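/- **Theorem.** Fix a positive integer $d$, and let $\mu:\mathbb N\to\mathbb N$ be such that multiplying two integers with at most $s$ bits costs $\mu(s)$ operations (up to one further step), where, as usual, $\mu$ is nondecreasing, $s=O(\mu(s))$ and $\mu(2s)=O(\mu(s))$. Adding, subtracting and comparing integers has linear bit cost, and division with remainder costs as much as schoolbook long division. A *frame* is an ordered set of affinely independent points of $\mathbb Q^d$; $\operatorname{Span}$ is the affine span over $\mathbb Q$; a frame $Q$ *covers* $\Lambda\subseteq\mathbb Z^d$ if $\Lambda\subseteq\operatorname{Span}(Q)$; a $\Lambda$-frame is a frame contained in $\Lambda$. $\mathrm{CFWF}(\Lambda,Q)$, for a finite $\Lambda\subseteq\mathbb Z^d$ and a frame $Q$ that covers $\Lambda$, is computed as follows. Start with $T=Q\cap\Lambda$, ordered as in $Q$; while $|T|<1+\dim\operatorname{Span}(\Lambda)$, append to $T$ the point of $\Lambda\setminus\operatorname{Span}(T)$ whose coordinates with respect to $Q$ are lexicographically minimal. Write $T=(p_0,\dots,p_k)$, let $M$ be the matrix with columns $p_1-p_0,\dots,p_k-p_0$, compute (by integer row operations based on the extended Euclidean algorithm) some $A\in GL(d,\mathbb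 Z)$ such that $AM$ is the Hermite normal form of $M$, put $\psi(x)=A(x-p_0)$, and return $(\psi(\Lambda),\psi(T))$. $\mathrm{EquivariantFrames2}(\Lambda,Q)$, for a finite $\Lambda\subseteq\mathbb Z^d$ and a frame $Q\subseteq\mathbb Q^d$, is the following recursive algorithm. 1. Replace $\Lambda$ by $\Lambda\setminus\operatorname{Span}(Q)$. If now $|\Lambda|\le 1$, return $\{\Lambda\}$. 2. If all the points of $\Lambda$ are congruent modulo $2$, choose $p\in\Lambda$, let $S'=\mathrm{EquivariantFrames2}((\Lambda-p)/2,(Q-p)/2)$, and return $2S'+p$. 3. Otherwise, partition $\Lambda$ into its congruence classes modulo $2$, sorted so that $|\Lambda_1|\le\dots\le|\Lambda_h|$. * If $|\Lambda_h|\le|\Lambda|/2$: let $S_i=\mathrm{EquivariantFrames2}(\Lambda_i,Q)$ for $1\le i\le h$, and $\Lambda'=\bigcup_{i}\bigcup_{V\in S_i}V$. Return the set of those $\Lambda'$-frames $R$ with $Q\cap R=\varnothing$ and $Q\cup R$ a frame covering $\Lambda$ for which $\mathrm{CFWF}(\Lambda,Q\cup R)$ is lexicographically minimal. * If $|\Lambda_h|>|\Lambda|/2$: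 let $S_i=\mathrm{EquivariantFrames2}(\Lambda_i,Q)$ for $1\le i\le h-1$, and $\Lambda'=\bigcup_{i<h}\bigcup_{V\in S_i}V$. Let $E$ be the set of $\Lambda'$-frames $R$ with $Q\cap R=\varnothing$ and $Q\cup R$ a frame covering $\Lambda\setminus\Lambda_h$. For each $R\in E$ let $S_R=\mathrm{EquivariantFrames2}(\Lambda_h,Q\cup R)$. Return the set of those $R\cup T$ ($R\in E$, $T\in S_R$) for which $\mathrm{CFWF}(\Lambda,Q\cup R\cup T)$ is lexicographically minimal. (The algorithm is implemented with sets as lists, rational points in integral homogeneous coordinates, division-free elimination for spans and coordinates, the first listed point as $p$ in step 2, and merge sort for ordering the sets that are compared.) Then there is a constant $C$, depending only on $d$ and $\mu$, such that for every finite set $\Lambda\subseteq\mathbb Z^d$ with $n=|\Lambda|\ge 2$, every frame $Q\subseteq\mathbb Q^d$, and every $s$ such that all coordinates of the points of $\Lambda$, and all numerators and denominators of the coordinates of the points of $Q$, have at most $s$ bits (not counting the sign), the execution of $\mathrm{EquivariantFrames2}(\Lambda,Q)$ terminates after at most $$C\,n\,\log_2^2 n\;s\,\mu(s)$$ operations.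 -/

import Mathlib

/-!
Cost model.  A program is a Lean function with values in `Timed α`: a result together with the
number of elementary (bit) operations spent.  Arithmetic on integers is available only through
`addI`, `subI`, `mulI`, `divI`; list traversals and comparisons of integers, points and lists are
charged as well.  A vector of fixed length is a function on a finite index type.
-/

namespace LatticeFrames

/-- A result together with the number of elementary operations used to obtain it. -/
structure Timed (α : Type) where
  val : α
  cost : ℕ

instance : Monad Timed where
  pure a := ⟨a, 0⟩
  bind x f := ⟨(f x.val).val, x.cost + (f x.val).cost⟩

/-- Spend `c` operations. -/
def tick (c : ℕ) : Timed Unit := ⟨(), c⟩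

/-- Length of the binary representation of `|x|`. -/
def bits (x : ℤ) : ℕ := x.natAbs.size

/-! ### Integer arithmetic -/

/-- Addition: linear cost. -/
def addI (x y : ℤ) : Timed ℤ := ⟨x + y, 1 + bits x + bits y⟩

/-- Subtraction: linear cost. -/
def subI (x y : ℤ) : Timed ℤ := ⟨x - y, 1 + bits x + bits y⟩

/-- Multiplication of two integers with at most `s` bits costs `μ s` (and one further step). -/
def mulI (μ : ℕ → ℕ) (x y : ℤ) : Timed ℤ := ⟨x * y, 1 + μ (max (bits x) (bits y))⟩

/-- Division with remainder, at the cost of long division: one pass over the dividend, and one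
pass over the divisor for each bit of the quotient.  The remainder `x % y` is a by-product. -/
def divI (x y : ℤ) : Timed ℤ := ⟨x / y, 1 + bits x + (bits (x / y) + 1) * (bits y + 1)⟩

/-! ### Loops -/

/-- Compute every coordinate of a vector. -/
def vecT {ι : Type} [Fintype ι] (f : ι → Timed ℤ) : Timed (ι → ℤ) :=
  ⟨fun i => (f i).val, ∑ i, (1 + (f i).cost)⟩

/-- Apply a program to every element of a list. -/
def mapT {α β : Type} (f : α → Timed β) (l : List α) : Timed (List β) :=
  ⟨l.map fun a => (f a).val, 1 + (l.map fun a => 1 + (f a).cost).sum⟩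

/-- Keep the elements of a list that pass a test. -/
def filterT {α : Type} (f : α → Timed Bool) (l : List α) : Timed (List α) :=
  ⟨l.filter fun a => (f a).val, 1 + (l.map fun a => 1 + (f a).cost).sum⟩

/-- Test whether all the elements of a list pass a test (the whole list is always scanned). -/
def allT {α : Type} (f : α → Timed Bool) (l : List α) : Timed Bool :=
  ⟨l.all fun a => (f a).val, 1 + (l.map fun a => 1 + (f a).cost).sum⟩

/-- Iterate over a list, updating a state. -/
def foldT {α β : Type} (f : β → α → Timed β) : β → List α → Timed β
  | b, [] => do
      tick 1
      pure b
  | b, a :: l => do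
      tick 1
      let b' ← f b a
      foldT f b' l

/-- Concatenate a list of lists. -/
def flattenT {α : Type} (L : List (List α)) : Timed (List α) :=
  ⟨L.flatten, 1 + L.length + L.flatten.length⟩

/-- Merge two sorted lists. -/
def mergeT {α : Type} (le : α → α → Timed Bool) : List α → List α → Timed (List α)
  | [], bs => do
      tick 1
      pure bs
  | a :: as, [] => do
      tick 1
      pure (a :: as)
  | a :: as, b :: bs => do
      tick 1
      let c ← le a b
      if c then
        let r ← mergeT le as (b :: bs)
        pure (a :: r)
      else
        let r ← mergeT le (a :: as) bs
        pure (b :: r)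
termination_by as bs => as.length + bs.length

/-- Merge sort. -/
def sortT {α : Type} (le : α → α → Timed Bool) (l : List α) : Timed (List α) :=
  if h : l.length ≤ 1 then do
    tick 1
    pure l
  else do
    tick (1 + l.length)
    let a ← sortT le (l.take (l.length / 2))
    let b ← sortT le (l.drop (l.length / 2))
    mergeT le a b
termination_by l.length
decreasing_by
  · simp only [List.length_take]; omega
  · simp only [List.length_drop]; omega

/-- Remove repetitions from a list, given an equality test. -/
def dedupT {α : Type} (eq : α → α → Timed Bool) : List α → Timed (List α)
  | [] => do
      tick 1
      pure []
  | a :: l => do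
      tick 1
      let r ← dedupT eq l
      let same ← filterT (eq a) r
      if same.isEmpty then pure (a :: r) else pure r

/-- All the lists of length at most `k` with entries in `l`. -/
def wordsT {α : Type} (l : List α) : ℕ → Timed (List (List α))
  | 0 => do
      tick 1
      pure [[]]
  | k + 1 => do
      let W ← wordsT l k
      let L ← mapT (fun a => mapT (fun w => pure (a :: w)) W) l
      let L' ← flattenT L
      pure ([] :: L')

/-! ### Points, comparisons -/

/-- A point of the lattice `ℤ^d`. -/
abbrev Pt (d : ℕ) := Fin d → ℤ

/-- A point of `ℚ^d` in integral homogeneous coordinates: `x` stands for the point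
`(x 1 / x 0, …, x d / x 0)`, with `x 0 > 0`. -/
abbrev HPt (d : ℕ) := Fin (d + 1) → ℤ

/-- Homogeneous coordinates of a lattice point. -/
def hom {d : ℕ} (p : Pt d) : HPt d := Fin.cons 1 p

/-- Homogeneous coordinates of a rational point, the coordinate `0` being the product of the
denominators of its coordinates. -/
def homogenize (μ : ℕ → ℕ) {d : ℕ} (q : Fin d → ℚ) : Timed (HPt d) :=
  vecT fun k => foldT
    (fun acc j => mulI μ acc (if k = Fin.succ j then (q j).num else ((q j).den : ℤ)))
    1 (List.finRange d)

/-- Lexicographic comparison of two lists of integers. -/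
def lexLe (a b : List ℤ) : Timed Bool :=
  ⟨decide (a ≤ b), 1 + (a.map fun x => 1 + bits x).sum + (b.map fun x => 1 + bits x).sum⟩

/-- Equality of two lists of integers. -/
def listEq (a b : List ℤ) : Timed Bool :=
  ⟨decide (a = b), 1 + (a.map fun x => 1 + bits x).sum + (b.map fun x => 1 + bits x).sum⟩

/-- Equality of two lattice points. -/
def ptEq {d : ℕ} (p q : Pt d) : Timed Bool := listEq (List.ofFn p) (List.ofFn q)

/-- Lexicographic comparison of two lattice points. -/
def ptLe {d : ℕ} (p q : Pt d) : Timed Bool := lexLe (List.ofFn p) (List.ofFn q)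

/-- Does the vector vanish? -/
def isZero {ι : Type} [Fintype ι] (x : ι → ℤ) : Timed Bool :=
  ⟨decide (∀ i, x i = 0), 1 + ∑ i, (1 + bits (x i))⟩

/-- Equality of a rational point (in homogeneous coordinates) and a lattice point. -/
def eqHom (μ : ℕ → ℕ) {d : ℕ} (q : HPt d) (p : Pt d) : Timed Bool := do
  let y ← vecT fun i : Fin d => do
    let a ← mulI μ (q 0) (p i)
    subI (q i.succ) a
  isZero y

/-- Congruence modulo `2` of two lattice points. -/
def congrTwo {d : ℕ} (p q : Pt d) : Timed Bool :=
  ⟨decide (∀ i, p i % 2 = q i % 2), 1 + ∑ i, (1 + bits (p i) + bits (q i))⟩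

/-- Difference of two lattice points. -/
def subPt {d : ℕ} (p q : Pt d) : Timed (Pt d) := vecT fun i => subI (p i) (q i)

/-! ### Linear algebra without divisions -/

/-- A row of an echelon form, with the position of its pivot. -/
abbrev Row (ι : Type) := ι × (ι → ℤ)

/-- Reduce a vector modulo the rows of an echelon form. -/
def reduceT (μ : ℕ → ℕ) {ι : Type} [Fintype ι] (B : List (Row ι)) (x : ι → ℤ) :
    Timed (ι → ℤ) :=
  foldT (fun x r => vecT fun k => do
    let a ← mulI μ (r.2 r.1) (x k)
    let b ← mulI μ (x r.1) (r.2 k)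
    subI a b) x B

/-- Extend an echelon form by a further vector, unless that vector reduces to one which vanishes
at the admissible pivot positions `P`.  Pivots are made positive. -/
def extendT (μ : ℕ → ℕ) {ι : Type} [Fintype ι] (P : List ι) (B : List (Row ι)) (x : ι → ℤ) :
    Timed (List (Row ι)) := do
  let y ← reduceT μ B x
  tick (1 + (P.map fun k => 1 + bits (y k)).sum + B.length)
  match P.find? fun k => decide (y k ≠ 0) with
  | none => pure B
  | some k =>
      if y k < 0 then
        let z ← vecT fun i => subI 0 (y i)
        pure (B ++ [(k, z)])
      else
        pure (B ++ [(k, y)])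

/-- Echelon form of a list of points; its length is the number of affinely independent points
among them, that is `1 + dim Span`. -/
def spanBasis (μ : ℕ → ℕ) {d : ℕ} (Q : List (HPt d)) : Timed (List (Row (Fin (d + 1)))) :=
  foldT (extendT μ (List.finRange (d + 1))) [] Q

/-- Does the lattice point `p` belong to the affine span with echelon form `B`? -/
def inSpan (μ : ℕ → ℕ) {d : ℕ} (B : List (Row (Fin (d + 1)))) (p : Pt d) : Timed Bool := do
  let y ← reduceT μ B (hom p)
  isZero y

/-- The complement `Λ ∖ Span(Q)`. -/
def minusSpan (μ : ℕ → ℕ) {d : ℕ} (Λ : List (Pt d)) (Q : List (HPt d)) :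
    Timed (List (Pt d)) := do
  let B ← spanBasis μ Q
  filterT (fun p => do
    let b ← inSpan μ B p
    pure (!b)) Λ

/-- Concatenation `Q ∪ R` of a frame of rational points and a list of lattice points. -/
def joinFrame {d : ℕ} (Q : List (HPt d)) (R : List (Pt d)) : Timed (List (HPt d)) := do
  let H ← mapT (fun r => do tick (d + 1); pure (hom r)) R
  tick (1 + Q.length)
  pure (Q ++ H)

/-- Is `Q` affinely independent, with a span that contains `Λ`? -/
def isCoveringFrame (μ : ℕ → ℕ) {d : ℕ} (Λ : List (Pt d)) (Q : List (HPt d)) :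
    Timed Bool := do
  let B ← spanBasis μ Q
  let c ← allT (inSpan μ B) Λ
  tick (1 + Q.length)
  pure (decide (B.length = Q.length) && c)

/-- Are `Q` and `R` disjoint? -/
def disjointFrames (μ : ℕ → ℕ) {d : ℕ} (Q : List (HPt d)) (R : List (Pt d)) : Timed Bool :=
  allT (fun q => allT (fun r => do
    let b ← eqHom μ q r
    pure (!b)) R) Q

/-- The ordered sets `R` of points of `Λ'` such that `Q ∩ R = ∅` and `Q ∪ R` is a frame that
covers `Λ`. -/
def complementaryFrames (μ : ℕ → ℕ) {d : ℕ} (Λ' Λ : List (Pt d)) (Q : List (HPt d)) :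
    Timed (List (List (Pt d))) := do
  let W ← wordsT Λ' (d + 1)
  filterT (fun R => do
    let a ← disjointFrames μ Q R
    let QR ← joinFrame Q R
    let b ← isCoveringFrame μ Λ QR
    pure (a && b)) W

/-! ### Hermite normal form -/

/-- Extended Euclidean algorithm: `(g, x, y)` with `g = x * a + y * b` a greatest common
divisor of `a` and `b` (up to sign). -/
def xgcdT (μ : ℕ → ℕ) (a b : ℤ) : Timed (ℤ × ℤ × ℤ) :=
  if h : b = 0 then do
    tick 1
    pure (a, 1, 0)
  else do
    let q ← divI a b
    let e ← xgcdT μ b (a % b)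
    let t ← mulI μ q e.2.2
    let y ← subI e.2.1 t
    pure (e.1, e.2.2, y)
termination_by b.natAbs
decreasing_by
  have h1 := Int.emod_nonneg a h
  have h2 := Int.emod_lt_abs a h
  rw [Int.abs_eq_natAbs] at h2
  omega

/-- The combination `a • u + b • v`. -/
def combT (μ : ℕ → ℕ) {ι : Type} [Fintype ι] (a : ℤ) (u : ι → ℤ) (b : ℤ) (v : ι → ℤ) :
    Timed (ι → ℤ) :=
  vecT fun k => do
    let x ← mulI μ a (u k)
    let y ← mulI μ b (v k)
    addI x y

/-- A `d × d` matrix followed by a second one that records the row operations. -/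
abbrev AugMat (d : ℕ) := Fin d → Fin d ⊕ Fin d → ℤ

/-- Make the entry `(i, j)` zero by a unimodular transformation of the rows `r` and `i`. -/
def clearEntry (μ : ℕ → ℕ) {d : ℕ} (j r : Fin d) (R : AugMat d) (i : Fin d) :
    Timed (AugMat d) := do
  tick 1
  if R i (Sum.inl j) = 0 then pure R
  else
    let e ← xgcdT μ (R r (Sum.inl j)) (R i (Sum.inl j))
    let a ← divI (R r (Sum.inl j)) e.1
    let b ← divI (R i (Sum.inl j)) e.1
    let u ← combT μ e.2.1 (R r) e.2.2 (R i)
    let v ← combT μ a (R i) (-b) (R r)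
    pure (Function.update (Function.update R r u) i v)

/-- Subtract from the row `i` the multiple of the row `r` that brings the entry `(i, j)` between
`0` and the pivot `(r, j)`. -/
def reduceEntry (μ : ℕ → ℕ) {d : ℕ} (j r : Fin d) (R : AugMat d) (i : Fin d) :
    Timed (AugMat d) := do
  let q ← divI (R i (Sum.inl j)) (R r (Sum.inl j))
  let v ← combT μ 1 (R i) (-q) (R r)
  pure (Function.update R i v)

/-- Treat the column `j`; the second component counts the pivots found so far. -/
def hermiteColumn (μ : ℕ → ℕ) {d : ℕ} (st : AugMat d × ℕ) (j : Fin d) :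
    Timed (AugMat d × ℕ) := do
  tick (1 + 2 * d)
  if h : st.2 < d then
    let r : Fin d := ⟨st.2, h⟩
    let R ← foldT (clearEntry μ j r) st.1 ((List.finRange d).filter fun i => decide (r < i))
    if R r (Sum.inl j) = 0 then pure (R, st.2)
    else
      let w ← if R r (Sum.inl j) < 0 then vecT fun k => subI 0 (R r k) else pure (R r)
      let R' ← foldT (reduceEntry μ j r) (Function.update R r w)
        ((List.finRange d).filter fun i => decide (i < r))
      pure (R', st.2 + 1)
  else pure st

/-- A matrix `A ∈ GL(d, ℤ)` such that `A * M` is the (row style) Hermite normal form of `M`: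
echelon form, positive pivots, the entries above a pivot nonnegative and less than the pivot. -/
def hermiteT (μ : ℕ → ℕ) {d : ℕ} (M : Fin d → Fin d → ℤ) : Timed (Fin d → Fin d → ℤ) := do
  tick (1 + 2 * d * d)
  let st ← foldT (hermiteColumn μ)
    ((fun i => Sum.elim (M i) (fun j => if i = j then 1 else 0) : AugMat d), 0)
    (List.finRange d)
  pure fun i j => st.1 i (Sum.inr j)

/-- Product of a matrix and a vector. -/
def mulVecT (μ : ℕ → ℕ) {d : ℕ} (A : Fin d → Fin d → ℤ) (x : Pt d) : Timed (Pt d) :=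
  vecT fun i => foldT (fun acc j => do
    let m ← mulI μ (A i j) (x j)
    addI acc m) 0 (List.finRange d)

/-! ### Canonical form, given a frame -/

/-- Echelon form of a frame `Q`, in which the second half of each row records the row as a
combination of the elements of `Q`. -/
def frameBasis (μ : ℕ → ℕ) {d : ℕ} (Q : List (HPt d)) :
    Timed (List (Row (Fin (d + 1) ⊕ Fin (d + 1)))) := do
  tick (1 + (2 * d + 2) * Q.length)
  foldT (extendT μ ((List.finRange (d + 1)).map Sum.inl)) []
    (Q.zipIdx.map fun qi => Sum.elim qi.1 fun j => if j.val = qi.2 then 1 else 0)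

/-- The coordinates of `p` with respect to the frame `Q = (q₀, q₁, …)` with echelon form `C`
(origin `q₀`, axes `qᵢ - q₀`), where the `i`-th coordinate is multiplied by a positive integer
that does not depend on `p`. -/
def coordT (μ : ℕ → ℕ) {d : ℕ} (C : List (Row (Fin (d + 1) ⊕ Fin (d + 1)))) (p : Pt d) :
    Timed (Fin d → ℤ) := do
  let y ← reduceT μ C (Sum.elim (hom p) fun _ => 0)
  vecT fun i => subI 0 (y (Sum.inr i.succ))

/-- Add to `T`, `m` times, the point outside `Span(T)` with the least coordinates; `K` is the list
of the points of `Λ`, together with their coordinates. -/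
def completeFrame (μ : ℕ → ℕ) {d : ℕ} (K : List (Pt d × (Fin d → ℤ))) :
    ℕ → List (Pt d) → Timed (List (Pt d))
  | 0, T => pure T
  | m + 1, T => do
      let H ← joinFrame [] T
      let B ← spanBasis μ H
      let cand ← filterT (fun x => do
        let b ← inSpan μ B x.1
        pure (!b)) K
      match cand with
      | [] => pure T
      | c :: cs =>
          let best ← foldT (fun x y => do
            let b ← ptLe x.2 y.2
            pure (if b then x else y)) c cs
          tick (1 + T.length)
          completeFrame μ K m (T ++ [best.1])

/-- `CanonicalFormWithFrame(Λ, Q)`.  The first component of the result, which is a set of points,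
is returned as a lexicographically sorted list. -/
def canonicalFormWithFrame (μ : ℕ → ℕ) {d : ℕ} (Λ : List (Pt d)) (Q : List (HPt d)) :
    Timed (List (Pt d) × List (Pt d)) := do
  let I ← mapT (fun q => filterT (eqHom μ q) Λ) Q
  let T₀ ← flattenT I
  let H ← joinFrame [] Λ
  let B ← spanBasis μ H
  let C ← frameBasis μ Q
  let K ← mapT (fun p => do
    let c ← coordT μ C p
    pure (p, c)) Λ
  tick (1 + B.length + T₀.length)
  let T ← completeFrame μ K (B.length - T₀.length) T₀
  match T with
  | [] => pure ([], [])
  | p₀ :: ps =>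
      let cols ← mapT (fun p => subPt p p₀) ps
      let A ← hermiteT μ fun i j => cols.getD j (fun _ => 0) i
      let Ω ← mapT (fun x => do
        let y ← subPt x p₀
        mulVecT μ A y) Λ
      let U ← mapT (fun x => do
        let y ← subPt x p₀
        mulVecT μ A y) (p₀ :: ps)
      let Ω' ← sortT ptLe Ω
      pure (Ω', U)

/-- The members `R` of the list `L` for which `CanonicalFormWithFrame(Λ, Q ∪ R)` is
lexicographically minimal. -/
def selectMinimal (μ : ℕ → ℕ) {d : ℕ} (Λ : List (Pt d)) (Q : List (HPt d))
    (L : List (List (Pt d))) : Timed (List (List (Pt d))) := do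
  let K ← mapT (fun R => do
    let QR ← joinFrame Q R
    let f ← canonicalFormWithFrame μ Λ QR
    let key ← flattenT ((f.1 ++ f.2).map List.ofFn)
    pure (R, key)) L
  match K with
  | [] => pure []
  | k :: ks =>
      let least ← foldT (fun m x => do
        let b ← lexLe m x.2
        pure (if b then m else x.2)) k.2 ks
      let F ← filterT (fun x => listEq x.2 least) K
      mapT (fun x => pure x.1) F

/-! ### The recursive algorithm -/

/-- Put a point into its congruence class modulo `2`. -/
def insertClass {d : ℕ} (p : Pt d) : List (List (Pt d)) → Timed (List (List (Pt d)))
  | [] => do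
      tick 1
      pure [[p]]
  | c :: cs => do
      let b ← congrTwo p (c.headD p)
      if b then pure ((p :: c) :: cs)
      else
        let cs' ← insertClass p cs
        pure (c :: cs')

/-- Partition into congruence classes modulo `2`. -/
def partitionTwo {d : ℕ} (Λ : List (Pt d)) : Timed (List (List (Pt d))) :=
  foldT (fun cs p => insertClass p cs) [] Λ

/-- Sort a list of lists by size. -/
def sortBySize {α : Type} (L : List (List α)) : Timed (List (List α)) :=
  sortT (fun a b => ⟨decide (a.length ≤ b.length), 1 + a.length + b.length⟩) L

/-- The union of all the frames in a list of lists of frames, as a list without repetitions. -/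
def unionT {d : ℕ} (Ss : List (List (List (Pt d)))) : Timed (List (Pt d)) := do
  let L ← flattenT Ss
  let P ← flattenT L
  dedupT ptEq P

/-- `(x - p) / 2` for lattice points `x` and `p` that are congruent modulo `2`. -/
def halvePt {d : ℕ} (p x : Pt d) : Timed (Pt d) :=
  vecT fun i => do
    let y ← subI (x i) (p i)
    divI y 2

/-- `(q - p) / 2` for a rational point `q`, in homogeneous coordinates. -/
def halveHPt (μ : ℕ → ℕ) {d : ℕ} (p : Pt d) (q : HPt d) : Timed (HPt d) :=
  vecT fun k => Fin.cases (addI (q 0) (q 0)) (fun i => do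
    let a ← mulI μ (q 0) (p i)
    subI (q i.succ) a) k

/-- `2 x + p`. -/
def doublePt {d : ℕ} (p x : Pt d) : Timed (Pt d) :=
  vecT fun i => do
    let y ← addI (x i) (x i)
    addI y (p i)

/-- A possibly nonterminating computation: a function of the number of operations spent so far,
which returns the result and the updated number, or `none` if the computation does not terminate. -/
abbrev Run := StateT ℕ Option

/-- Execute a terminating program and count its operations. -/
def exec {α : Type} (x : Timed α) : Run α := fun t => some (x.val, t + x.cost)

/-- `EquivariantFrames2(Λ₀, Q)`, for `Λ₀` a list of lattice points without repetitions and `Q` a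
frame of rational points in homogeneous coordinates.  `Λ` is `Λ₀ ∖ Span(Q)`; "any point" of `Λ` is
the first one in the list. -/
def equivariantFramesRec (μ : ℕ → ℕ) {d : ℕ} (Λ₀ : List (Pt d)) (Q : List (HPt d)) :
    Run (List (List (Pt d))) := do
  let Λ ← exec (minusSpan μ Λ₀ Q)
  exec (tick (1 + Λ.length))
  match Λ with
  | [] => pure [[]]
  | [p] => pure [[p]]
  | p :: _ :: _ =>
    let same ← exec (allT (congrTwo p) Λ)
    if same then
      let Λ' ← exec (mapT (halvePt p) Λ)
      let Q' ← exec (mapT (halveHPt μ p) Q)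
      let S' ← equivariantFramesRec μ Λ' Q'
      exec (mapT (mapT (doublePt p)) S')
    else
      let classes ← exec (partitionTwo Λ)
      let sorted ← exec (sortBySize classes)
      let small := sorted.dropLast
      let big := sorted.getLastD []
      exec (tick (1 + sorted.length + Λ.length))
      if 2 * big.length ≤ Λ.length then
        let Ss ← sorted.mapM fun c => equivariantFramesRec μ c Q
        let Λ' ← exec (unionT Ss)
        let L ← exec (complementaryFrames μ Λ' Λ Q)
        exec (selectMinimal μ Λ Q L)
      else
        let Ss ← small.mapM fun c => equivariantFramesRec μ c Q
        let Λ' ← exec (unionT Ss)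
        let rest ← exec (flattenT small)
        let E ← exec (complementaryFrames μ Λ' rest Q)
        let Ls ← E.mapM fun R => do
          let QR ← exec (joinFrame Q R)
          let S ← equivariantFramesRec μ big QR
          exec (mapT (fun T => do tick (1 + R.length); pure (R ++ T)) S)
        let L ← exec (flattenT Ls)
        exec (selectMinimal μ Λ Q L)
  partial_fixpoint

/-- `EquivariantFrames2(Λ, Q)`, for a frame `Q` of rational points. -/
def equivariantFrames2 (μ : ℕ → ℕ) {d : ℕ} (Λ : List (Fin d → ℤ)) (Q : List (Fin d → ℚ)) :
    Run (List (List (Fin d → ℤ))) := do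
  let H ← exec (mapT (homogenize μ) Q)
  equivariantFramesRec μ Λ H

end LatticeFrames

/-! The bound rests on three facts: all integers that occur have O(s) bits, every recursive call
returns a bounded number of frames, and the resulting recursion for the cost can be solved by
induction on the codimension of the frame.

Sizes and local costs. Since μ(2s) = O(μ(s)), an operation on integers of O(s) bits costs O(μ(s))
(`IsMulCost.exists_op`). An echelon form has no more rows than there are coordinates, so
division-free elimination enlarges the entries only by a factor depending on d
(`exists_foldT_extendT_bound`). The quotients of a Euclidean algorithm have O(s) bits altogether, so
the extended algorithm costs O(s μ(s)), and so does the Hermite transformation, which calls it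
boundedly often (`exists_xgcdT_bound`, `exists_hermiteT_bound`). With the sorting of the transformed
points, a canonical form costs O(n log n · s μ(s)) (`exists_canonicalForm_bound`). During the
recursion the sizes are controlled by `Admissible`: the points of Λ differ by less than 2^k, a
halving lowers k by one and doubles the denominator q₀ of each rational frame point, and so the
bound for q₀ 2^k persists.

Number of frames. Suppose that R and R' give the same canonical form, with charts x ↦ A(x - p) and x
↦ A'(x - p'). Both charts have the same image of Λ, so A⁻¹A' is the linear part of an affine
permutation of Λ. If A ≡ A' mod 3, Minkowski's argument shows that this permutation is trivial
(`eq_of_mulVec_eq`). Hence a minimal frame is determined by its length and a matrix over ℤ/3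
(`card_toFinset_selectMinimal_le`), however many candidates there were. A list can be repeated only
because it splits in several ways as R followed by T, and R has boundedly many possible lengths
(`length_filter_isPrefix_le`).

The recursion. A call is charged C μ(s) n (k + s (log n + 1)²). A halving lowers k, which pays for
its linear cost. If no congruence class contains more than half of the points, the logarithm drops
by one in every class, and the difference of the squares pays for the canonical forms. Otherwise the
small classes are charged with the same C, while the large class is treated boundedly often, each
time with a frame enlarged by a nonempty R, because points outside Span(Q) have to be covered. The
constant C₀ for larger frames is known from an outer induction on d + 2 - |Q|. As the large class
has more than n/2 points, a sufficiently large C pays for these calls and for the step itself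
(`exists_splitStep_bound`, `exists_solves`). There is no circularity, since the bound for the output
of a call depends only on the bound for larger frames. -/

namespace LatticeFrames

/-! ### Sizes of integers -/

theorem bits_le_iff {x : ℤ} {b : ℕ} : bits x ≤ b ↔ x.natAbs < 2 ^ b := Nat.size_le

theorem bits_mono {x y : ℤ} (h : x.natAbs ≤ y.natAbs) : bits x ≤ bits y := Nat.size_le_size h

theorem bits_zero : bits 0 = 0 := by simp [bits]

theorem bits_one : bits 1 = 1 := by simp [bits]

theorem bits_neg (x : ℤ) : bits (-x) = bits x := by simp [bits]

theorem bits_le_of_abs_le {x : ℤ} {b : ℕ} (h : |x| ≤ 2 ^ b) : bits x ≤ b + 1 := by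
  rw [bits_le_iff]
  have : (x.natAbs : ℤ) ≤ 2 ^ b := by rwa [← Int.abs_eq_natAbs]
  have : x.natAbs ≤ 2 ^ b := by exact_mod_cast this
  calc x.natAbs ≤ 2 ^ b := this
    _ < 2 ^ (b + 1) := Nat.pow_lt_pow_right (by norm_num) (by omega)

theorem abs_lt_of_bits_le {x : ℤ} {b : ℕ} (h : bits x ≤ b) : |x| < 2 ^ b := by
  rw [bits_le_iff] at h
  rw [Int.abs_eq_natAbs]
  exact_mod_cast h

theorem bits_add_le {x y : ℤ} {b : ℕ} (hx : bits x ≤ b) (hy : bits y ≤ b) :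
    bits (x + y) ≤ b + 1 := by
  rw [bits_le_iff] at *
  have h3 := Int.natAbs_add_le x y
  rw [pow_succ]
  omega

theorem bits_sub_le {x y : ℤ} {b : ℕ} (hx : bits x ≤ b) (hy : bits y ≤ b) :
    bits (x - y) ≤ b + 1 := by
  rw [sub_eq_add_neg]
  exact bits_add_le hx (by rwa [bits_neg])

theorem bits_mul_le {x y : ℤ} {b c : ℕ} (hx : bits x ≤ b) (hy : bits y ≤ c) :
    bits (x * y) ≤ b + c := by
  rw [bits_le_iff] at *
  rw [Int.natAbs_mul, pow_add]
  exact Nat.mul_lt_mul'' hx hy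

theorem bits_ediv_le (x y : ℤ) : bits (x / y) ≤ bits x :=
  bits_mono (Int.natAbs_ediv_le_natAbs x y)

/-! ### Costs of loops -/

section Timed

variable {α β : Type}

@[simp] theorem pure_val (a : α) : (pure a : Timed α).val = a := rfl
@[simp] theorem pure_cost (a : α) : (pure a : Timed α).cost = 0 := rfl
@[simp] theorem bind_val (x : Timed α) (f : α → Timed β) : (x >>= f).val = (f x.val).val := rfl
@[simp] theorem bind_cost (x : Timed α) (f : α → Timed β) :
    (x >>= f).cost = x.cost + (f x.val).cost := rfl
@[simp] theorem tick_cost (c : ℕ) : (tick c).cost = c := rfl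

@[simp] theorem addI_val (x y : ℤ) : (addI x y).val = x + y := rfl
@[simp] theorem subI_val (x y : ℤ) : (subI x y).val = x - y := rfl
@[simp] theorem mulI_val (μ : ℕ → ℕ) (x y : ℤ) : (mulI μ x y).val = x * y := rfl
@[simp] theorem divI_val (x y : ℤ) : (divI x y).val = x / y := rfl

@[simp] theorem vecT_val {ι : Type} [Fintype ι] (f : ι → Timed ℤ) :
    (vecT f).val = fun i => (f i).val := rfl
@[simp] theorem mapT_val (f : α → Timed β) (l : List α) :
    (mapT f l).val = l.map fun a => (f a).val := rfl
@[simp] theorem filterT_val (f : α → Timed Bool) (l : List α) :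
    (filterT f l).val = l.filter fun a => (f a).val := rfl
@[simp] theorem allT_val (f : α → Timed Bool) (l : List α) :
    (allT f l).val = l.all fun a => (f a).val := rfl
@[simp] theorem flattenT_val (L : List (List α)) : (flattenT L).val = L.flatten := rfl

theorem vecT_cost_le {ι : Type} [Fintype ι] {f : ι → Timed ℤ} {c D : ℕ}
    (hD : Fintype.card ι ≤ D) (h : ∀ i, (f i).cost ≤ c) : (vecT f).cost ≤ D * (1 + c) := by
  calc (vecT f).cost = ∑ i, (1 + (f i).cost) := rfl
    _ ≤ ∑ _i : ι, (1 + c) := Finset.sum_le_sum fun i _ => by have := h i; omega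
    _ = Fintype.card ι * (1 + c) := by simp
    _ ≤ D * (1 + c) := by gcongr

theorem sum_map_le {f : α → ℕ} {l : List α} {c : ℕ} (h : ∀ a ∈ l, f a ≤ c) :
    (l.map f).sum ≤ l.length * c := by
  induction l with
  | nil => simp
  | cons a l ih =>
    have h1 := h a (by simp)
    have h2 := ih fun b hb => h b (by simp [hb])
    simp only [List.map_cons, List.sum_cons, List.length_cons, add_mul, one_mul]
    omega

theorem mapT_cost_le {f : α → Timed β} {l : List α} {c N : ℕ} (hN : l.length ≤ N)
    (h : ∀ a ∈ l, (f a).cost ≤ c) : (mapT f l).cost ≤ 1 + N * (1 + c) := by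
  have := sum_map_le (f := fun a => 1 + (f a).cost) (c := 1 + c) fun a ha => by
    have := h a ha; omega
  calc (mapT f l).cost ≤ 1 + l.length * (1 + c) := Nat.add_le_add_left this 1
    _ ≤ 1 + N * (1 + c) := by gcongr

theorem filterT_cost_le {f : α → Timed Bool} {l : List α} {c N : ℕ} (hN : l.length ≤ N)
    (h : ∀ a ∈ l, (f a).cost ≤ c) : (filterT f l).cost ≤ 1 + N * (1 + c) :=
  mapT_cost_le (f := f) hN h

theorem allT_cost_le {f : α → Timed Bool} {l : List α} {c N : ℕ} (hN : l.length ≤ N)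
    (h : ∀ a ∈ l, (f a).cost ≤ c) : (allT f l).cost ≤ 1 + N * (1 + c) :=
  mapT_cost_le (f := f) hN h

theorem flattenT_cost_le {L : List (List α)} {M N : ℕ} (hM : L.length ≤ M)
    (hN : L.flatten.length ≤ N) : (flattenT L).cost ≤ 1 + M + N := by
  calc (flattenT L).cost = 1 + L.length + L.flatten.length := rfl
    _ ≤ _ := by gcongr

theorem length_flatten_le {L : List (List α)} {M N : ℕ} (hM : L.length ≤ M)
    (hN : ∀ l ∈ L, l.length ≤ N) : L.flatten.length ≤ M * N := by
  rw [List.length_flatten]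
  exact (sum_map_le hN).trans (by gcongr)

theorem foldT_cons (f : β → α → Timed β) (b : β) (a : α) (l : List α) :
    foldT f b (a :: l) = ⟨(foldT f (f b a).val l).val,
      1 + ((f b a).cost + (foldT f (f b a).val l).cost)⟩ := rfl

/-- A loop with an invariant that depends on the number of iterations. -/
theorem foldT_le {f : β → α → Timed β} (P : ℕ → β → Prop) {c N : ℕ} {l : List α}
    (h : ∀ i b, ∀ a ∈ l, i < N → P i b → P (i + 1) (f b a).val ∧ (f b a).cost ≤ c)
    {b : β} {i : ℕ} (hb : P i b) (hN : i + l.length ≤ N) :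
    P (i + l.length) (foldT f b l).val ∧ (foldT f b l).cost ≤ 1 + l.length * (1 + c) := by
  induction l generalizing b i with
  | nil => exact ⟨hb, by simp [foldT]⟩
  | cons a l ih =>
    simp only [List.length_cons] at hN
    obtain ⟨h1, h2⟩ := h i b a (by simp) (by omega) hb
    obtain ⟨h3, h4⟩ := ih (fun i b a' ha' => h i b a' (by simp [ha'])) h1 (by omega)
    rw [foldT_cons]
    refine ⟨?_, ?_⟩
    · rwa [List.length_cons, show i + (l.length + 1) = i + 1 + l.length by ring]
    · simp only [List.length_cons, add_mul, one_mul]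
      omega

/-- A loop with an invariant. -/
theorem foldT_inv {f : β → α → Timed β} (P : β → Prop) {c N : ℕ} {l : List α}
    (h : ∀ b, ∀ a ∈ l, P b → P (f b a).val ∧ (f b a).cost ≤ c)
    {b : β} (hb : P b) (hN : l.length ≤ N) :
    P (foldT f b l).val ∧ (foldT f b l).cost ≤ 1 + N * (1 + c) := by
  obtain ⟨h1, h2⟩ := foldT_le (fun _ => P) (N := l.length) (i := 0)
    (fun _ b a ha _ hb => h b a ha hb) hb (by simp)
  exact ⟨h1, h2.trans (by gcongr)⟩

end Timed

/-! ### The cost of multiplication -/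

/-- The standing hypotheses on the cost of multiplication. -/
structure IsMulCost (μ : ℕ → ℕ) : Prop where
  mono : Monotone μ
  linear : ∃ c : ℕ, ∀ s, s ≤ c * μ s
  double : ∃ K : ℕ, ∀ s, μ (2 * s) ≤ K * μ s

variable {μ : ℕ → ℕ}

/-- Allows additive constants and loop overheads to be absorbed into multiples of `μ s` throughout.
-/
theorem IsMulCost.one_le (hμ : IsMulCost μ) {s : ℕ} (hs : 1 ≤ s) : 1 ≤ μ s := by
  obtain ⟨c, hc⟩ := hμ.linear
  by_contra h
  have h0 : μ s = 0 := by omega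
  have := hc s
  rw [h0] at this
  omega

/-- Since `a ≤ 2 ^ a`, it suffices to apply the doubling property `a` times. -/
theorem IsMulCost.scale (hμ : IsMulCost μ) (a : ℕ) : ∃ C, ∀ s b, b ≤ a * s → μ b ≤ C * μ s := by
  obtain ⟨K, hK⟩ := hμ.double
  have key : ∀ j s, μ (2 ^ j * s) ≤ K ^ j * μ s := by
    intro j
    induction j with
    | zero => simp
    | succ j ih =>
      intro s
      calc μ (2 ^ (j + 1) * s) = μ (2 * (2 ^ j * s)) := by ring_nf
        _ ≤ K * μ (2 ^ j * s) := hK _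
        _ ≤ K * (K ^ j * μ s) := Nat.mul_le_mul_left _ (ih s)
        _ = K ^ (j + 1) * μ s := by ring
  refine ⟨K ^ a, fun s b hb => (hμ.mono (hb.trans ?_)).trans (key a s)⟩
  exact Nat.mul_le_mul_right _ (Nat.lt_two_pow_self).le

/-- Elementary operations with integers of `a * s` bits cost `O(μ s)`. -/
theorem IsMulCost.exists_op (hμ : IsMulCost μ) (a : ℕ) : ∃ C, ∀ s, 1 ≤ s → ∀ b, b ≤ a * s →
    1 + b ≤ C * μ s ∧ 1 + μ b ≤ C * μ s := by
  obtain ⟨C, hC⟩ := hμ.scale a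
  obtain ⟨c, hc⟩ := hμ.linear
  refine ⟨1 + a * c + C, fun s hs b hb => ?_⟩
  have h1 := hμ.one_le hs
  have h2 := hC s b hb
  have h3 : a * s ≤ a * (c * μ s) := Nat.mul_le_mul_left _ (hc s)
  have h4 : (1 + a * c + C) * μ s = μ s + a * (c * μ s) + C * μ s := by ring
  constructor <;> rw [h4] <;> omega

theorem mulI_cost_le {x y : ℤ} {b w : ℕ} (hμ : IsMulCost μ) (hx : bits x ≤ b) (hy : bits y ≤ b)
    (h : 1 + μ b ≤ w) : (mulI μ x y).cost ≤ w :=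
  (Nat.add_le_add_left (hμ.mono (max_le hx hy)) 1).trans h

theorem addI_cost_le {x y : ℤ} {b w : ℕ} (hx : bits x ≤ b) (hy : bits y ≤ b)
    (h : 1 + b ≤ w) : (addI x y).cost ≤ 2 * w := by
  have : (addI x y).cost = 1 + bits x + bits y := rfl
  omega

theorem subI_cost_le {x y : ℤ} {b w : ℕ} (hx : bits x ≤ b) (hy : bits y ≤ b)
    (h : 1 + b ≤ w) : (subI x y).cost ≤ 2 * w :=
  addI_cost_le hx hy h

/-! ### Comparisons -/

theorem isZero_cost_le {ι : Type} [Fintype ι] {x : ι → ℤ} {D b w : ℕ}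
    (hD : Fintype.card ι ≤ D) (hx : ∀ i, bits (x i) ≤ b) (h : 1 + b ≤ w) :
    (isZero x).cost ≤ 1 + D * w := by
  calc (isZero x).cost = 1 + ∑ i, (1 + bits (x i)) := rfl
    _ ≤ 1 + ∑ _i : ι, w := by
      gcongr with i
      exact (Nat.add_le_add_left (hx i) 1).trans h
    _ = 1 + Fintype.card ι * w := by simp
    _ ≤ 1 + D * w := by gcongr

theorem congrTwo_cost_le {d : ℕ} {p q : Pt d} {b w : ℕ} (hp : ∀ i, bits (p i) ≤ b)
    (hq : ∀ i, bits (q i) ≤ b) (h : 1 + b ≤ w) : (congrTwo p q).cost ≤ 1 + d * (2 * w) := by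
  calc (congrTwo p q).cost = 1 + ∑ i, (1 + bits (p i) + bits (q i)) := rfl
    _ ≤ 1 + ∑ _i : Fin d, 2 * w := by
      gcongr with i
      have h1 := hp i
      have h2 := hq i
      omega
    _ = 1 + d * (2 * w) := by simp

theorem lexLe_cost_le {x y : List ℤ} {N b w : ℕ} (hxl : x.length ≤ N) (hyl : y.length ≤ N)
    (hx : ∀ i ∈ x, bits i ≤ b) (hy : ∀ i ∈ y, bits i ≤ b) (h : 1 + b ≤ w) :
    (lexLe x y).cost ≤ 1 + 2 * (N * w) := by
  have key : ∀ l : List ℤ, l.length ≤ N → (∀ i ∈ l, bits i ≤ b) →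
      (l.map fun x => 1 + bits x).sum ≤ N * w := fun l hl hb =>
    (sum_map_le fun i hi => (Nat.add_le_add_left (hb i hi) 1).trans h).trans (by gcongr)
  have h1 := key x hxl hx
  have h2 := key y hyl hy
  have : (lexLe x y).cost = 1 + (x.map fun x => 1 + bits x).sum + (y.map fun x => 1 + bits x).sum :=
    rfl
  omega

theorem listEq_cost_le {x y : List ℤ} {N b w : ℕ} (hxl : x.length ≤ N) (hyl : y.length ≤ N)
    (hx : ∀ i ∈ x, bits i ≤ b) (hy : ∀ i ∈ y, bits i ≤ b) (h : 1 + b ≤ w) :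
    (listEq x y).cost ≤ 1 + 2 * (N * w) :=
  lexLe_cost_le hxl hyl hx hy h

theorem ptLe_cost_le {d : ℕ} {p q : Pt d} {b w : ℕ} (hp : ∀ i, bits (p i) ≤ b)
    (hq : ∀ i, bits (q i) ≤ b) (h : 1 + b ≤ w) : (ptLe p q).cost ≤ 1 + 2 * (d * w) :=
  lexLe_cost_le (by simp) (by simp) (by simpa [List.forall_mem_ofFn_iff] using hp)
    (by simpa [List.forall_mem_ofFn_iff] using hq) h

theorem ptEq_cost_le {d : ℕ} {p q : Pt d} {b w : ℕ} (hp : ∀ i, bits (p i) ≤ b)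
    (hq : ∀ i, bits (q i) ≤ b) (h : 1 + b ≤ w) : (ptEq p q).cost ≤ 1 + 2 * (d * w) :=
  ptLe_cost_le hp hq h

theorem ptEq_val {d : ℕ} (p q : Pt d) : (ptEq p q).val = decide (p = q) := by
  simp [ptEq, listEq, List.ofFn_inj]

/-! ### Echelon forms -/

section Echelon

variable {ι : Type} [Fintype ι]

/-- The step of `reduceT`. -/
theorem reduceT_cons (μ : ℕ → ℕ) (r : Row ι) (B : List (Row ι)) (x : ι → ℤ) :
    (reduceT μ (r :: B) x).val =
      (reduceT μ B fun k => r.2 r.1 * x k - x r.1 * r.2 k).val := rfl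

theorem reduceT_keep (μ : ℕ → ℕ) {B : List (Row ι)} {x : ι → ℤ} {k : ι} (hx : x k = 0)
    (hB : ∀ r ∈ B, r.2 k = 0) : (reduceT μ B x).val k = 0 := by
  induction B generalizing x with
  | nil => exact hx
  | cons r B ih =>
    rw [reduceT_cons]
    exact ih (by simp [hx, hB r (by simp)]) fun r' hr' => hB r' (by simp [hr'])

/-- Rows vanish at the pivots of the preceding rows. -/
def Echelon (B : List (Row ι)) : Prop := B.Pairwise fun r r' => r'.2 r.1 = 0

/-- The step for `r` leaves `r.2 r.1 * x r.1 - x r.1 * r.2 r.1 = 0` at its pivot. The later rows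
vanish there, so the later steps only rescale this zero. -/
theorem reduceT_pivot (μ : ℕ → ℕ) {B : List (Row ι)} (hB : Echelon B) (x : ι → ℤ) {r : Row ι}
    (hr : r ∈ B) : (reduceT μ B x).val r.1 = 0 := by
  induction B generalizing x with
  | nil => simp at hr
  | cons r' B ih =>
    rw [Echelon, List.pairwise_cons] at hB
    rw [reduceT_cons]
    rcases List.mem_cons.1 hr with rfl | hr
    · exact reduceT_keep μ (by ring) hB.1
    · exact ih hB.2 _ hr

/-- Each row adds at most `a * s + 1 ≤ (a + 1) * s` bits, and there are at most `N` rows. The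
constants precede `ι` because the bound serves both homogeneous coordinates and the doubled vectors
of `frameBasis`. -/
theorem exists_reduceT_bound (hμ : IsMulCost μ) (D N a : ℕ) : ∃ A C, ∀ s, 1 ≤ s →
    ∀ {ι : Type} [Fintype ι], Fintype.card ι ≤ D → ∀ (B : List (Row ι)) (x : ι → ℤ),
    B.length ≤ N → (∀ r ∈ B, ∀ k, bits (r.2 k) ≤ a * s) → (∀ k, bits (x k) ≤ a * s) →
    (∀ k, bits ((reduceT μ B x).val k) ≤ A * s) ∧ (reduceT μ B x).cost ≤ C * μ s := by
  -- The factor 2 makes room for the two products formed before the subtraction.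
  obtain ⟨C, hC⟩ := hμ.exists_op (2 * (a + N * (a + 1)))
  refine ⟨a + N * (a + 1), 1 + N * (1 + D * (1 + 4 * C)), fun s hs ι _ hD B x hN hB hx => ?_⟩
  have hw := hμ.one_le hs
  obtain ⟨h1, h2⟩ := hC s hs _ le_rfl
  have hmono : ∀ i ≤ N, (a + i * (a + 1)) * s ≤ (a + N * (a + 1)) * s := fun i hi => by gcongr
  have key := foldT_le (f := fun (x : ι → ℤ) (r : Row ι) => vecT fun k => do
      let a ← mulI μ (r.2 r.1) (x k)
      let b ← mulI μ (x r.1) (r.2 k)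
      subI a b) (fun i x => ∀ k, bits (x k) ≤ (a + i * (a + 1)) * s)
    (c := D * (1 + 4 * (C * μ s))) (N := N) (l := B) (fun i x r hr hi hx => ?_) (b := x) (i := 0)
    (by simpa using hx) (by simpa using hN)
  · refine ⟨fun k => (key.1 k).trans (hmono _ (by simpa using hN)), key.2.trans ?_⟩
    calc 1 + B.length * (1 + D * (1 + 4 * (C * μ s)))
        ≤ μ s + N * (μ s + D * (μ s + 4 * (C * μ s))) := by gcongr
      _ = (1 + N * (1 + D * (1 + 4 * C))) * μ s := by ring
  · have ha : a * s ≤ (a + N * (a + 1)) * s := by gcongr; omega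
    have hm := hmono i hi.le
    have e : 2 * (a + N * (a + 1)) * s = (a + N * (a + 1)) * s + (a + N * (a + 1)) * s := by ring
    have hr' := hB r hr
    refine ⟨fun k => ?_, ?_⟩
    · have h3 := bits_mul_le (hr' r.1) (hx k)
      have h4 := bits_mul_le (hx r.1) (hr' k)
      rw [add_comm] at h4
      have e' : (a + (i + 1) * (a + 1)) * s = a * s + (a + i * (a + 1)) * s + s := by ring
      exact (bits_sub_le h3 h4).trans (by omega)
    · refine vecT_cost_le hD fun k => ?_
      have b1 := hr' r.1
      have b2 := hr' k
      have b3 := hx r.1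
      have b4 := hx k
      have c1 := mulI_cost_le hμ (b := 2 * (a + N * (a + 1)) * s) (by omega) (by omega) h2
        (x := r.2 r.1) (y := x k)
      have c2 := mulI_cost_le hμ (b := 2 * (a + N * (a + 1)) * s) (by omega) (by omega) h2
        (x := x r.1) (y := r.2 k)
      have c3 := subI_cost_le (b := 2 * (a + N * (a + 1)) * s) (w := C * μ s)
        (x := r.2 r.1 * x k) (y := x r.1 * r.2 k)
        ((bits_mul_le b1 b4).trans (by omega)) ((bits_mul_le b3 b2).trans (by omega)) h1
      simp only [bind_cost, mulI_val]
      omega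

end Echelon

section Echelon

variable {ι : Type} [Fintype ι]

theorem extendT_val_cases (μ : ℕ → ℕ) (P : List ι) (B : List (Row ι)) (x : ι → ℤ) :
    (extendT μ P B x).val = B ∨ ∃ k, ∃ z : ι → ℤ, (extendT μ P B x).val = B ++ [(k, z)] ∧
      z k ≠ 0 ∧ (z = (reduceT μ B x).val ∨ z = -(reduceT μ B x).val) := by
  simp only [extendT, bind_val]
  split
  · left; rfl
  · rename_i k hk
    right
    have hk' : (reduceT μ B x).val k ≠ 0 := by simpa using List.find?_some hk
    split
    · refine ⟨k, -(reduceT μ B x).val, ?_, by simpa using hk', Or.inr rfl⟩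
      simp only [bind_val, vecT_val, subI_val, zero_sub, pure_val]
      rfl
    · exact ⟨k, _, rfl, hk', Or.inl rfl⟩

theorem extendT_cost_le (μ : ℕ → ℕ) {P : List ι} {B : List (Row ι)} {x : ι → ℤ}
    {b c w D N : ℕ} (hD : Fintype.card ι ≤ D) (hP : P.length ≤ D) (hB : B.length ≤ N)
    (hx : ∀ k, bits ((reduceT μ B x).val k) ≤ b) (hc : (reduceT μ B x).cost ≤ c)
    (hw : 1 + b ≤ w) :
    (extendT μ P B x).cost ≤ c + (1 + D * w + N) + D * (1 + 2 * w) := by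
  have h1 : (P.map fun k => 1 + bits ((reduceT μ B x).val k)).sum ≤ D * w :=
    (sum_map_le fun k _ => (Nat.add_le_add_left (hx k) 1).trans hw).trans (by gcongr)
  have h2 : (vecT fun i => subI 0 ((reduceT μ B x).val i)).cost ≤ D * (1 + 2 * w) :=
    vecT_cost_le hD fun i => subI_cost_le (by simp [bits_zero]) (hx i) hw
  simp only [extendT, bind_cost, tick_cost]
  split
  · simp only [pure_cost]; omega
  · split
    · simp only [bind_cost, pure_cost]; omega
    · simp only [pure_cost]; omega

/-- The rows vanish at the pivots of the preceding rows, but not at their own pivots. -/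
def Reduced (B : List (Row ι)) : Prop := Echelon B ∧ ∀ r ∈ B, r.2 r.1 ≠ 0

/-- The pivots are distinct: a row vanishes at all earlier pivots, but not at its own. -/
theorem Reduced.length_le {B : List (Row ι)} (hB : Reduced B) : B.length ≤ Fintype.card ι := by
  have h : (B.map Prod.fst).Nodup := by
    rw [List.Nodup, List.pairwise_map]
    refine (List.pairwise_iff_forall_sublist.2 ?_)
    intro r r' hs
    have h1 := List.pairwise_iff_forall_sublist.1 hB.1 hs
    have h2 := hB.2 r' (hs.subset (by simp))
    intro e
    rw [e] at h1
    exact h2 h1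
  simpa using h.length_le_card

theorem Reduced.extendT (μ : ℕ → ℕ) (P : List ι) {B : List (Row ι)} (hB : Reduced B)
    (x : ι → ℤ) : Reduced (extendT μ P B x).val := by
  rcases extendT_val_cases μ P B x with h | ⟨k, z, h, hz, hz'⟩
  · rwa [h]
  · rw [h]
    refine ⟨?_, ?_⟩
    · rw [Echelon, List.pairwise_append]
      refine ⟨hB.1, by simp, ?_⟩
      intro r hr r' hr'
      rw [List.mem_singleton] at hr'
      subst hr'
      have := reduceT_pivot μ hB.1 x hr
      rcases hz' with rfl | rfl <;> simp [this]
    · intro r hr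
      rw [List.mem_append, List.mem_singleton] at hr
      rcases hr with hr | rfl
      · exact hB.2 r hr
      · exact hz

/-- Computation of an echelon form. -/
theorem exists_foldT_extendT_bound (hμ : IsMulCost μ) (D a : ℕ) : ∃ A C, ∀ s, 1 ≤ s →
    ∀ {ι : Type} [Fintype ι], Fintype.card ι ≤ D → ∀ P : List ι, P.length ≤ D →
    ∀ L : List (ι → ℤ), (∀ x ∈ L, ∀ k, bits (x k) ≤ a * s) →
    Reduced (foldT (extendT μ P) [] L).val ∧
    (∀ r ∈ (foldT (extendT μ P) [] L).val, ∀ k, bits (r.2 k) ≤ A * s) ∧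
    (foldT (extendT μ P) [] L).cost ≤ (L.length + 1) * (C * μ s) := by
  choose A₁ C₁ h₁ using fun a => exists_reduceT_bound hμ D D a
  -- `H n * s` bounds the entries of an echelon form with `n` rows. Indexing by rows and not by
  -- iterations is essential: `L` may be as long as `Λ`, but only `D` of its vectors can enlarge the
  -- form.
  let H : ℕ → ℕ := fun n => n.rec a fun _ b => b + A₁ b
  have hH : Monotone H := monotone_nat_of_le_succ fun n => Nat.le_add_right _ _
  have haH : ∀ n, a ≤ H n := fun n => hH (Nat.zero_le n)
  have hA₁ : ∀ n, A₁ (H n) ≤ H (n + 1) := fun n => Nat.le_add_left _ _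
  obtain ⟨C₂, h₂⟩ := hμ.exists_op (H (D + 1))
  let M := (Finset.range (D + 1)).sup fun n => C₁ (H n)
  refine ⟨H D, 1 + (1 + (M + (1 + D * C₂ + D) + D * (1 + 2 * C₂))), fun s hs ι _ hD P hP L hL => ?_⟩
  have hw := hμ.one_le hs
  have key := foldT_inv (f := extendT μ P) (l := L) (b := []) (N := L.length)
    (c := (M + (1 + D * C₂ + D) + D * (1 + 2 * C₂)) * μ s)
    (fun B => Reduced B ∧ ∀ r ∈ B, ∀ k, bits (r.2 k) ≤ H B.length * s) ?_
    ⟨⟨by simp [Echelon], by simp⟩, by simp⟩ le_rfl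
  · refine ⟨key.1.1, fun r hr k => (key.1.2 r hr k).trans ?_, key.2.trans ?_⟩
    · exact Nat.mul_le_mul_right _ (hH (key.1.1.length_le.trans hD))
    · set c := (M + (1 + D * C₂ + D) + D * (1 + 2 * C₂)) with hc
      calc 1 + L.length * (1 + c * μ s) ≤ μ s + L.length * (μ s + c * μ s) := by gcongr
        _ ≤ μ s + L.length * (μ s + c * μ s) + (μ s + c * μ s + L.length * μ s) :=
          Nat.le_add_right _ _
        _ = (L.length + 1) * ((1 + (1 + c)) * μ s) := by ring
  · rintro B x hx ⟨hB, hb⟩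
    have hBD : B.length ≤ D := hB.length_le.trans hD
    obtain ⟨h3, h4⟩ := h₁ (H B.length) s hs hD B x hBD hb fun k =>
      (hL x hx k).trans (Nat.mul_le_mul_right _ (haH _))
    have h5 : ∀ k, bits ((reduceT μ B x).val k) ≤ H (B.length + 1) * s := fun k =>
      (h3 k).trans (Nat.mul_le_mul_right _ (hA₁ _))
    refine ⟨⟨hB.extendT μ P x, ?_⟩, ?_⟩
    · rcases extendT_val_cases μ P B x with h | ⟨k, z, h, hz, hz'⟩
      · rwa [h]
      · rw [h]
        intro r hr j
        rw [List.length_append, List.length_singleton]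
        rw [List.mem_append, List.mem_singleton] at hr
        rcases hr with hr | rfl
        · exact (hb r hr j).trans (Nat.mul_le_mul_right _ (hH (Nat.le_succ _)))
        · rcases hz' with rfl | rfl
          · exact h5 j
          · simpa [bits_neg] using h5 j
    · have h6 : C₁ (H B.length) ≤ M :=
        Finset.le_sup (f := fun n => C₁ (H n)) (Finset.mem_range.2 (by omega))
      have h7 := (h₂ s hs (H (B.length + 1) * s)
        (Nat.mul_le_mul_right _ (hH (Nat.succ_le_succ hBD)))).1
      refine (extendT_cost_le μ hD hP hBD h5 h4 h7).trans ?_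
      calc _ ≤ M * μ s + (μ s + D * (C₂ * μ s) + D * μ s) + D * (μ s + 2 * (C₂ * μ s)) := by
            gcongr
            nlinarith
        _ = _ := by ring

end Echelon

/-! ### Affine spans of frames -/

theorem bits_hom_le {d : ℕ} {p : Pt d} {a s : ℕ} (hs : 1 ≤ s) (ha : 1 ≤ a)
    (hp : ∀ i, bits (p i) ≤ a * s) (k : Fin (d + 1)) : bits (hom p k) ≤ a * s := by
  refine Fin.cases ?_ (fun i => ?_) k
  · simp only [hom, Fin.cons_zero, bits_one]; nlinarith
  · simpa [hom] using hp i

variable {d : ℕ}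

theorem exists_spanBasis_bound (hμ : IsMulCost μ) (d a : ℕ) : ∃ A C, ∀ s, 1 ≤ s →
    ∀ Q : List (HPt d), (∀ q ∈ Q, ∀ k, bits (q k) ≤ a * s) →
    (spanBasis μ Q).val.length ≤ d + 1 ∧
    (∀ r ∈ (spanBasis μ Q).val, ∀ k, bits (r.2 k) ≤ A * s) ∧
    (spanBasis μ Q).cost ≤ (Q.length + 1) * (C * μ s) := by
  obtain ⟨A, C, h⟩ := exists_foldT_extendT_bound hμ (d + 1) a
  refine ⟨A, C, fun s hs Q hQ => ?_⟩
  obtain ⟨h1, h2, h3⟩ := h s hs (by simp) (List.finRange (d + 1)) (by simp) Q hQ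
  exact ⟨h1.length_le.trans (by simp), h2, h3⟩

theorem exists_inSpan_bound (hμ : IsMulCost μ) (d a : ℕ) : ∃ C, ∀ s, 1 ≤ s →
    ∀ (B : List (Row (Fin (d + 1)))) (p : Pt d), B.length ≤ d + 1 →
    (∀ r ∈ B, ∀ k, bits (r.2 k) ≤ a * s) → (∀ i, bits (p i) ≤ a * s) →
    (inSpan μ B p).cost ≤ C * μ s := by
  obtain ⟨A, C, h⟩ := exists_reduceT_bound hμ (d + 1) (d + 1) (a + 1)
  obtain ⟨C', h'⟩ := hμ.exists_op A
  refine ⟨C + (1 + (d + 1) * C'), fun s hs B p hB hb hp => ?_⟩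
  have hw := hμ.one_le hs
  have e : a * s ≤ (a + 1) * s := by gcongr; omega
  obtain ⟨h1, h2⟩ := h s hs (by simp) B (hom p) hB (fun r hr k => (hb r hr k).trans e)
    (bits_hom_le hs (by omega) fun i => (hp i).trans e)
  have h3 := isZero_cost_le (D := d + 1) (by simp) h1 (h' s hs _ le_rfl).1
  simp only [inSpan, bind_cost]
  calc _ ≤ C * μ s + (μ s + (d + 1) * (C' * μ s)) := by gcongr; omega
    _ = _ := by ring

theorem exists_minusSpan_bound (hμ : IsMulCost μ) (d a N : ℕ) : ∃ C, ∀ s, 1 ≤ s →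
    ∀ (Λ : List (Pt d)) (Q : List (HPt d)), Q.length ≤ N →
    (∀ q ∈ Q, ∀ k, bits (q k) ≤ a * s) → (∀ p ∈ Λ, ∀ i, bits (p i) ≤ a * s) →
    (minusSpan μ Λ Q).cost ≤ (Λ.length + 1) * (C * μ s) := by
  obtain ⟨A, C, h⟩ := exists_spanBasis_bound hμ d a
  obtain ⟨C', h'⟩ := exists_inSpan_bound hμ d (A + a)
  refine ⟨(N + 1) * C + (1 + (1 + C')), fun s hs Λ Q hQ hq hp => ?_⟩
  have hw := hμ.one_le hs
  obtain ⟨h1, h2, h3⟩ := h s hs Q hq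
  have h4 := filterT_cost_le (f := fun p => do
    let b ← inSpan μ (spanBasis μ Q).val p
    pure (!b)) (l := Λ) le_rfl (c := C' * μ s) fun p hp' => by
      simpa using h' s hs _ p h1 (fun r hr k => (h2 r hr k).trans (by gcongr; omega))
        (fun i => (hp p hp' i).trans (by gcongr; omega))
  simp only [minusSpan, bind_cost]
  calc _ ≤ (N + 1) * (C * μ s) + (1 * μ s + Λ.length * (μ s + C' * μ s)) := by
        gcongr ?_ + ?_
        · exact h3.trans (by gcongr)
        · exact h4.trans (by gcongr; omega)
    _ ≤ (N + 1) * (C * μ s) * (Λ.length + 1) + (1 * μ s + Λ.length * (μ s + C' * μ s)) +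
      (μ s + C' * μ s + Λ.length * μ s) := by
        rw [Nat.mul_succ]
        omega
    _ = _ := by ring

theorem minusSpan_sublist (μ : ℕ → ℕ) (Λ : List (Pt d)) (Q : List (HPt d)) :
    (minusSpan μ Λ Q).val.Sublist Λ := by
  simp only [minusSpan, bind_val, filterT_val]
  exact List.filter_sublist

/-- This is what later forces every frame added in the unbalanced case to be nonempty. -/
theorem not_inSpan_of_mem_minusSpan {Λ : List (Pt d)} {Q : List (HPt d)} {p : Pt d}
    (h : p ∈ (minusSpan μ Λ Q).val) : (inSpan μ (spanBasis μ Q).val p).val = false := by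
  simp only [minusSpan, bind_val, filterT_val, List.mem_filter, pure_val] at h
  simpa using h.2

theorem joinFrame_val (Q : List (HPt d)) (R : List (Pt d)) :
    (joinFrame Q R).val = Q ++ R.map hom := rfl

theorem joinFrame_cost (Q : List (HPt d)) (R : List (Pt d)) :
    (joinFrame Q R).cost ≤ 1 + R.length * (1 + (d + 1)) + (1 + Q.length) := by
  have h := mapT_cost_le (f := fun r : Pt d => do tick (d + 1); pure (hom r)) (l := R)
    le_rfl (c := d + 1) (by simp)
  simp only [joinFrame, bind_cost, tick_cost, pure_cost]
  omega

/-! ### Frames contained in a given set -/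

section Words

variable {α : Type}

theorem wordsT_succ_val (l : List α) (k : ℕ) :
    (wordsT l (k + 1)).val = [] :: (l.map fun a => (wordsT l k).val.map (a :: ·)).flatten := rfl

theorem wordsT_mem {l : List α} {k : ℕ} {w : List α} (h : w ∈ (wordsT l k).val) :
    w.length ≤ k ∧ ∀ a ∈ w, a ∈ l := by
  induction k generalizing w with
  | zero =>
    have : w = [] := by simpa [wordsT] using h
    subst this
    simp
  | succ k ih =>
    rw [wordsT_succ_val] at h
    rcases List.mem_cons.1 h with rfl | h
    · simp
    · obtain ⟨L, hL, hw⟩ := List.mem_flatten.1 h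
      obtain ⟨a, ha, rfl⟩ := List.mem_map.1 hL
      obtain ⟨v, hv, rfl⟩ := List.mem_map.1 hw
      obtain ⟨h1, h2⟩ := ih hv
      refine ⟨by simpa using h1, fun b hb => ?_⟩
      rcases List.mem_cons.1 hb with rfl | hb
      · exact ha
      · exact h2 b hb

/-- Needed to bound the multiplicities in the output, since the argument modulo 3 counts only
distinct frames. -/
theorem wordsT_nodup {l : List α} (hl : l.Nodup) (k : ℕ) : (wordsT l k).val.Nodup := by
  induction k with
  | zero => simp [wordsT]
  | succ k ih =>
    rw [wordsT_succ_val, List.nodup_cons]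
    refine ⟨by simp, ?_⟩
    rw [List.nodup_flatten]
    refine ⟨?_, ?_⟩
    · intro L hL
      obtain ⟨a, _, rfl⟩ := List.mem_map.1 hL
      exact ih.map fun v w h => (List.cons.inj h).2
    · rw [List.pairwise_map]
      refine hl.imp fun {a b} hab => ?_
      rw [List.disjoint_left]
      intro w hw hw'
      obtain ⟨v, _, rfl⟩ := List.mem_map.1 hw
      obtain ⟨v', _, h⟩ := List.mem_map.1 hw'
      exact hab (List.cons.inj h).1.symm

theorem exists_wordsT_bound (N k : ℕ) : ∃ C, ∀ {α : Type} (l : List α), l.length ≤ N →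
    (wordsT l k).val.length ≤ C ∧ (wordsT l k).cost ≤ C := by
  induction k with
  | zero => exact ⟨1, fun l _ => ⟨by simp [wordsT], by simp [wordsT]⟩⟩
  | succ k ih =>
    obtain ⟨C, hC⟩ := ih
    refine ⟨C + (1 + N * (1 + (1 + C))) + (1 + N + N * C) , fun l hl => ?_⟩
    obtain ⟨h1, h2⟩ := hC l hl
    have h3 : (l.map fun a => (wordsT l k).val.map (a :: ·)).flatten.length ≤ N * C :=
      length_flatten_le (by simpa using hl) (by simpa using fun _ _ => h1)
    refine ⟨?_, ?_⟩
    · rw [wordsT_succ_val, List.length_cons]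
      omega
    · have h4 := mapT_cost_le (f := fun a : _ => mapT (fun w => pure (a :: w)) (wordsT l k).val)
        (l := l) hl (c := 1 + C) fun a _ => by
          simpa using mapT_cost_le (c := 0) h1 (f := fun w => (pure (a :: w) : Timed _)) (by simp)
      have h5 := flattenT_cost_le
        (L := (mapT (fun a : _ => mapT (fun w => pure (a :: w)) (wordsT l k).val) l).val)
        (M := N) (N := N * C) (by simpa using hl) h3
      simp only [wordsT, bind_cost, pure_cost]
      omega

end Words

theorem exists_eqHom_bound (hμ : IsMulCost μ) (d a : ℕ) : ∃ C, ∀ s, 1 ≤ s →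
    ∀ (q : HPt d) (p : Pt d), (∀ k, bits (q k) ≤ a * s) → (∀ i, bits (p i) ≤ a * s) →
    (eqHom μ q p).cost ≤ C * μ s := by
  obtain ⟨C, hC⟩ := hμ.exists_op (a + a + 1)
  refine ⟨d * (1 + 3 * C) + (1 + d * C), fun s hs q p hq hp => ?_⟩
  have hw := hμ.one_le hs
  obtain ⟨h1, h2⟩ := hC s hs _ le_rfl
  have e : (a + a + 1) * s = a * s + a * s + s := by ring
  have h3 : ∀ i, bits (q 0 * p i) ≤ a * s + a * s := fun i => bits_mul_le (hq 0) (hp i)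
  have h4 := vecT_cost_le (f := fun i : Fin d => do
    let a ← mulI μ (q 0) (p i)
    subI (q i.succ) a) (D := d) (c := 3 * (C * μ s)) (by simp) fun i => by
      have c1 := mulI_cost_le hμ (b := (a + a + 1) * s) (by have := hq 0; omega)
        (by have := hp i; omega) h2 (x := q 0) (y := p i)
      have c2 := subI_cost_le (b := (a + a + 1) * s) (by have := hq i.succ; omega)
        (by have := h3 i; omega) h1 (x := q i.succ) (y := q 0 * p i)
      simp only [bind_cost, mulI_val]
      omega
  have h5 := isZero_cost_le (D := d) (by simp) (x := fun i : Fin d => q i.succ - q 0 * p i)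
    (b := (a + a + 1) * s) (fun i => by
      have := bits_sub_le ((hq i.succ).trans (Nat.le_add_left _ (a * s))) (h3 i)
      omega) h1
  simp only [eqHom, bind_cost]
  calc _ ≤ d * (μ s + 3 * (C * μ s)) + (μ s + d * (C * μ s)) := by
        gcongr
        · exact h4.trans (by gcongr)
        · exact h5.trans (by gcongr)
    _ = _ := by ring

theorem exists_disjointFrames_bound (hμ : IsMulCost μ) (d a N : ℕ) : ∃ C, ∀ s, 1 ≤ s →
    ∀ (Q : List (HPt d)) (R : List (Pt d)), Q.length ≤ N → R.length ≤ N →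
    (∀ q ∈ Q, ∀ k, bits (q k) ≤ a * s) → (∀ p ∈ R, ∀ i, bits (p i) ≤ a * s) →
    (disjointFrames μ Q R).cost ≤ C * μ s := by
  obtain ⟨C, hC⟩ := exists_eqHom_bound hμ d a
  refine ⟨1 + N * (1 + (1 + N * (1 + C))), fun s hs Q R hQ hR hq hr => ?_⟩
  have hw := hμ.one_le hs
  have h1 := allT_cost_le (l := Q) (f := fun q => allT (fun r => do
    let b ← eqHom μ q r
    pure (!b)) R) hQ fun q hq' => allT_cost_le hR fun r hr' => by
      simpa using hC s hs q r (hq q hq') (hr r hr')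
  refine (show (disjointFrames μ Q R).cost ≤ _ from h1).trans ?_
  calc _ ≤ μ s + N * (μ s + (μ s + N * (μ s + C * μ s))) := by gcongr
    _ = _ := by ring

theorem exists_isCoveringFrame_bound (hμ : IsMulCost μ) (d a N : ℕ) : ∃ C, ∀ s, 1 ≤ s →
    ∀ (Λ : List (Pt d)) (Q : List (HPt d)), Q.length ≤ N →
    (∀ q ∈ Q, ∀ k, bits (q k) ≤ a * s) → (∀ p ∈ Λ, ∀ i, bits (p i) ≤ a * s) →
    (isCoveringFrame μ Λ Q).cost ≤ (Λ.length + 1) * (C * μ s) := by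
  obtain ⟨A, C, h⟩ := exists_spanBasis_bound hμ d a
  obtain ⟨C', h'⟩ := exists_inSpan_bound hμ d (A + a)
  refine ⟨(N + 1) * C + (1 + (1 + C')) + (1 + N), fun s hs Λ Q hQ hq hp => ?_⟩
  have hw := hμ.one_le hs
  obtain ⟨h1, h2, h3⟩ := h s hs Q hq
  have h4 := allT_cost_le (f := inSpan μ (spanBasis μ Q).val) (l := Λ) le_rfl (c := C' * μ s)
    fun p hp' => by
      simpa using h' s hs _ p h1 (fun r hr k => (h2 r hr k).trans (by gcongr; omega))
        (fun i => (hp p hp' i).trans (by gcongr; omega))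
  simp only [isCoveringFrame, bind_cost, tick_cost, pure_cost]
  calc _ ≤ (N + 1) * (C * μ s) + (μ s + Λ.length * (μ s + C' * μ s) + (μ s + N * μ s)) := by
        gcongr ?_ + (?_ + ?_)
        · exact h3.trans (by gcongr)
        · exact h4.trans (by gcongr)
        · nlinarith
    _ ≤ (N + 1) * (C * μ s) + (μ s + Λ.length * (μ s + C' * μ s) + (μ s + N * μ s)) +
      ((N + 1) * (C * μ s) * Λ.length + (μ s + C' * μ s + Λ.length * μ s) +
        Λ.length * (μ s + N * μ s)) := Nat.le_add_right _ _
    _ = _ := by ring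

/-- Independence and covering are kept in terms of the computed echelon form. The cost analysis only
compares outcomes of the same computation and never needs the geometric meaning of `spanBasis`. -/
theorem mem_complementaryFrames {Λ' Λ : List (Pt d)} {Q : List (HPt d)} {R : List (Pt d)}
    (h : R ∈ (complementaryFrames μ Λ' Λ Q).val) :
    R.length ≤ d + 1 ∧ (∀ p ∈ R, p ∈ Λ') ∧
    (spanBasis μ (Q ++ R.map hom)).val.length = Q.length + R.length ∧
    ∀ p ∈ Λ, (inSpan μ (spanBasis μ (Q ++ R.map hom)).val p).val = true := by
  simp only [complementaryFrames, bind_val, filterT_val, List.mem_filter, pure_val,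
    isCoveringFrame, joinFrame_val, allT_val, Bool.and_eq_true, decide_eq_true_eq,
    List.all_eq_true, List.length_append, List.length_map] at h
  obtain ⟨h1, -, h2, h3⟩ := h
  exact ⟨(wordsT_mem h1).1, (wordsT_mem h1).2, h2, h3⟩

theorem complementaryFrames_nodup (μ : ℕ → ℕ) {Λ' : List (Pt d)} (h : Λ'.Nodup)
    (Λ : List (Pt d)) (Q : List (HPt d)) : (complementaryFrames μ Λ' Λ Q).val.Nodup := by
  simp only [complementaryFrames, bind_val, filterT_val]
  exact (wordsT_nodup h _).filter _

/-- The number of candidate words is a constant because `Λ'` is a union of boundedly many bounded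
outputs. Only the covering test runs over all of `Λ`, so the cost is linear in its length. -/
theorem exists_complementaryFrames_bound (hμ : IsMulCost μ) (d a N : ℕ) (ha : 1 ≤ a) :
    ∃ C, ∀ s, 1 ≤ s → ∀ (Λ' Λ : List (Pt d)) (Q : List (HPt d)), Λ'.length ≤ N → Q.length ≤ N →
    (∀ q ∈ Q, ∀ k, bits (q k) ≤ a * s) → (∀ p ∈ Λ', ∀ i, bits (p i) ≤ a * s) →
    (∀ p ∈ Λ, ∀ i, bits (p i) ≤ a * s) →
    (complementaryFrames μ Λ' Λ Q).val.length ≤ C ∧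
    (complementaryFrames μ Λ' Λ Q).cost ≤ (Λ.length + 1) * (C * μ s) := by
  obtain ⟨C₁, h₁⟩ := exists_wordsT_bound N (d + 1)
  obtain ⟨C₂, h₂⟩ := exists_disjointFrames_bound hμ d a (N + (d + 1))
  obtain ⟨C₃, h₃⟩ := exists_isCoveringFrame_bound hμ d a (N + (d + 1))
  let J := 1 + (d + 1) * (1 + (d + 1)) + (1 + N)
  refine ⟨C₁ + (1 + C₁ * (1 + (C₂ + (J + C₃)))), fun s hs Λ' Λ Q hΛ' hQ hq hp' hp => ?_⟩
  have hw := hμ.one_le hs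
  obtain ⟨h1, h2⟩ := h₁ Λ' hΛ'
  refine ⟨?_, ?_⟩
  · simp only [complementaryFrames, bind_val, filterT_val]
    exact (List.length_filter_le _ _).trans (h1.trans (Nat.le_add_right _ _))
  · have h4 := filterT_cost_le (l := (wordsT Λ' (d + 1)).val) (f := fun R => do
      let a ← disjointFrames μ Q R
      let QR ← joinFrame Q R
      let b ← isCoveringFrame μ Λ QR
      pure (a && b)) h1 (c := C₂ * μ s + (J + (Λ.length + 1) * (C₃ * μ s))) fun R hR => by
        obtain ⟨h5, h6⟩ := wordsT_mem hR
        have h7 := h₂ s hs Q R (by omega) (by omega) hq fun p hpR => hp' p (h6 p hpR)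
        have h8 := h₃ s hs Λ (Q ++ R.map hom) (by simp; omega) (by
          intro q hqR
          rcases List.mem_append.1 hqR with hqR | hqR
          · exact hq q hqR
          · obtain ⟨p, hpR, rfl⟩ := List.mem_map.1 hqR
            exact bits_hom_le hs ha (hp' p (h6 p hpR))) hp
        have h9 : (joinFrame Q R).cost ≤ J := (joinFrame_cost Q R).trans (by
          dsimp only [J]; gcongr)
        simp only [bind_cost, pure_cost, joinFrame_val]
        omega
    simp only [complementaryFrames, bind_cost]
    calc _ ≤ C₁ * μ s + (μ s + C₁ * (μ s + (C₂ * μ s +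
          (J * μ s + (Λ.length + 1) * (C₃ * μ s))))) := by
          gcongr
          · nlinarith
          · refine h4.trans ?_
            gcongr
            nlinarith
      _ ≤ _ + (C₁ * μ s + (μ s + C₁ * (μ s + (C₂ * μ s + J * μ s)))) * Λ.length :=
          Nat.le_add_right _ _
      _ = _ := by ring

/-! ### Unions -/

theorem dedupT_cons_val {α : Type} (eq : α → α → Timed Bool) (a : α) (l : List α) :
    (dedupT eq (a :: l)).val =
      if (filterT (eq a) (dedupT eq l).val).val.isEmpty then a :: (dedupT eq l).val
      else (dedupT eq l).val := by
  simp only [dedupT, bind_val]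
  split
  · rfl
  · rfl

theorem dedupT_spec {α : Type} [DecidableEq α] {eq : α → α → Timed Bool}
    (heq : ∀ a b, (eq a b).val = decide (a = b)) (l : List α) :
    (dedupT eq l).val.Nodup ∧ (dedupT eq l).val.Sublist l := by
  induction l with
  | nil => simp [dedupT]
  | cons a l ih =>
    rw [dedupT_cons_val]
    split
    · rename_i h
      refine ⟨List.nodup_cons.2 ⟨fun ha => ?_, ih.1⟩, ih.2.cons_cons a⟩
      rw [filterT_val, List.isEmpty_iff, List.filter_eq_nil_iff] at h
      exact h a ha (by simp [heq])
    · exact ⟨ih.1, ih.2.trans (List.sublist_cons_self _ _)⟩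

theorem dedupT_cost_le {α : Type} [DecidableEq α] {eq : α → α → Timed Bool}
    (heq : ∀ a b, (eq a b).val = decide (a = b)) {c N : ℕ} {l : List α} (hN : l.length ≤ N)
    (hc : ∀ a ∈ l, ∀ b ∈ l, (eq a b).cost ≤ c) :
    (dedupT eq l).cost ≤ 1 + l.length * (2 + N * (1 + c)) := by
  induction l with
  | nil => simp [dedupT]
  | cons a l ih =>
    rw [List.length_cons] at hN
    have h1 := ih (by omega) fun a ha b hb => hc a (by simp [ha]) b (by simp [hb])
    have hs := (dedupT_spec heq l).2
    have h2 := filterT_cost_le (f := eq a) (l := (dedupT eq l).val) (N := N) (c := c)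
      (hs.length_le.trans (by omega)) fun b hb => hc a (by simp) b (by simp [hs.subset hb])
    have h3 : (dedupT eq (a :: l)).cost =
        1 + ((dedupT eq l).cost + (filterT (eq a) (dedupT eq l).val).cost) := by
      simp only [dedupT, bind_cost, tick_cost]
      split <;> simp
    rw [h3, List.length_cons, add_mul, one_mul]
    omega

theorem unionT_spec (Ss : List (List (List (Pt d)))) :
    (unionT Ss).val.Nodup ∧ ∀ p ∈ (unionT Ss).val, ∃ S ∈ Ss, ∃ V ∈ S, p ∈ V := by
  have h := dedupT_spec (eq := ptEq (d := d)) ptEq_val Ss.flatten.flatten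
  refine ⟨h.1, fun p hp => ?_⟩
  obtain ⟨V, hV, hp⟩ := List.mem_flatten.1 (h.2.subset hp)
  obtain ⟨S, hS, hV⟩ := List.mem_flatten.1 hV
  exact ⟨S, hS, V, hV, hp⟩

/-- Removing repetitions takes quadratic time, which is harmless here: the total number of points is
at most `H * N * M`. -/
theorem exists_unionT_bound (hμ : IsMulCost μ) (d a H N M : ℕ) : ∃ C, ∀ s, 1 ≤ s →
    ∀ Ss : List (List (List (Pt d))), Ss.length ≤ H → (∀ S ∈ Ss, S.length ≤ N) →
    (∀ S ∈ Ss, ∀ V ∈ S, V.length ≤ M) →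
    (∀ S ∈ Ss, ∀ V ∈ S, ∀ p ∈ V, ∀ i, bits (p i) ≤ a * s) →
    (unionT Ss).val.length ≤ H * N * M ∧ (unionT Ss).cost ≤ C * μ s := by
  obtain ⟨C, hC⟩ := hμ.exists_op a
  refine ⟨(1 + H + H * N) + (1 + H * N + H * N * M) +
    (1 + H * N * M * (2 + H * N * M * (1 + (1 + 2 * (d * C))))), fun s hs Ss h1 h2 h3 h4 => ?_⟩
  have hw := hμ.one_le hs
  have h5 : Ss.flatten.length ≤ H * N := length_flatten_le h1 h2
  have h6 : Ss.flatten.flatten.length ≤ H * N * M := length_flatten_le h5 fun V hV => by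
    obtain ⟨S, hS, hV⟩ := List.mem_flatten.1 hV
    exact h3 S hS V hV
  refine ⟨(dedupT_spec (eq := ptEq (d := d)) ptEq_val _).2.length_le.trans h6, ?_⟩
  have h7 : ∀ p ∈ Ss.flatten.flatten, ∀ i, bits (p i) ≤ a * s := fun p hp => by
    obtain ⟨V, hV, hp⟩ := List.mem_flatten.1 hp
    obtain ⟨S, hS, hV⟩ := List.mem_flatten.1 hV
    exact h4 S hS V hV p hp
  have h8 := dedupT_cost_le (eq := ptEq (d := d)) ptEq_val h6 fun p hp q hq =>
    ptEq_cost_le (h7 p hp) (h7 q hq) (hC s hs _ le_rfl).1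
  have h9 := flattenT_cost_le h1 h5
  have h10 := flattenT_cost_le h5 h6
  simp only [unionT, bind_cost, flattenT_val]
  calc _ ≤ (1 + H + H * N) * μ s + ((1 + H * N + H * N * M) * μ s +
        (μ s + H * N * M * (2 * μ s + H * N * M * (μ s + (μ s + 2 * (d * (C * μ s))))))) := by
        gcongr
        · exact h9.trans (by nlinarith)
        · exact h10.trans (by nlinarith)
        · exact h8.trans (by gcongr; omega)
    _ = _ := by ring

/-! ### Halving and doubling -/

theorem exists_halvePt_bound (hμ : IsMulCost μ) (d a : ℕ) : ∃ C, ∀ s, 1 ≤ s →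
    ∀ p x : Pt d, (∀ i, bits (p i) ≤ a * s) → (∀ i, bits (x i) ≤ a * s) →
    (halvePt p x).cost ≤ C * μ s := by
  obtain ⟨C, hC⟩ := hμ.exists_op (a + 1)
  refine ⟨d * (1 + (2 * C + 10 * C)), fun s hs p x hp hx => ?_⟩
  have hw := hμ.one_le hs
  obtain ⟨h1, -⟩ := hC s hs _ le_rfl
  have e : (a + 1) * s = a * s + s := by ring
  have h2 := vecT_cost_le (f := fun i : Fin d => do
      let y ← subI (x i) (p i)
      divI y 2) (D := d) (c := 2 * (C * μ s) + 10 * (C * μ s)) (by simp) fun i => by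
    have c1 := subI_cost_le (x := x i) (y := p i) (b := (a + 1) * s)
      (by have := hx i; omega) (by have := hp i; omega) h1
    have c2 : (divI (x i - p i) 2).cost = 1 + bits (x i - p i) +
      (bits ((x i - p i) / 2) + 1) * (bits 2 + 1) := rfl
    have c3 : bits 2 = 2 := rfl
    have c4 := bits_ediv_le (x i - p i) 2
    have c5 := bits_sub_le (hx i) (hp i)
    simp only [bind_cost, subI_val]
    rw [c2, c3]
    omega
  refine (show (halvePt p x).cost ≤ _ from h2).trans ?_
  calc _ ≤ d * (μ s + (2 * (C * μ s) + 10 * (C * μ s))) := by gcongr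
    _ = _ := by ring

theorem exists_halveHPt_bound (hμ : IsMulCost μ) (d a : ℕ) : ∃ C, ∀ s, 1 ≤ s →
    ∀ (p : Pt d) (q : HPt d), (∀ i, bits (p i) ≤ a * s) → (∀ k, bits (q k) ≤ a * s) →
    (halveHPt μ p q).cost ≤ C * μ s := by
  obtain ⟨C, hC⟩ := hμ.exists_op (a + a)
  refine ⟨(d + 1) * (1 + 3 * C), fun s hs p q hp hq => ?_⟩
  have hw := hμ.one_le hs
  obtain ⟨h1, h2⟩ := hC s hs _ le_rfl
  have e : (a + a) * s = a * s + a * s := by ring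
  have h3 : (halveHPt μ p q).cost ≤ (d + 1) * (1 + 3 * (C * μ s)) := by
    refine vecT_cost_le (by simp) fun k => ?_
    refine Fin.cases ?_ (fun i => ?_) k
    · have := addI_cost_le (x := q 0) (y := q 0) (b := (a + a) * s)
        (by have := hq 0; omega) (by have := hq 0; omega) h1
      simp only [Fin.cases_zero]
      omega
    · have c1 := mulI_cost_le hμ (x := q 0) (y := p i) (b := (a + a) * s)
        (by have := hq 0; omega) (by have := hp i; omega) h2
      have c2 := subI_cost_le (x := q i.succ) (y := q 0 * p i) (b := (a + a) * s)
        (by have := hq i.succ; omega) ((bits_mul_le (hq 0) (hp i)).trans (by omega)) h1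
      simp only [Fin.cases_succ, bind_cost, mulI_val]
      omega
  refine h3.trans ?_
  calc _ ≤ (d + 1) * (μ s + 3 * (C * μ s)) := by gcongr
    _ = _ := by ring

theorem exists_doublePt_bound (hμ : IsMulCost μ) (d a : ℕ) : ∃ C, ∀ s, 1 ≤ s →
    ∀ p x : Pt d, (∀ i, bits (p i) ≤ a * s) → (∀ i, bits (x i) ≤ a * s) →
    (doublePt p x).cost ≤ C * μ s := by
  obtain ⟨C, hC⟩ := hμ.exists_op (a + 1)
  refine ⟨d * (1 + 4 * C), fun s hs p x hp hx => ?_⟩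
  have hw := hμ.one_le hs
  obtain ⟨h1, -⟩ := hC s hs _ le_rfl
  have e : (a + 1) * s = a * s + s := by ring
  have h2 : (doublePt p x).cost ≤ d * (1 + 4 * (C * μ s)) := by
    refine vecT_cost_le (by simp) fun i => ?_
    have c1 := addI_cost_le (x := x i) (y := x i) (b := (a + 1) * s)
      (by have := hx i; omega) (by have := hx i; omega) h1
    have c2 := addI_cost_le (x := x i + x i) (y := p i) (b := (a + 1) * s)
      ((bits_add_le (hx i) (hx i)).trans (by omega)) (by have := hp i; omega) h1
    simp only [bind_cost, addI_val]
    omega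
  refine h2.trans ?_
  calc _ ≤ d * (μ s + 4 * (C * μ s)) := by gcongr
    _ = _ := by ring

theorem doublePt_val (p x : Pt d) : (doublePt p x).val = fun i => x i + x i + p i := rfl

theorem halvePt_val (p x : Pt d) : (halvePt p x).val = fun i => (x i - p i) / 2 := rfl

theorem halveHPt_zero (μ : ℕ → ℕ) (p : Pt d) (q : HPt d) :
    (halveHPt μ p q).val 0 = q 0 + q 0 := rfl

theorem halveHPt_succ (μ : ℕ → ℕ) (p : Pt d) (q : HPt d) (i : Fin d) :
    (halveHPt μ p q).val i.succ = q i.succ - q 0 * p i := rfl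

/-- Congruence modulo 2 makes the division exact. Hence halving is injective on a class, and the
frames found after halving are carried back into `Λ`. -/
theorem doublePt_halvePt {p x : Pt d} (h : (congrTwo p x).val = true) :
    (doublePt p (halvePt p x).val).val = x := by
  funext i
  simp only [doublePt_val, halvePt_val]
  have : p i % 2 = x i % 2 := by
    have := of_decide_eq_true (p := ∀ i, p i % 2 = x i % 2) h
    exact this i
  omega

theorem doublePt_injective (p : Pt d) : Function.Injective fun x => (doublePt p x).val := by
  intro x y h
  funext i
  have := congrFun h i
  simp only [doublePt_val] at this
  omega

/-! ### Sorting -/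

section Sorting

variable {α : Type} {le : α → α → Timed Bool}

theorem mergeT_cons_cons (a : α) (as : List α) (b : α) (bs : List α) :
    (mergeT le (a :: as) (b :: bs)).val =
        (if (le a b).val then a :: (mergeT le as (b :: bs)).val
          else b :: (mergeT le (a :: as) bs).val) ∧
    (mergeT le (a :: as) (b :: bs)).cost = 1 + ((le a b).cost +
      if (le a b).val then (mergeT le as (b :: bs)).cost else (mergeT le (a :: as) bs).cost) := by
  rw [mergeT]
  simp only [bind_val, bind_cost, tick_cost]
  split <;> simp

theorem mergeT_perm (as bs : List α) : (mergeT le as bs).val.Perm (as ++ bs) := by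
  induction as generalizing bs with
  | nil => simp [mergeT]
  | cons a as iha =>
    induction bs with
    | nil => simp [mergeT]
    | cons b bs ihb =>
      rw [(mergeT_cons_cons (le := le) a as b bs).1]
      split
      · exact (iha (b :: bs)).cons a
      · exact (ihb.cons b).trans List.perm_middle.symm

theorem mergeT_cost_le {c : ℕ} (as bs : List α)
    (hc : ∀ a ∈ as ++ bs, ∀ b ∈ as ++ bs, (le a b).cost ≤ c) :
    (mergeT le as bs).cost ≤ 1 + (as.length + bs.length) * (1 + c) := by
  induction as generalizing bs with
  | nil => simp [mergeT]
  | cons a as iha =>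
    induction bs with
    | nil => simp [mergeT]
    | cons b bs ihb =>
      have hab := hc a (by simp) b (by simp)
      rw [(mergeT_cons_cons (le := le) a as b bs).2]
      split
      · have h4 := iha (b :: bs) fun x hx y hy => hc x (by simp_all) y (by simp_all)
        simp only [List.length_cons] at h4 ⊢
        have e : (as.length + 1 + (bs.length + 1)) * (1 + c) =
          (as.length + (bs.length + 1)) * (1 + c) + (1 + c) := by ring
        omega
      · have h4 := ihb fun x hx y hy => hc x
          (List.mem_append.2 ((List.mem_append.1 hx).imp_right (List.mem_cons_of_mem _))) y
          (List.mem_append.2 ((List.mem_append.1 hy).imp_right (List.mem_cons_of_mem _)))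
        simp only [List.length_cons] at h4 ⊢
        have e : (as.length + 1 + (bs.length + 1)) * (1 + c) =
          (as.length + 1 + bs.length) * (1 + c) + (1 + c) := by ring
        omega

theorem mergeT_pairwise {r : α → α → Prop} (hr : ∀ a b c, r a b → r b c → r a c)
    (h1 : ∀ a b, (le a b).val = true → r a b) (h2 : ∀ a b, (le a b).val ≠ true → r b a)
    (as bs : List α) (ha : as.Pairwise r) (hb : bs.Pairwise r) :
    (mergeT le as bs).val.Pairwise r := by
  induction as generalizing bs with
  | nil => simpa [mergeT] using hb
  | cons a as iha =>
    induction bs with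
    | nil => simpa [mergeT] using ha
    | cons b bs ihb =>
      rw [(mergeT_cons_cons (le := le) a as b bs).1]
      have ha' := List.pairwise_cons.1 ha
      have hb' := List.pairwise_cons.1 hb
      split
      · rename_i h
        refine List.pairwise_cons.2 ⟨fun x hx => ?_, iha _ ha'.2 hb⟩
        rcases List.mem_append.1 ((mergeT_perm _ _).subset hx) with hx | hx
        · exact ha'.1 x hx
        · rcases List.mem_cons.1 hx with rfl | hx
          · exact h1 _ _ h
          · exact hr _ _ _ (h1 _ _ h) (hb'.1 x hx)
      · rename_i h
        refine List.pairwise_cons.2 ⟨fun x hx => ?_, ihb hb'.2⟩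
        rcases List.mem_append.1 ((mergeT_perm _ _).subset hx) with hx | hx
        · rcases List.mem_cons.1 hx with rfl | hx
          · exact h2 _ _ h
          · exact hr _ _ _ (h2 _ _ h) (ha'.1 x hx)
        · exact hb'.1 x hx

theorem sortT_of_length_le {l : List α} (h : l.length ≤ 1) :
    (sortT le l).val = l ∧ (sortT le l).cost = 1 := by
  rw [sortT, dif_pos h]
  exact ⟨rfl, rfl⟩

theorem sortT_of_not_length_le {l : List α} (h : ¬l.length ≤ 1) :
    (sortT le l).val = (mergeT le (sortT le (l.take (l.length / 2))).val
      (sortT le (l.drop (l.length / 2))).val).val ∧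
    (sortT le l).cost = (1 + l.length) + ((sortT le (l.take (l.length / 2))).cost +
      ((sortT le (l.drop (l.length / 2))).cost +
      (mergeT le (sortT le (l.take (l.length / 2))).val
        (sortT le (l.drop (l.length / 2))).val).cost)) := by
  rw [sortT, dif_neg h]
  exact ⟨rfl, rfl⟩

/-- Each level of the recursion costs a constant times the length, and the number of levels is the
upper binary logarithm. -/
theorem sortT_spec {c : ℕ} (l : List α) (hc : ∀ a ∈ l, ∀ b ∈ l, (le a b).cost ≤ c) :
    (sortT le l).val.Perm l ∧
    (sortT le l).cost ≤ 1 + l.length * Nat.clog 2 l.length * (4 + c) := by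
  induction hn : l.length using Nat.strong_induction_on generalizing l with
  | _ n ih =>
    subst hn
    by_cases h : l.length ≤ 1
    · obtain ⟨h1, h2⟩ := sortT_of_length_le (le := le) h
      rw [h1, h2]
      exact ⟨List.Perm.refl _, by omega⟩
    · obtain ⟨h1, h2⟩ := sortT_of_not_length_le (le := le) h
      set k := l.length / 2 with hk
      obtain ⟨p1, q1⟩ := ih (l.take k).length (by simp; omega) (l.take k)
        (fun a ha b hb => hc a (List.mem_of_mem_take ha) b (List.mem_of_mem_take hb)) rfl
      obtain ⟨p2, q2⟩ := ih (l.drop k).length (by simp; omega) (l.drop k)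
        (fun a ha b hb => hc a (List.mem_of_mem_drop ha) b (List.mem_of_mem_drop hb)) rfl
      have p3 : ((sortT le (l.take k)).val ++ (sortT le (l.drop k)).val).Perm l := by
        simpa using p1.append p2
      have q4 := mergeT_cost_le (le := le) (c := c) (sortT le (l.take k)).val
        (sortT le (l.drop k)).val fun a ha b hb => hc a (p3.subset ha) b (p3.subset hb)
      rw [h1, h2]
      refine ⟨(mergeT_perm _ _).trans p3, ?_⟩
      rw [p1.length_eq, p2.length_eq] at q4
      rw [List.length_take_of_le (by omega)] at q1 q4
      rw [List.length_drop] at q2 q4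
      -- The longer half has `⌈n / 2⌉ = n - k` elements, and for this number the upper logarithm
      -- drops by exactly one.
      have e1 : Nat.clog 2 l.length = Nat.clog 2 (l.length - k) + 1 := by
        rw [Nat.clog_of_two_le (by norm_num) (by omega)]
        congr 2
        omega
      have e2 : Nat.clog 2 k ≤ Nat.clog 2 (l.length - k) := Nat.clog_mono_right _ (by omega)
      rw [e1]
      have e3 : k + (l.length - k) = l.length := by omega
      rw [e3] at q4
      set g := Nat.clog 2 (l.length - k)
      have e4 : k * Nat.clog 2 k * (4 + c) + (l.length - k) * g * (4 + c) ≤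
          l.length * g * (4 + c) := by
        calc _ ≤ k * g * (4 + c) + (l.length - k) * g * (4 + c) := by gcongr
          _ = (k + (l.length - k)) * g * (4 + c) := by ring
          _ = _ := by rw [e3]
      have e5 : l.length * (g + 1) * (4 + c) =
        l.length * g * (4 + c) + (l.length * (1 + c) + 3 * l.length) := by ring
      omega

theorem sortT_pairwise {r : α → α → Prop} (hr : ∀ a b c, r a b → r b c → r a c)
    (h1 : ∀ a b, (le a b).val = true → r a b) (h2 : ∀ a b, (le a b).val ≠ true → r b a)
    (l : List α) : (sortT le l).val.Pairwise r := by
  induction hn : l.length using Nat.strong_induction_on generalizing l with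
  | _ n ih =>
    subst hn
    by_cases h : l.length ≤ 1
    · rw [(sortT_of_length_le (le := le) h).1]
      match l, h with
      | [], _ => simp
      | [a], _ => simp
    · rw [(sortT_of_not_length_le (le := le) h).1]
      exact mergeT_pairwise hr h1 h2 _ _ (ih _ (by simp; omega) _ rfl)
        (ih _ (by simp; omega) _ rfl)

end Sorting

theorem sortBySize_spec {α : Type} (L : List (List α)) :
    (sortBySize L).val.Perm L ∧ (sortBySize L).val.Pairwise (fun a b => a.length ≤ b.length) ∧
    (sortBySize L).cost ≤
      1 + L.length * Nat.clog 2 L.length * (4 + (1 + 2 * L.flatten.length)) := by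
  have key := sortT_spec (le := fun a b : List α =>
    (⟨decide (a.length ≤ b.length), 1 + a.length + b.length⟩ : Timed Bool))
    (c := 1 + 2 * L.flatten.length) L fun a ha b hb => by
      have h1 := (List.sublist_flatten_of_mem ha).length_le
      have h2 := (List.sublist_flatten_of_mem hb).length_le
      show 1 + a.length + b.length ≤ _
      omega
  refine ⟨key.1, ?_, key.2⟩
  refine sortT_pairwise (fun a b c h1 h2 => h1.trans h2) ?_ ?_ L
  · intro a b h
    simpa using h
  · intro a b h
    have : ¬ a.length ≤ b.length := by simpa using h
    omega

/-! ### Congruence classes -/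

/-- Congruence modulo `2`. -/
def Congr (p q : Pt d) : Prop := ∀ i, p i % 2 = q i % 2

theorem congrTwo_val (p q : Pt d) : (congrTwo p q).val = true ↔ Congr p q := by
  simp [congrTwo, Congr]

theorem Congr.symm {p q : Pt d} (h : Congr p q) : Congr q p := fun i => (h i).symm

theorem Congr.trans {p q r : Pt d} (h : Congr p q) (h' : Congr q r) : Congr p r := fun i =>
  (h i).trans (h' i)

/-- A list of nonempty congruence classes. -/
structure IsPartition (cs : List (List (Pt d))) : Prop where
  ne_nil : ∀ c ∈ cs, c ≠ []
  congr : ∀ c ∈ cs, ∀ p ∈ c, ∀ q ∈ c, Congr p q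
  pairwise : cs.Pairwise fun c c' => ∀ p ∈ c, ∀ q ∈ c', ¬ Congr p q

/-- A class is determined by the parity vector of its first point. -/
theorem IsPartition.length_le {cs : List (List (Pt d))} (h : IsPartition cs) :
    cs.length ≤ 2 ^ d := by
  let f : List (Pt d) → Fin d → Bool := fun c i => decide ((c.headD 0) i % 2 = 0)
  have hn : (cs.map f).Nodup := by
    rw [List.Nodup, List.pairwise_map]
    refine (List.pairwise_iff_forall_sublist.2 ?_)
    intro c c' hs e
    have h1 := List.pairwise_iff_forall_sublist.1 h.pairwise hs
    obtain ⟨p, l, rfl⟩ := List.exists_cons_of_ne_nil (h.ne_nil c (hs.subset (by simp)))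
    obtain ⟨p', l', rfl⟩ := List.exists_cons_of_ne_nil (h.ne_nil c' (hs.subset (by simp)))
    refine h1 p (by simp) p' (by simp) fun i => ?_
    have := congrFun e i
    simp only [f, List.headD_cons] at this
    have := decide_eq_decide.1 this
    omega
  simpa using hn.length_le_card

theorem insertClass_spec {c : ℕ} (p : Pt d) (cs : List (List (Pt d))) (h : IsPartition cs)
    (hc : ∀ q ∈ p :: cs.flatten, (congrTwo p q).cost ≤ c) :
    IsPartition (insertClass p cs).val ∧ (insertClass p cs).val.flatten.Perm (p :: cs.flatten) ∧
    (insertClass p cs).cost ≤ 1 + cs.length * c := by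
  induction cs with
  | nil =>
    refine ⟨⟨by simp [insertClass], ?_, by simp [insertClass]⟩, by simp [insertClass],
      by simp [insertClass]⟩
    intro c hc x hx y hy
    have e : c = [p] := by simpa [insertClass] using hc
    subst e
    simp only [List.mem_singleton] at hx hy
    subst hx
    subst hy
    exact fun i => rfl
  | cons l cs ih =>
    obtain ⟨x, l, rfl⟩ := List.exists_cons_of_ne_nil (h.ne_nil l (by simp))
    have hpw := List.pairwise_cons.1 h.pairwise
    have hcs : IsPartition cs := ⟨fun c hc => h.ne_nil c (by simp [hc]),
      fun c hc => h.congr c (by simp [hc]), hpw.2⟩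
    obtain ⟨i1, i2, i3⟩ := ih hcs fun q hq => hc q (by
      rcases List.mem_cons.1 hq with rfl | hq
      · simp
      · rw [List.flatten_cons]; simp [hq])
    have hx := hc x (by simp)
    have hcl := h.congr (x :: l) (by simp)
    simp only [insertClass, bind_val, bind_cost, List.headD_cons, List.length_cons, add_mul, one_mul]
    by_cases hb : (congrTwo p x).val = true
    · have hpx : ∀ y ∈ x :: l, Congr p y := fun y hy =>
        ((congrTwo_val p x).1 hb).trans (hcl x (by simp) y hy)
      rw [if_pos hb]
      refine ⟨⟨?_, ?_, ?_⟩, by simp, by simp only [pure_cost]; omega⟩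
      · intro c hc
        rcases List.mem_cons.1 hc with rfl | hc
        · simp
        · exact hcs.ne_nil c hc
      · intro c hc
        rcases List.mem_cons.1 hc with rfl | hc
        · intro y hy z hz
          rcases List.mem_cons.1 hy with hy' | hy'
          · rw [hy']
            rcases List.mem_cons.1 hz with hz' | hz'
            · rw [hz']
              exact fun i => rfl
            · exact hpx z hz'
          · rcases List.mem_cons.1 hz with hz' | hz'
            · rw [hz']
              exact (hpx y hy').symm
            · exact hcl y hy' z hz'
        · exact hcs.congr c hc
      · refine List.pairwise_cons.2 ⟨fun c hc' y hy z hz hyz => ?_, hpw.2⟩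
        rcases List.mem_cons.1 hy with hy' | hy'
        · rw [hy'] at hyz
          exact hpw.1 c hc' x (by simp) z hz (((congrTwo_val _ x).1 hb).symm.trans hyz)
        · exact hpw.1 c hc' y hy' z hz hyz
    · rw [if_neg hb]
      refine ⟨⟨?_, ?_, ?_⟩, ?_, by simp only [bind_cost, pure_cost]; omega⟩
      · intro c hc
        simp only [bind_val, pure_val] at hc
        rcases List.mem_cons.1 hc with rfl | hc
        · simp
        · exact i1.ne_nil c hc
      · intro c hc
        simp only [bind_val, pure_val] at hc
        rcases List.mem_cons.1 hc with rfl | hc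
        · exact hcl
        · exact i1.congr c hc
      · simp only [bind_val, pure_val]
        refine List.pairwise_cons.2 ⟨fun c hc y hy z hz hyz => ?_, i1.pairwise⟩
        have hz' := i2.subset (List.mem_flatten.2 ⟨c, hc, hz⟩)
        rcases List.mem_cons.1 hz' with rfl | hz'
        · exact hb ((congrTwo_val _ x).2 (hyz.symm.trans (hcl y hy x (by simp))))
        · obtain ⟨c', hc', hz'⟩ := List.mem_flatten.1 hz'
          exact hpw.1 c' hc' y hy z hz' hyz
      · simp only [bind_val, pure_val, List.flatten_cons]
        exact (List.Perm.append_left _ i2).trans List.perm_middle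

theorem partitionTwo_spec {c : ℕ} (Λ : List (Pt d))
    (hc : ∀ p ∈ Λ, ∀ q ∈ Λ, (congrTwo p q).cost ≤ c) :
    IsPartition (partitionTwo Λ).val ∧ (partitionTwo Λ).val.flatten.Perm Λ ∧
    (partitionTwo Λ).cost ≤ 1 + Λ.length * (2 + 2 ^ d * c) := by
  have key : ∀ (L : List (Pt d)) (cs : List (List (Pt d))), IsPartition cs →
      (∀ p ∈ L, ∀ q ∈ L ++ cs.flatten, (congrTwo p q).cost ≤ c) →
      IsPartition (foldT (fun cs p => insertClass p cs) cs L).val ∧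
      (foldT (fun cs p => insertClass p cs) cs L).val.flatten.Perm (L ++ cs.flatten) ∧
      (foldT (fun cs p => insertClass p cs) cs L).cost ≤ 1 + L.length * (2 + 2 ^ d * c) := by
    intro L
    induction L with
    | nil => exact fun cs h _ => ⟨h, by simp [foldT], by simp [foldT]⟩
    | cons p L ih =>
      intro cs h hc
      obtain ⟨h1, h2, h3⟩ := insertClass_spec (c := c) p cs h fun q hq => hc p (by simp) q (by
        rcases List.mem_cons.1 hq with rfl | hq
        · simp
        · simp only [List.mem_append]; exact Or.inr hq)
      obtain ⟨h4, h5, h6⟩ := ih (insertClass p cs).val h1 fun x hx y hy => hc x (by simp [hx]) y (by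
        rcases List.mem_append.1 hy with hy | hy
        · simp [hy]
        · rcases List.mem_cons.1 (h2.subset hy) with rfl | hy
          · simp
          · simp only [List.mem_append]; exact Or.inr hy)
      rw [foldT_cons]
      refine ⟨h4, ?_, ?_⟩
      · exact h5.trans ((List.Perm.append_left L h2).trans List.perm_middle)
      · have : cs.length * c ≤ 2 ^ d * c := Nat.mul_le_mul_right _ h.length_le
        simp only [List.length_cons, add_mul, one_mul]
        omega
  have h := key Λ [] ⟨by simp, by simp, by simp⟩ (by simpa using hc)
  simpa [partitionTwo] using h

/-! ### The extended Euclidean algorithm -/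

theorem xgcdT_zero (μ : ℕ → ℕ) (a : ℤ) : xgcdT μ a 0 = ⟨(a, 1, 0), 1⟩ := by
  rw [xgcdT, dif_pos rfl]
  rfl

theorem xgcdT_of_ne_zero (μ : ℕ → ℕ) (a : ℤ) {b : ℤ} (h : b ≠ 0) :
    xgcdT μ a b = ⟨((xgcdT μ b (a % b)).val.1, (xgcdT μ b (a % b)).val.2.2,
        (xgcdT μ b (a % b)).val.2.1 - a / b * (xgcdT μ b (a % b)).val.2.2),
      (divI a b).cost + ((xgcdT μ b (a % b)).cost +
        ((mulI μ (a / b) (xgcdT μ b (a % b)).val.2.2).cost +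
        ((subI (xgcdT μ b (a % b)).val.2.1 (a / b * (xgcdT μ b (a % b)).val.2.2)).cost + 0)))⟩ := by
  rw [xgcdT, dif_neg h]
  rfl

theorem natAbs_emod_lt (a : ℤ) {b : ℤ} (h : b ≠ 0) : (a % b).natAbs < b.natAbs := by
  have h1 := Int.emod_nonneg a h
  have h2 := Int.emod_lt_abs a h
  rw [Int.abs_eq_natAbs] at h2
  omega

theorem xgcdT_spec (μ : ℕ → ℕ) (a b : ℤ) :
    (xgcdT μ a b).val.1 = (xgcdT μ a b).val.2.1 * a + (xgcdT μ a b).val.2.2 * b ∧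
    (xgcdT μ a b).val.1 ∣ a ∧ (xgcdT μ a b).val.1 ∣ b := by
  induction hn : b.natAbs using Nat.strong_induction_on generalizing a b with
  | _ n ih =>
    subst hn
    by_cases h : b = 0
    · subst h
      simp [xgcdT_zero]
    · obtain ⟨h1, h2, h3⟩ := ih _ (natAbs_emod_lt a h) b (a % b) rfl
      rw [xgcdT_of_ne_zero μ a h]
      set e := (xgcdT μ b (a % b)).val
      have e1 := Int.emod_add_mul_ediv a b
      refine ⟨?_, ?_, h2⟩
      · linear_combination h1 + e.2.2 * e1
      · rw [← e1]
        exact dvd_add h3 (h2.mul_right _)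

/-- In the inductive step the new coefficient is at most `a % b + (a / b) * b = a`. The maximum with
1 covers the terminal coefficients `(1, 0)` and the step with remainder zero. -/
theorem xgcdT_abs_le (μ : ℕ → ℕ) {a b : ℤ} (ha : 0 ≤ a) (hb : 0 ≤ b) :
    |(xgcdT μ a b).val.2.1| ≤ max b 1 ∧ |(xgcdT μ a b).val.2.2| ≤ max a 1 := by
  induction hn : b.natAbs using Nat.strong_induction_on generalizing a b with
  | _ n ih =>
    subst hn
    by_cases h : b = 0
    · subst h
      simp [xgcdT_zero]
    · have hr := Int.emod_nonneg a h
      obtain ⟨h1, h2⟩ := ih _ (natAbs_emod_lt a h) hb hr rfl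
      have e1 := Int.emod_add_mul_ediv a b
      have hq : 0 ≤ a / b := Int.ediv_nonneg ha hb
      rw [xgcdT_of_ne_zero μ a h]
      refine ⟨h2, ?_⟩
      by_cases hr0 : a % b = 0
      · rw [hr0, xgcdT_zero]
        simp
      · have h3 : |(xgcdT μ b (a % b)).val.2.1| ≤ a % b := h1.trans (max_le le_rfl (by omega))
        have h4 : |(xgcdT μ b (a % b)).val.2.2| ≤ b := h2.trans (max_le le_rfl (by omega))
        refine le_trans ?_ (le_max_left _ _)
        calc _ ≤ |(xgcdT μ b (a % b)).val.2.1| + |a / b * (xgcdT μ b (a % b)).val.2.2| :=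
              abs_sub _ _
          _ ≤ a % b + a / b * b := by
              rw [abs_mul, abs_of_nonneg hq]
              gcongr
          _ = a := by linarith

/-- The cost of one step of the Euclidean algorithm. -/
theorem xgcdT_cost_step (hμ : IsMulCost μ) {a b : ℤ} (h : b ≠ 0) {β w : ℕ} (ha : bits a ≤ β)
    (hb : bits b ≤ β) (hx : bits (xgcdT μ b (a % b)).val.2.1 ≤ β)
    (hy : bits (xgcdT μ b (a % b)).val.2.2 ≤ β) (h1 : 1 + (β + β) ≤ w) (h2 : 1 + μ β ≤ w) :
    (xgcdT μ a b).cost ≤ (xgcdT μ b (a % b)).cost + 5 * w * (bits (a / b) + 1) := by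
  have hq : bits (a / b) ≤ β := (bits_ediv_le a b).trans ha
  have c1 : (divI a b).cost = 1 + bits a + (bits (a / b) + 1) * (bits b + 1) := rfl
  have c2 := mulI_cost_le hμ hq hy h2
  have c3 := subI_cost_le (w := w) (b := β + β) (x := (xgcdT μ b (a % b)).val.2.1)
    (y := a / b * (xgcdT μ b (a % b)).val.2.2) (by omega) (bits_mul_le hq hy) h1
  have c4 : (bits (a / b) + 1) * (bits b + 1) ≤ (bits (a / b) + 1) * w := by
    gcongr; omega
  have c5 : 4 * w * 1 ≤ 4 * w * (bits (a / b) + 1) := by gcongr; omega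
  have c6 : 5 * w * (bits (a / b) + 1) =
    4 * w * (bits (a / b) + 1) + (bits (a / b) + 1) * w := by ring
  rw [xgcdT_of_ne_zero μ a h]
  show _ + (_ + (_ + (_ + 0))) ≤ _
  omega

theorem bits_mono_of_nonneg {x y : ℤ} (hx : 0 ≤ x) (h : x ≤ y) : bits x ≤ bits y :=
  bits_mono (by omega)

theorem two_pow_le_of_lt_bits {x : ℤ} (hx : 0 ≤ x) {k : ℕ} (h : k < bits x) : 2 ^ k ≤ x := by
  have h1 := Nat.lt_size.1 h
  have h2 : ((2 ^ k : ℕ) : ℤ) ≤ x.natAbs := by exact_mod_cast h1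
  rw [Int.natAbs_of_nonneg hx] at h2
  exact_mod_cast h2

theorem lt_bits_of_two_pow_le {x : ℤ} {k : ℕ} (h : 2 ^ k ≤ x) : k < bits x := by
  refine Nat.lt_size.2 ?_
  zify
  exact h.trans (le_abs_self x)

theorem bits_le_of_abs_le_max {x y : ℤ} (hy : 0 ≤ y) (h : |x| ≤ max y 1) :
    bits x ≤ max (bits y) 1 := by
  rw [Int.abs_eq_natAbs] at h
  rcases max_choice y 1 with h' | h' <;> rw [h'] at h
  · exact (bits_mono (y := y) (by omega)).trans (le_max_left _ _)
  · exact (bits_mono (y := 1) (by have h : (x.natAbs : ℤ) ≤ 1 := h; omega)).trans (by simp [bits_one])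

/-- Long divisions in the Euclidean algorithm have short quotients on average. -/
theorem bits_ediv_add_one_le {a b : ℤ} (hb : 0 < b) (hab : b ≤ a) :
    bits (a / b) + 1 + 3 * bits (a % b) ≤ 3 * bits a := by
  have ha : 0 < a := hb.trans_le hab
  have hr0 := Int.emod_nonneg a hb.ne'
  have hrb := Int.emod_lt_of_pos a hb
  have e := Int.emod_add_mul_ediv a b
  have hq : 1 ≤ a / b := (Int.le_ediv_iff_mul_le hb).2 (by linarith)
  -- From `a % b < b` and `b ≤ a` follows `2 * (a % b) ≤ a % b + b ≤ a`.
  have k1 : bits (a % b) + 1 ≤ bits a := by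
    rcases Nat.eq_zero_or_pos (bits (a % b)) with h | h
    · rw [h]
      exact lt_bits_of_two_pow_le (by rw [pow_zero]; exact ha)
    · refine lt_bits_of_two_pow_le ?_
      have h1 := two_pow_le_of_lt_bits hr0 (Nat.sub_lt h one_pos)
      calc (2 : ℤ) ^ bits (a % b) = 2 ^ (bits (a % b) - 1) * 2 := by
            rw [← pow_succ, Nat.sub_add_cancel h]
        _ ≤ a % b * 2 := by gcongr
        _ ≤ a := by nlinarith
  -- The product of the leading powers of two of `a / b` and `b` is at most `a`.
  have k2 : bits (a / b) + bits b ≤ bits a + 1 := by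
    have hq' : 0 < bits (a / b) := lt_bits_of_two_pow_le (by simpa using hq)
    have hb' : 0 < bits b := lt_bits_of_two_pow_le (by rw [pow_zero]; exact hb)
    have h1 := two_pow_le_of_lt_bits (by omega) (Nat.sub_lt hq' one_pos)
    have h2 := two_pow_le_of_lt_bits hb.le (Nat.sub_lt hb' one_pos)
    have h3 : bits (a / b) - 1 + (bits b - 1) < bits a := by
      refine lt_bits_of_two_pow_le ?_
      rw [pow_add]
      calc _ ≤ a / b * b := by gcongr
        _ ≤ a := by nlinarith
    omega
  have k3 : bits (a % b) ≤ bits b := bits_mono_of_nonneg hr0 hrb.le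
  omega

/-- The quantity `15 * w * (bits a + bits b)` is a potential. A step costs at most `5 * w * (bits (a
/ b) + 1)`, and by `bits_ediv_add_one_le` this is paid for by the passage from `bits a` to `bits (a
% b)`. Thus long division, although quadratic in a single step, does not cost more than `s * μ s` in
total. -/
theorem xgcdT_cost_le (hμ : IsMulCost μ) {β w : ℕ} (hβ : 1 ≤ β) (h1 : 1 + (β + β) ≤ w)
    (h2 : 1 + μ β ≤ w) {a b : ℤ} (hb : 0 ≤ b) (hab : b ≤ a) (ha : bits a ≤ β) :
    (xgcdT μ a b).cost ≤ 1 + 15 * w * (bits a + bits b) := by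
  induction hn : b.natAbs using Nat.strong_induction_on generalizing a b with
  | _ n ih =>
    subst hn
    by_cases h : b = 0
    · subst h
      simp [xgcdT_zero]
    · have hb' : 0 < b := lt_of_le_of_ne hb (Ne.symm h)
      have hr0 := Int.emod_nonneg a h
      have hrb := Int.emod_lt_of_pos a hb'
      have hbb : bits b ≤ β := (bits_mono_of_nonneg hb hab).trans ha
      have h3 := ih _ (natAbs_emod_lt a h) hr0 hrb.le hbb rfl
      obtain ⟨h4, h5⟩ := xgcdT_abs_le μ hb hr0
      have small : ∀ x y : ℤ, 0 ≤ y → bits y ≤ β → |x| ≤ max y 1 → bits x ≤ β := by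
        exact fun x y hy hy' hx => (bits_le_of_abs_le_max hy hx).trans (max_le hy' hβ)
      have h6 := xgcdT_cost_step hμ h ha hbb
        (small _ _ hr0 ((bits_mono_of_nonneg hr0 hrb.le).trans hbb) h4) (small _ _ hb hbb h5) h1 h2
      have h7 : 5 * w * (bits (a / b) + 1 + 3 * bits (a % b)) ≤ 5 * w * (3 * bits a) :=
        Nat.mul_le_mul_left _ (bits_ediv_add_one_le hb' hab)
      have e1 : 5 * w * (bits (a / b) + 1 + 3 * bits (a % b)) =
        5 * w * (bits (a / b) + 1) + 15 * w * bits (a % b) := by ring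
      have e2 : 15 * w * (bits b + bits (a % b)) = 15 * w * bits b + 15 * w * bits (a % b) := by
        ring
      have e3 : 15 * w * (bits a + bits b) = 5 * w * (3 * bits a) + 15 * w * bits b := by ring
      omega

/-- The bounds that hold for the extended Euclidean algorithm. -/
def XgcdBound (μ : ℕ → ℕ) (A C s : ℕ) (x y : ℤ) : Prop :=
  bits (xgcdT μ x y).val.2.1 ≤ A * s ∧ bits (xgcdT μ x y).val.2.2 ≤ A * s ∧
  (xgcdT μ x y).cost ≤ C * (s * μ s)

theorem xgcdBound_zero (hμ : IsMulCost μ) {A C s : ℕ} (hs : 1 ≤ s) (hA : 1 ≤ A) (hC : 1 ≤ C)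
    (x : ℤ) : XgcdBound μ A C s x 0 := by
  have hw := hμ.one_le hs
  simp only [XgcdBound, xgcdT_zero, bits_one, bits_zero]
  exact ⟨Nat.mul_pos hA hs, Nat.zero_le _, Nat.mul_pos hC (Nat.mul_pos hs hw)⟩

/-- Allows finitely many initial steps to be treated separately, at the price of larger constants.
-/
theorem exists_xgcdBound_step (hμ : IsMulCost μ) (a A C : ℕ) : ∃ A' C', 1 ≤ A' ∧ 1 ≤ C' ∧
    ∀ s, 1 ≤ s → ∀ x y : ℤ, y ≠ 0 → bits x ≤ a * s → bits y ≤ a * s →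
    XgcdBound μ A C s y (x % y) → XgcdBound μ A' C' s x y := by
  obtain ⟨C₂, h₂⟩ := hμ.exists_op ((a + A) + (a + A))
  refine ⟨a + A + 1, C + 5 * C₂ * (a + 1) + 1, by omega, by omega,
    fun s hs x y hy hx hy' ⟨h1, h2, h3⟩ => ?_⟩
  have e : ((a + A) + (a + A)) * s = (a + A) * s + (a + A) * s := by ring
  have e' : (a + A) * s = a * s + A * s := by ring
  have e'' : (a + A + 1) * s = a * s + A * s + s := by ring
  have hq : bits (x / y) ≤ a * s := (bits_ediv_le x y).trans hx
  have h4 := xgcdT_cost_step hμ (a := x) hy (β := (a + A) * s) (w := C₂ * μ s) (by omega) (by omega)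
    (by omega) (by omega) (h₂ s hs _ e.ge).1 (h₂ s hs _ (by omega)).2
  refine ⟨?_, ?_, h4.trans ?_⟩
  · rw [xgcdT_of_ne_zero μ x hy]
    exact h2.trans (by gcongr; omega)
  · rw [xgcdT_of_ne_zero μ x hy]
    exact (bits_sub_le (b := a * s + A * s) (h1.trans (by omega)) (bits_mul_le hq h2)).trans
      (by omega)
  · calc _ ≤ C * (s * μ s) + 5 * (C₂ * μ s) * (a * s + s) := by gcongr
      _ ≤ _ + s * μ s := Nat.le_add_right _ _
      _ = _ := by ring

/-- Remainders are nonnegative and smaller than the modulus in absolute value. After two divisions,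
if the algorithm has not stopped, the pair is therefore nonnegative and decreasing, as the potential
argument requires. -/
theorem exists_xgcdT_bound (hμ : IsMulCost μ) (a : ℕ) : ∃ A C, ∀ s, 1 ≤ s → ∀ x y : ℤ,
    bits x ≤ a * s → bits y ≤ a * s → XgcdBound μ A C s x y := by
  obtain ⟨C, hC⟩ := hμ.exists_op ((a + 1) + (a + 1))
  have h0 : ∀ s, 1 ≤ s → ∀ x y : ℤ, 0 ≤ y → y ≤ x → bits x ≤ a * s →
      XgcdBound μ (a + 1) (1 + 15 * C * (a + a)) s x y := by
    intro s hs x y hy hyx hx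
    have hw := hμ.one_le hs
    have e1 : ((a + 1) + (a + 1)) * s = (a + 1) * s + (a + 1) * s := by ring
    have e2 : (a + 1) * s = a * s + s := by ring
    have hyb : bits y ≤ a * s := (bits_mono_of_nonneg hy hyx).trans hx
    have small : ∀ x y : ℤ, 0 ≤ y → bits y ≤ a * s → |x| ≤ max y 1 → bits x ≤ (a + 1) * s := by
      exact fun x y hy hy' hx => (bits_le_of_abs_le_max hy hx).trans (by omega)
    obtain ⟨h1, h2⟩ := xgcdT_abs_le μ (hy.trans hyx) hy
    refine ⟨small _ _ hy hyb h1, small _ _ (hy.trans hyx) hx h2, ?_⟩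
    have h3 := xgcdT_cost_le hμ (β := (a + 1) * s) (by omega) (hC s hs _ e1.ge).1
      (hC s hs _ (by omega)).2 hy hyx (by omega)
    calc _ ≤ s * μ s + 15 * (C * μ s) * (a * s + a * s) := by
          refine h3.trans ?_
          gcongr
          exact Nat.mul_pos hs hw
      _ = _ := by ring
  obtain ⟨A₁, C₁, hA₁, hC₁, h₁⟩ := exists_xgcdBound_step hμ a (a + 1) (1 + 15 * C * (a + a))
  have h1 : ∀ s, 1 ≤ s → ∀ x y : ℤ, 0 ≤ y → bits x ≤ a * s → bits y ≤ a * s →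
      XgcdBound μ A₁ C₁ s x y := by
    intro s hs x y hy hx hyb
    by_cases h : y = 0
    · subst h
      exact xgcdBound_zero hμ hs hA₁ hC₁ x
    · exact h₁ s hs x y h hx hyb (h0 s hs y _ (Int.emod_nonneg x h)
        (Int.emod_lt_of_pos x (by omega)).le hyb)
  obtain ⟨A₂, C₂, hA₂, hC₂, h₂⟩ := exists_xgcdBound_step hμ a A₁ C₁
  refine ⟨A₂, C₂, fun s hs x y hx hyb => ?_⟩
  by_cases h : y = 0
  · subst h
    exact xgcdBound_zero hμ hs hA₂ hC₂ x
  · exact h₂ s hs x y h hx hyb (h1 s hs y _ (Int.emod_nonneg x h) hyb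
      ((bits_mono (natAbs_emod_lt x h).le).trans hyb))

/-! ### Hermite normal form -/

/-- A loop of bounded length, in which each step enlarges the state by a bounded factor. -/
theorem foldT_growth {α β κ : Type} (f : κ → β → α → Timed β) (p : κ → α → Prop)
    (G : ℕ → ℕ → β → Prop) (U : ℕ → ℕ) (hU : ∀ s, 1 ≤ s → 1 ≤ U s)
    (h : ∀ a, ∃ A C, ∀ s, 1 ≤ s → ∀ k b x, p k x → G a s b →
      G A s (f k b x).val ∧ (f k b x).cost ≤ C * U s)
    (hG : ∀ a A s b, a ≤ A → G a s b → G A s b) (N : ℕ) :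
    ∀ a, ∃ A C, ∀ s, 1 ≤ s → ∀ k b l, l.length ≤ N → (∀ x ∈ l, p k x) → G a s b →
      G A s (foldT (f k) b l).val ∧ (foldT (f k) b l).cost ≤ C * U s := by
  induction N with
  | zero =>
    refine fun a => ⟨a, 1, fun s hs k b l hl _ hb => ?_⟩
    have : l = [] := by simpa using hl
    subst this
    exact ⟨hb, by simpa [foldT] using hU s hs⟩
  | succ N ih =>
    intro a
    obtain ⟨A₁, C₁, h₁⟩ := h a
    -- The rest of the loop starts from the size produced by the first step. The constants are
    -- composed `N` times, so the bound on the length of the loop is essential.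
    obtain ⟨A₂, C₂, h₂⟩ := ih A₁
    refine ⟨max a A₂, 1 + C₁ + C₂, fun s hs k b l hl hp hb => ?_⟩
    have h1 := hU s hs
    have e : (1 + C₁ + C₂) * U s = U s + C₁ * U s + C₂ * U s := by ring
    cases l with
    | nil => exact ⟨hG _ _ _ _ (le_max_left _ _) hb, by simp only [foldT, bind_cost, tick_cost, pure_cost]; omega⟩
    | cons x l =>
      obtain ⟨h3, h4⟩ := h₁ s hs k b x (hp x (by simp)) hb
      obtain ⟨h5, h6⟩ := h₂ s hs k _ l (by simpa using hl) (fun y hy => hp y (by simp [hy])) h3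
      rw [foldT_cons]
      exact ⟨hG _ _ _ _ (le_max_right _ _) h5, by dsimp only; omega⟩

theorem combT_val (μ : ℕ → ℕ) {ι : Type} [Fintype ι] (a : ℤ) (u : ι → ℤ) (b : ℤ) (v : ι → ℤ) :
    (combT μ a u b v).val = fun k => a * u k + b * v k := rfl

theorem combT_bound (hμ : IsMulCost μ) {ι : Type} [Fintype ι] {a : ℤ} {u : ι → ℤ} {b : ℤ}
    {v : ι → ℤ} {β w D : ℕ} (hD : Fintype.card ι ≤ D) (ha : bits a ≤ β) (hu : ∀ k, bits (u k) ≤ β)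
    (hb : bits b ≤ β) (hv : ∀ k, bits (v k) ≤ β) (h1 : 1 + (β + β) ≤ w) (h2 : 1 + μ β ≤ w) :
    (∀ k, bits ((combT μ a u b v).val k) ≤ β + β + 1) ∧
    (combT μ a u b v).cost ≤ D * (1 + 4 * w) := by
  refine ⟨fun k => bits_add_le (bits_mul_le ha (hu k)) (bits_mul_le hb (hv k)),
    vecT_cost_le hD fun k => ?_⟩
  have c1 := mulI_cost_le hμ ha (hu k) h2
  have c2 := mulI_cost_le hμ hb (hv k) h2
  have c3 := addI_cost_le (bits_mul_le ha (hu k)) (bits_mul_le hb (hv k)) h1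
  simp only [bind_cost, mulI_val]
  omega

/-- The row operations recorded in an augmented matrix. -/
def rowOps (R : AugMat d) : Fin d → Fin d → ℤ := fun i j => R i (Sum.inr j)

/-- The size of the entries of an augmented matrix is at most `a * s`, and the recorded row
operations are invertible. -/
def GoodMat (a s : ℕ) (R : AugMat d) : Prop :=
  (∀ i k, bits (R i k) ≤ a * s) ∧ Submodule.span ℤ (Set.range (rowOps R)) = ⊤

theorem GoodMat.mono {a A s : ℕ} {R : AugMat d} (hA : a ≤ A) (h : GoodMat a s R) :
    GoodMat A s R :=
  ⟨fun i k => (h.1 i k).trans (Nat.mul_le_mul_right _ hA), h.2⟩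

/-- Invertibility is followed as the property that the rows generate ℤ^d. It is then enough to
recover each old row as an integral combination of the new rows, without computing determinants. -/
theorem span_rowOps_eq_top {R R' : AugMat d} (h : Submodule.span ℤ (Set.range (rowOps R)) = ⊤)
    (h' : ∀ i, rowOps R i ∈ Submodule.span ℤ (Set.range (rowOps R'))) :
    Submodule.span ℤ (Set.range (rowOps R')) = ⊤ := by
  rw [eq_top_iff, ← h, Submodule.span_le]
  rintro _ ⟨i, rfl⟩
  exact h' i

theorem mem_span_rowOps (R : AugMat d) (i : Fin d) :
    rowOps R i ∈ Submodule.span ℤ (Set.range (rowOps R)) :=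
  Submodule.subset_span ⟨i, rfl⟩

theorem divI_cost_le {x y : ℤ} {b w : ℕ} (hx : bits x ≤ b) (hy : bits y ≤ b) (h : 1 + b ≤ w) :
    (divI x y).cost ≤ w + (b + 1) * w := by
  have h1 : (divI x y).cost = 1 + bits x + (bits (x / y) + 1) * (bits y + 1) := rfl
  have h2 : (bits (x / y) + 1) * (bits y + 1) ≤ (b + 1) * w :=
    Nat.mul_le_mul (by have := bits_ediv_le x y; omega) (by omega)
  omega

theorem bits_update {R : AugMat d} {i : Fin d} {v : Fin d ⊕ Fin d → ℤ} {b : ℕ}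
    (hR : ∀ i k, bits (R i k) ≤ b) (hv : ∀ k, bits (v k) ≤ b) (j : Fin d) (k : Fin d ⊕ Fin d) :
    bits (Function.update R i v j k) ≤ b := by
  by_cases h : j = i
  · subst h
    simpa using hv k
  · simpa [h] using hR j k

/-- The two rows are multiplied by a matrix of determinant 1, by the Bézout identity, and its
inverse expresses the old rows in the new ones. The cofactors are no longer than the entries
themselves, because the greatest common divisor divides exactly. -/
theorem exists_clearEntry_bound (hμ : IsMulCost μ) (d a : ℕ) : ∃ A C, ∀ s, 1 ≤ s →
    ∀ (j r : Fin d) (R : AugMat d) (i : Fin d), r < i → GoodMat a s R →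
    GoodMat A s (clearEntry μ j r R i).val ∧
    (clearEntry μ j r R i).cost ≤ C * (s * μ s) := by
  obtain ⟨A, C, h⟩ := exists_xgcdT_bound hμ a
  obtain ⟨C', h'⟩ := hμ.exists_op ((a + A) + (a + A))
  refine ⟨(a + A) + (a + A) + 1,
    1 + C + 2 * (C' + (a + A + 1) * C') + 2 * ((2 * d) * (1 + 4 * C')),
    fun s hs j r R i hri hR => ?_⟩
  have hw := hμ.one_le hs
  have e1 : ((a + A) + (a + A)) * s = (a + A) * s + (a + A) * s := by ring
  have e2 : ((a + A) + (a + A) + 1) * s = (a + A) * s + (a + A) * s + s := by ring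
  have e3 : (a + A) * s = a * s + A * s := by ring
  have hsw : μ s ≤ s * μ s := Nat.le_mul_of_pos_left _ hs
  obtain ⟨h1, h2⟩ := h' s hs _ e1.ge
  have h2 := (h' s hs ((a + A) * s) (by omega)).2
  by_cases h0 : R i (Sum.inl j) = 0
  · simp only [clearEntry, if_pos h0, bind_val, bind_cost, tick_cost, pure_val, pure_cost]
    refine ⟨hR.mono (by omega), ?_⟩
    calc 1 + 0 ≤ 1 * (s * μ s) := by omega
      _ ≤ _ := by gcongr; omega
  · simp only [clearEntry, if_neg h0, bind_val, bind_cost, tick_cost, pure_val, pure_cost, divI_val]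
    set x := R r (Sum.inl j) with hx
    set y := R i (Sum.inl j) with hy
    obtain ⟨b1, b2, b3⟩ := h s hs x y (hR.1 _ _) (hR.1 _ _)
    obtain ⟨g1, g2, g3⟩ := xgcdT_spec μ x y
    set e := (xgcdT μ x y).val
    have hg : e.1 ≠ 0 := fun h => h0 (zero_dvd_iff.1 (h ▸ g3))
    have bx : bits x ≤ a * s := hR.1 _ _
    have bY : bits y ≤ a * s := hR.1 _ _
    have bg : bits e.1 ≤ a * s := (bits_mono (Nat.le_of_dvd (Int.natAbs_pos.2 h0)
      (Int.natAbs_dvd_natAbs.2 g3))).trans bY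
    have bqx := (bits_ediv_le x e.1).trans bx
    have bqy := (bits_ediv_le y e.1).trans bY
    obtain ⟨u1, u2⟩ := combT_bound hμ (β := (a + A) * s) (w := C' * μ s) (D := 2 * d)
      (a := e.2.1) (b := e.2.2) (u := R r) (v := R i) (by simp; omega) (by omega)
      (fun k => by have := hR.1 r k; omega) (by omega) (fun k => by have := hR.1 i k; omega) h1 h2
    obtain ⟨v1, v2⟩ := combT_bound hμ (β := (a + A) * s) (w := C' * μ s) (D := 2 * d)
      (a := x / e.1) (b := -(y / e.1)) (u := R i) (v := R r) (by simp; omega) (by omega)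
      (fun k => by have := hR.1 i k; omega) (by rw [bits_neg]; omega)
      (fun k => by have := hR.1 r k; omega) h1 h2
    have c1 := divI_cost_le (b := (a + A) * s) (w := C' * μ s) (x := x) (y := e.1) (by omega)
      (by omega) (by omega)
    have c2 := divI_cost_le (b := (a + A) * s) (w := C' * μ s) (x := y) (y := e.1) (by omega)
      (by omega) (by omega)
    refine ⟨⟨?_, span_rowOps_eq_top hR.2 fun l => ?_⟩, ?_⟩
    · exact bits_update (bits_update (fun l k => (hR.1 l k).trans (by omega))
        fun k => (u1 k).trans (by omega)) fun k => (v1 k).trans (by omega)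
    · set R' := Function.update (Function.update R r (combT μ e.2.1 (R r) e.2.2 (R i)).val) i
        (combT μ (x / e.1) (R i) (-(y / e.1)) (R r)).val with hR'
      have hne : r ≠ i := hri.ne
      have r1 : R' r = (combT μ e.2.1 (R r) e.2.2 (R i)).val := by simp [hR', hne]
      have r2 : R' i = (combT μ (x / e.1) (R i) (-(y / e.1)) (R r)).val := by simp [hR']
      obtain ⟨α, hα⟩ := g2
      obtain ⟨γ, hγ⟩ := g3
      have q1 : x / e.1 = α := by rw [hα]; exact Int.mul_ediv_cancel_left _ hg
      have q2 : y / e.1 = γ := by rw [hγ]; exact Int.mul_ediv_cancel_left _ hg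
      -- The Bézout identity divided by the greatest common divisor; it is the determinant of the
      -- transformation of the rows `r` and `i`.
      have bez : e.2.1 * α + e.2.2 * γ = 1 := by
        have : e.1 * (e.2.1 * α + e.2.2 * γ) = e.1 * 1 := by
          linear_combination -g1 - e.2.1 * hα - e.2.2 * hγ
        exact mul_left_cancel₀ hg this
      rw [q1, q2] at r2
      by_cases hl : l = r
      · have : rowOps R l = α • rowOps R' r - e.2.2 • rowOps R' i := by
          subst hl
          funext k
          simp only [rowOps, r1, r2, combT_val, Pi.sub_apply, Pi.smul_apply, smul_eq_mul]
          linear_combination (-R l (Sum.inr k)) * bez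
        rw [this]
        exact sub_mem (Submodule.smul_mem _ _ (mem_span_rowOps _ _))
          (Submodule.smul_mem _ _ (mem_span_rowOps _ _))
      · by_cases hl' : l = i
        · have : rowOps R l = γ • rowOps R' r + e.2.1 • rowOps R' i := by
            subst hl'
            funext k
            simp only [rowOps, r1, r2, combT_val, Pi.add_apply, Pi.smul_apply, smul_eq_mul]
            linear_combination (-R l (Sum.inr k)) * bez
          rw [this]
          exact add_mem (Submodule.smul_mem _ _ (mem_span_rowOps _ _))
            (Submodule.smul_mem _ _ (mem_span_rowOps _ _))
        · have : rowOps R l = rowOps R' l := by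
            funext k
            simp [rowOps, hR', hl, hl']
          rw [this]
          exact mem_span_rowOps _ _
    · calc _ ≤ s * μ s + (C * (s * μ s) + ((C' * μ s + ((a + A) * s + s) * (C' * μ s)) +
            ((C' * μ s + ((a + A) * s + s) * (C' * μ s)) +
            ((2 * d) * (μ s + 4 * (C' * μ s)) + ((2 * d) * (μ s + 4 * (C' * μ s)) + 0))))) := by
            gcongr ?_ + (?_ + (?_ + (?_ + (?_ + (?_ + 0)))))
            · omega
            · exact c1.trans (by gcongr)
            · exact c2.trans (by gcongr)
            · exact u2.trans (by gcongr)
            · exact v2.trans (by gcongr)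
        _ ≤ s * μ s + (C * (s * μ s) + ((C' * (s * μ s) + ((a + A) * s + s) * (C' * μ s)) +
            ((C' * (s * μ s) + ((a + A) * s + s) * (C' * μ s)) +
            ((2 * d) * (s * μ s + 4 * (C' * (s * μ s))) +
              ((2 * d) * (s * μ s + 4 * (C' * (s * μ s))) + 0))))) := by gcongr
        _ = _ := by ring

theorem exists_reduceEntry_bound (hμ : IsMulCost μ) (d a : ℕ) : ∃ A C, ∀ s, 1 ≤ s →
    ∀ (j r : Fin d) (R : AugMat d) (i : Fin d), i < r → GoodMat a s R →
    GoodMat A s (reduceEntry μ j r R i).val ∧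
    (reduceEntry μ j r R i).cost ≤ C * (s * μ s) := by
  obtain ⟨C', h'⟩ := hμ.exists_op ((a + 1) + (a + 1))
  refine ⟨(a + 1) + (a + 1) + 1, (C' + (a + 1 + 1) * C') + (2 * d) * (1 + 4 * C'),
    fun s hs j r R i hri hR => ?_⟩
  have hw := hμ.one_le hs
  have e1 : ((a + 1) + (a + 1)) * s = (a + 1) * s + (a + 1) * s := by ring
  have e2 : ((a + 1) + (a + 1) + 1) * s = (a + 1) * s + (a + 1) * s + s := by ring
  have e3 : (a + 1) * s = a * s + s := by ring
  have hsw : μ s ≤ s * μ s := Nat.le_mul_of_pos_left _ hs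
  obtain ⟨h1, -⟩ := h' s hs _ e1.ge
  have h2 := (h' s hs ((a + 1) * s) (by omega)).2
  simp only [reduceEntry, bind_val, bind_cost, pure_val, pure_cost, divI_val]
  have bx := hR.1 i (Sum.inl j)
  have bY := hR.1 r (Sum.inl j)
  set x := R i (Sum.inl j)
  set y := R r (Sum.inl j)
  have bq := (bits_ediv_le x y).trans bx
  obtain ⟨v1, v2⟩ := combT_bound hμ (β := (a + 1) * s) (w := C' * μ s) (D := 2 * d)
      (a := 1) (b := -(x / y)) (u := R i) (v := R r) (by simp; omega) (by rw [bits_one]; omega)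
      (fun k => by have := hR.1 i k; omega) (by rw [bits_neg]; omega)
      (fun k => by have := hR.1 r k; omega) h1 h2
  have c1 := divI_cost_le (b := (a + 1) * s) (w := C' * μ s) (x := x) (y := y) (by omega)
      (by omega) (by omega)
  refine ⟨⟨?_, span_rowOps_eq_top hR.2 fun l => ?_⟩, ?_⟩
  · exact bits_update (fun l k => (hR.1 l k).trans (by omega)) fun k => (v1 k).trans (by omega)
  · set R' := Function.update R i (combT μ 1 (R i) (-(x / y)) (R r)).val with hR'
    have hne : r ≠ i := hri.ne'
    have r2 : R' i = (combT μ 1 (R i) (-(x / y)) (R r)).val := by simp [hR']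
    have r1 : R' r = R r := by simp [hR', hne]
    by_cases hl : l = i
    · have : rowOps R l = rowOps R' i + (x / y) • rowOps R' r := by
        subst hl
        funext k
        simp only [rowOps, r1, r2, combT_val, Pi.add_apply, Pi.smul_apply, smul_eq_mul]
        ring
      rw [this]
      exact add_mem (mem_span_rowOps _ _) (Submodule.smul_mem _ _ (mem_span_rowOps _ _))
    · have : rowOps R l = rowOps R' l := by
        funext k
        simp [rowOps, hR', hl]
      rw [this]
      exact mem_span_rowOps _ _
  · calc _ ≤ (C' * μ s + ((a + 1) * s + s) * (C' * μ s)) +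
          ((2 * d) * (μ s + 4 * (C' * μ s)) + 0) := by
          gcongr ?_ + (?_ + 0)
          · exact c1.trans (by gcongr)
          · exact v2.trans (by gcongr)
      _ ≤ (C' * (s * μ s) + ((a + 1) * s + s) * (C' * μ s)) +
          ((2 * d) * (s * μ s + 4 * (C' * (s * μ s))) + 0) := by gcongr
      _ = _ := by ring

theorem exists_hermiteColumn_bound (hμ : IsMulCost μ) (d a : ℕ) : ∃ A C, ∀ s, 1 ≤ s →
    ∀ (st : AugMat d × ℕ) (j : Fin d), GoodMat a s st.1 →
    GoodMat A s (hermiteColumn μ st j).val.1 ∧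
    (hermiteColumn μ st j).cost ≤ C * (s * μ s) := by
  have hU : ∀ s, 1 ≤ s → 1 ≤ s * μ s := fun s hs => Nat.mul_pos hs (hμ.one_le hs)
  obtain ⟨A₁, C₁, h₁⟩ := foldT_growth (κ := Fin d × Fin d)
    (fun k => clearEntry μ (d := d) k.1 k.2) (fun k i => k.2 < i) GoodMat (fun s => s * μ s) hU
    (fun a => by
      obtain ⟨A, C, h⟩ := exists_clearEntry_bound hμ d a
      exact ⟨A, C, fun s hs k R i hi hR => h s hs k.1 k.2 R i hi hR⟩)
    (fun a A s R hA h => h.mono hA) d a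
  obtain ⟨A₂, C₂, h₂⟩ := foldT_growth (κ := Fin d × Fin d)
    (fun k => reduceEntry μ (d := d) k.1 k.2) (fun k i => i < k.2) GoodMat (fun s => s * μ s) hU
    (fun a => by
      obtain ⟨A, C, h⟩ := exists_reduceEntry_bound hμ d a
      exact ⟨A, C, fun s hs k R i hi hR => h s hs k.1 k.2 R i hi hR⟩)
    (fun a A s R hA h => h.mono hA) d A₁
  obtain ⟨C₃, h₃⟩ := hμ.exists_op A₁
  refine ⟨a + A₁ + A₂, (1 + 2 * d) + C₁ + (2 * d) * (1 + 2 * C₃) + C₂, fun s hs st j hst => ?_⟩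
  have hw := hU s hs
  have hsw : μ s ≤ s * μ s := Nat.le_mul_of_pos_left _ hs
  have e : ((1 + 2 * d) + C₁ + (2 * d) * (1 + 2 * C₃) + C₂) * (s * μ s) =
    (1 + 2 * d) * (s * μ s) + C₁ * (s * μ s) + (2 * d) * (s * μ s + 2 * (C₃ * (s * μ s))) +
      C₂ * (s * μ s) := by ring
  have e1 : 1 + 2 * d ≤ (1 + 2 * d) * (s * μ s) := Nat.le_mul_of_pos_right _ hw
  rw [e]
  simp only [hermiteColumn, bind_val, bind_cost, tick_cost]
  split
  · rename_i hlt
    set r : Fin d := ⟨st.2, hlt⟩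
    obtain ⟨g1, g2⟩ := h₁ s hs (j, r) st.1 ((List.finRange d).filter fun i => decide (r < i))
      ((List.length_filter_le _ _).trans (by simp)) (fun i hi => by simpa using hi) hst
    simp only [bind_val, bind_cost]
    dsimp only at g1 g2
    set R := (foldT (clearEntry μ j r) st.1 ((List.finRange d).filter fun i => decide (r < i))).val
    split
    · simp only [pure_val, pure_cost]
      exact ⟨g1.mono (by omega), by omega⟩
    · have key : ∀ W : Timed (Fin d ⊕ Fin d → ℤ), (W.val = R r ∨ W.val = -R r) →
          W.cost ≤ (2 * d) * (s * μ s + 2 * (C₃ * (s * μ s))) →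
          GoodMat (a + A₁ + A₂) s (foldT (reduceEntry μ j r) (Function.update R r W.val)
            ((List.finRange d).filter fun i => decide (i < r))).val ∧
          1 + 2 * d + ((foldT (clearEntry μ j r) st.1
            ((List.finRange d).filter fun i => decide (r < i))).cost + (W.cost +
            ((foldT (reduceEntry μ j r) (Function.update R r W.val)
            ((List.finRange d).filter fun i => decide (i < r))).cost + 0))) ≤
            (1 + 2 * d) * (s * μ s) + C₁ * (s * μ s) +
            (2 * d) * (s * μ s + 2 * (C₃ * (s * μ s))) + C₂ * (s * μ s) := by
        intro W hW hc
        have hup : GoodMat A₁ s (Function.update R r W.val) := by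
          refine ⟨bits_update g1.1 fun k => ?_, span_rowOps_eq_top g1.2 fun l => ?_⟩
          · rcases hW with h | h <;> rw [h]
            · exact g1.1 r k
            · simpa [bits_neg] using g1.1 r k
          · by_cases hl : l = r
            · have h1 := mem_span_rowOps (Function.update R r W.val) r
              subst hl
              rcases hW with h | h
              · rw [h, Function.update_eq_self]
                exact mem_span_rowOps _ _
              · have : rowOps R r = -rowOps (Function.update R r W.val) r := by
                  funext k
                  simp [rowOps, h]
                rw [this]
                exact neg_mem h1
            · have : rowOps R l = rowOps (Function.update R r W.val) l := by
                funext k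
                simp [rowOps, hl]
              rw [this]
              exact mem_span_rowOps _ _
        obtain ⟨g3, g4⟩ := h₂ s hs (j, r) (Function.update R r W.val)
          ((List.finRange d).filter fun i => decide (i < r))
          ((List.length_filter_le _ _).trans (by simp)) (fun i hi => by simpa using hi) hup
        dsimp only at g3 g4
        exact ⟨g3.mono (by omega), by omega⟩
      have k1 := key (vecT fun k => subI 0 (R r k)) (Or.inr (by funext k; simp)) (by
        refine (vecT_cost_le (D := 2 * d) (c := 2 * (C₃ * μ s)) (by simp; omega) fun k =>
          subI_cost_le (b := A₁ * s) (by simp [bits_zero]) (g1.1 r k) (h₃ s hs _ le_rfl).1).trans ?_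
        gcongr)
      have k2 := key (pure (R r)) (Or.inl rfl) (by simp)
      split
      · exact k1
      · exact k2
  · simp only [pure_val, pure_cost]
    exact ⟨hst.mono (by omega), by omega⟩

/-- The matrix of row operations is invertible; bounds for its entries and for the cost. -/
theorem exists_hermiteT_bound (hμ : IsMulCost μ) (d a : ℕ) : ∃ A C, ∀ s, 1 ≤ s →
    ∀ M : Fin d → Fin d → ℤ, (∀ i j, bits (M i j) ≤ a * s) →
    (∀ i j, bits ((hermiteT μ M).val i j) ≤ A * s) ∧
    IsUnit (Matrix.of (hermiteT μ M).val) ∧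
    (hermiteT μ M).cost ≤ C * (s * μ s) := by
  have hU : ∀ s, 1 ≤ s → 1 ≤ s * μ s := fun s hs => Nat.mul_pos hs (hμ.one_le hs)
  -- The loop starts from `a + 1` rather than `a` to leave room for the entries 1 of the identity
  -- block.
  obtain ⟨A, C, h⟩ := foldT_growth (κ := Unit)
    (fun _ => hermiteColumn μ (d := d)) (fun _ _ => True) (fun a s st => GoodMat a s st.1)
    (fun s => s * μ s) hU (fun a => by
      obtain ⟨A, C, h⟩ := exists_hermiteColumn_bound hμ d a
      exact ⟨A, C, fun s hs _ st j _ hst => h s hs st j hst⟩)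
    (fun a A s R hA h => h.mono hA) d (a + 1)
  refine ⟨A, (1 + 2 * d * d) + C, fun s hs M hM => ?_⟩
  have hw := hU s hs
  obtain ⟨⟨h1, h2⟩, h3⟩ := h s hs ()
    ((fun i => Sum.elim (M i) (fun j => if i = j then 1 else 0) : AugMat d), 0)
    (List.finRange d) (by simp) (by simp) (by
      refine ⟨fun i k => ?_, ?_⟩
      · rcases k with k | k
        · exact (hM i k).trans (by gcongr; omega)
        · have : bits (if i = k then 1 else 0) ≤ 1 := by split <;> simp [bits_one, bits_zero]
          refine this.trans ?_
          nlinarith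
      · rw [eq_top_iff]
        intro x _
        have : x = ∑ i, x i • rowOps ((fun i => Sum.elim (M i)
            (fun j => if i = j then 1 else 0) : AugMat d)) i := by
          funext k
          simp [rowOps, Finset.sum_apply]
        rw [this]
        exact sum_mem fun i _ => Submodule.smul_mem _ _ (mem_span_rowOps _ _))
  have hv : (hermiteT μ M).val = rowOps (foldT (hermiteColumn μ)
    ((fun i => Sum.elim (M i) (fun j => if i = j then 1 else 0) : AugMat d), 0)
    (List.finRange d)).val.1 := rfl
  refine ⟨fun i j => h1 i (Sum.inr j), ?_, ?_⟩
  · rw [hv]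
    set F := rowOps (foldT (hermiteColumn μ)
      ((fun i => Sum.elim (M i) (fun j => if i = j then 1 else 0) : AugMat d), 0)
      (List.finRange d)).val.1
    -- Writing the unit vectors as combinations of the rows yields a left inverse of the matrix, and
    -- a one-sided inverse of a square matrix is two-sided.
    have hex : ∀ i : Fin d, ∃ c : Fin d → ℤ, ∑ j, c j • F j = Pi.single i 1 := fun i =>
      (Submodule.mem_span_range_iff_exists_fun ℤ).1 (by rw [h2]; trivial)
    choose c hc using hex
    have : Matrix.of c * Matrix.of F = 1 := by
      ext i k
      have := congrFun (hc i) k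
      rw [Finset.sum_apply] at this
      rw [Matrix.mul_apply, Matrix.one_apply]
      simpa [Pi.single_apply, eq_comm] using this
    exact IsUnit.of_mul_eq_one _ (mul_eq_one_comm.1 this)
  · simp only [hermiteT, bind_cost, tick_cost, pure_cost]
    have : 1 + 2 * d * d ≤ (1 + 2 * d * d) * (s * μ s) := Nat.le_mul_of_pos_right _ hw
    rw [add_mul]
    omega

/-! ### Symmetries that are trivial modulo `3` -/

section Minkowski

open Matrix

/-- Iterating the hypothesis shows that every coordinate `w i` is divisible by all powers of 3, in
particular by one that exceeds `|w i|`. -/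
theorem eq_zero_of_three_descent {P : (Fin d → ℤ) → Prop}
    (h : ∀ w, P w → ∃ w' : Fin d → ℤ, w = (3 : ℤ) • w' ∧ P w') {w : Fin d → ℤ} (hw : P w) :
    w = 0 := by
  have key : ∀ k, ∀ w, P w → ∀ i, (3 : ℤ) ^ k ∣ w i := by
    intro k
    induction k with
    | zero => simp
    | succ k ih =>
      intro w hw i
      obtain ⟨w', rfl, hw'⟩ := h w hw
      rw [pow_succ', Pi.smul_apply, smul_eq_mul]
      exact mul_dvd_mul_left _ (ih w' hw' i)
  funext i
  refine Int.eq_zero_of_abs_lt_dvd (key (w i).natAbs w hw i) ?_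
  rw [Int.abs_eq_natAbs]
  exact_mod_cast Nat.lt_pow_self (by norm_num)

/-- A matrix that is congruent to `1` modulo `3` and has finite order on a vector fixes it. -/
theorem eq_zero_of_geom_sum_mulVec (m : ℕ) (hm : 1 ≤ m) (C N : Matrix (Fin d) (Fin d) ℤ)
    (hC : C = 1 + (3 : ℤ) • N) (w : Fin d → ℤ) (hw : (∑ j ∈ Finset.range m, C ^ j) *ᵥ w = 0) :
    w = 0 := by
  induction m using Nat.strong_induction_on generalizing C N w with
  | _ m ih =>
  have hpow : ∀ j, ∃ K : Matrix (Fin d) (Fin d) ℤ, C ^ j = 1 + (3 : ℤ) • K := fun j => by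
    refine ⟨N * ∑ i ∈ Finset.range j, C ^ i, ?_⟩
    have := mul_geom_sum C j
    rw [hC, add_sub_cancel_left, ← hC, smul_mul_assoc] at this
    rw [this]
    abel
  by_cases h3 : 3 ∣ m
  · obtain ⟨k, rfl⟩ := h3
    -- Grouping by threes turns the sum for `C` into a sum of `k` powers of `C ^ 3`, which is again
    -- congruent to 1 modulo 3, so the induction hypothesis leaves only the factor `1 + C + C ^ 2`.
    have e : ∑ j ∈ Finset.range (3 * k), C ^ j =
        (∑ j ∈ Finset.range k, (C ^ 3) ^ j) * (1 + C + C ^ 2) := by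
      clear ih hw hm
      induction k with
      | zero => simp
      | succ k ih =>
        rw [show 3 * (k + 1) = 3 * k + 1 + 1 + 1 by ring, Finset.sum_range_succ,
          Finset.sum_range_succ, Finset.sum_range_succ, ih, Finset.sum_range_succ, ← pow_mul,
          pow_add C (3 * k + 1) 1, pow_add]
        noncomm_ring
    rw [e, ← mulVec_mulVec] at hw
    obtain ⟨K, hK⟩ := hpow 3
    have h1 := ih k (by omega) (by omega) (C ^ 3) K hK _ hw
    refine eq_zero_of_three_descent (P := fun w => (1 + C + C ^ 2) *ᵥ w = 0) (fun w hw => ?_) h1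
    -- With `C = 1 + 3 N` the sum is 3 times a matrix congruent to 1 modulo 3, so a vector in its
    -- kernel is divisible by 3. The analogue fails for 2: the matrix `-1` is congruent to 1 modulo
    -- 2, and `1 + C = 0`.
    have e2 : 1 + C + C ^ 2 = (3 : ℤ) • (1 + (3 : ℤ) • (N + N ^ 2)) := by
      rw [hC]
      noncomm_ring
    have h2 : (1 + (3 : ℤ) • (N + N ^ 2)) *ᵥ w = 0 := by
      rw [e2, smul_mulVec] at hw
      exact (smul_eq_zero.1 hw).resolve_left (by norm_num)
    have h3 : w = (3 : ℤ) • (-((N + N ^ 2) *ᵥ w)) := by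
      rw [add_mulVec, one_mulVec, smul_mulVec] at h2
      rw [smul_neg]
      exact eq_neg_of_add_eq_zero_left h2
    refine ⟨_, h3, ?_⟩
    rw [h3, mulVec_smul] at hw
    exact (smul_eq_zero.1 hw).resolve_left (by norm_num)
  · refine eq_zero_of_three_descent (P := fun w => (∑ j ∈ Finset.range m, C ^ j) *ᵥ w = 0)
      (fun w hw => ?_) hw
    choose K hK using hpow
    -- Modulo 3 the sum is multiplication by `m`, which is invertible in this case, so the kernel
    -- again consists of vectors divisible by 3.
    have e : ∑ j ∈ Finset.range m, C ^ j =
        (m : ℤ) • (1 : Matrix (Fin d) (Fin d) ℤ) + (3 : ℤ) • ∑ j ∈ Finset.range m, K j := by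
      rw [Finset.sum_congr rfl fun j _ => hK j, Finset.sum_add_distrib, Finset.smul_sum]
      simp
    have h1 : ∀ i, (3 : ℤ) ∣ w i := by
      intro i
      have h2 := hw
      rw [e, add_mulVec, smul_mulVec, smul_mulVec, one_mulVec] at h2
      have h6 := congrFun h2 i
      simp only [Pi.add_apply, Pi.smul_apply, smul_eq_mul, Pi.zero_apply] at h6
      have h4 : (3 : ℤ) ∣ m * w i := ⟨-((∑ j ∈ Finset.range m, K j) *ᵥ w) i, by linarith⟩
      rcases Int.prime_three.dvd_or_dvd h4 with h5 | h5
      · exact absurd (by exact_mod_cast h5) h3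
      · exact h5
    choose w' hw' using h1
    have h2 : w = (3 : ℤ) • w' := funext hw'
    refine ⟨w', h2, ?_⟩
    rw [h2, mulVec_smul] at hw
    exact (smul_eq_zero.1 hw).resolve_left (by norm_num)

/-- An affine transformation of a finite set of lattice points whose linear part is congruent to
`1` modulo `3` fixes all the points. -/
theorem affine_fix {C N : Matrix (Fin d) (Fin d) ℤ} (hC : C = 1 + (3 : ℤ) • N) (hu : IsUnit C)
    (t : Fin d → ℤ) {S : Set (Fin d → ℤ)} (hS : S.Finite) (hmap : ∀ x ∈ S, C *ᵥ x + t ∈ S)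
    {x : Fin d → ℤ} (hx : x ∈ S) : C *ᵥ x + t = x := by
  set h : (Fin d → ℤ) → Fin d → ℤ := fun x => C *ᵥ x + t with hh
  have hinj : Function.Injective h := fun x y hxy =>
    mulVec_injective_of_isUnit hu (add_right_cancel hxy)
  have hmem : ∀ j, h^[j] x ∈ S := by
    intro j
    induction j with
    | zero => exact hx
    | succ j ih =>
      rw [Function.iterate_succ_apply']
      exact hmap _ ih
  have hper : ∃ m, 1 ≤ m ∧ h^[m] x = x := by
    have := hS.to_subtype
    obtain ⟨i, j, hij, e⟩ := Finite.exists_ne_map_eq_of_infinite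
      (fun j : ℕ => (⟨h^[j] x, hmem j⟩ : S))
    have e' : h^[i] x = h^[j] x := congrArg Subtype.val e
    rcases lt_or_gt_of_ne hij with hlt | hlt
    · exact ⟨j - i, by omega, Function.iterate_cancel hinj e'.symm⟩
    · exact ⟨i - j, by omega, Function.iterate_cancel hinj e'⟩
  obtain ⟨m, hm, hmx⟩ := hper
  -- Around a cycle of length `m` these differences add up to zero, which is the relation required
  -- by the lemma on geometric sums.
  have step : ∀ j, h^[j + 1] x - h^[j] x = (C ^ j) *ᵥ (h x - x) := by
    intro j
    induction j with
    | zero => simp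
    | succ j ih =>
      rw [pow_succ', ← mulVec_mulVec, ← ih, mulVec_sub, Function.iterate_succ_apply' h (j + 1),
        Function.iterate_succ_apply' h j]
      simp only [hh]
      abel
  have total : (∑ j ∈ Finset.range m, C ^ j) *ᵥ (h x - x) = 0 := by
    have h1 : (∑ j ∈ Finset.range m, C ^ j) *ᵥ (h x - x) =
        ∑ j ∈ Finset.range m, (h^[j + 1] x - h^[j] x) := by
      rw [Finset.sum_congr rfl fun j _ => step j, sum_mulVec]
    rw [h1, Finset.sum_range_sub (fun j => h^[j] x), hmx]
    simp
  have := eq_zero_of_geom_sum_mulVec m hm C N hC _ total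
  exact sub_eq_zero.1 this

/-- Two unimodular coordinate systems that agree modulo `3` and in which a finite set looks the
same coincide on this set. -/
theorem eq_of_mulVec_eq {A A' : Matrix (Fin d) (Fin d) ℤ} (hA : IsUnit A) (hA' : IsUnit A')
    (h3 : ∀ i j, (A i j : ZMod 3) = (A' i j : ZMod 3)) {p p' : Fin d → ℤ} {S : Set (Fin d → ℤ)}
    (hS : S.Finite) (himg : ∀ x' ∈ S, ∃ x ∈ S, A *ᵥ (x - p) = A' *ᵥ (x' - p'))
    {x x' : Fin d → ℤ} (hx' : x' ∈ S) (h : A *ᵥ (x - p) = A' *ᵥ (x' - p')) : x = x' := by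
  have hdvd : ∀ i j, ∃ k : ℤ, A' i j = A i j + 3 * k := fun i j => by
    obtain ⟨k, hk⟩ := (ZMod.intCast_eq_intCast_iff_dvd_sub (A i j) (A' i j) 3).1 (h3 i j)
    exact ⟨k, by push_cast at hk; linarith⟩
  choose K hK using hdvd
  obtain ⟨u, rfl⟩ := hA
  set B : Matrix (Fin d) (Fin d) ℤ := (u⁻¹ : (Matrix (Fin d) (Fin d) ℤ)ˣ).val with hB
  have hBu : B * u.val = 1 := u.inv_mul
  have hAK : A' = u.val + (3 : ℤ) • Matrix.of K := by
    ext i j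
    simp [hK]
  have hC : B * A' = 1 + (3 : ℤ) • (B * Matrix.of K) := by
    rw [hAK, mul_add, hBu, mul_smul_comm]
  -- The passage from `x'` to `x` is an affine map with linear part `A⁻¹ A'`; it maps `S` into
  -- itself by `himg`.
  have key : ∀ x x', u.val *ᵥ (x - p) = A' *ᵥ (x' - p') →
      (B * A') *ᵥ x' + (p - (B * A') *ᵥ p') = x := by
    intro x x' h
    have h1 := congrArg (fun v => B *ᵥ v) h
    simp only [mulVec_mulVec, hBu, one_mulVec] at h1
    rw [mulVec_sub] at h1
    rw [show (B * A') *ᵥ x' + (p - (B * A') *ᵥ p') =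
      (B * A') *ᵥ x' - (B * A') *ᵥ p' + p by abel, ← h1]
    abel
  rw [← key x x' h]
  refine affine_fix hC ((u⁻¹).isUnit.mul hA') _ hS (fun y hy => ?_) hx'
  obtain ⟨z, hz, hzy⟩ := himg y hy
  rw [key z y hzy]
  exact hz

end Minkowski

/-! ### Canonical forms -/

theorem foldT_val {α β : Type} (f : β → α → Timed β) (b : β) (l : List α) :
    (foldT f b l).val = l.foldl (fun b a => (f b a).val) b := by
  induction l generalizing b with
  | nil => rfl
  | cons a l ih => rw [foldT_cons, List.foldl_cons]; exact ih _

theorem mulVecT_val (μ : ℕ → ℕ) (A : Fin d → Fin d → ℤ) (x : Pt d) :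
    (mulVecT μ A x).val = Matrix.mulVec (Matrix.of A) x := by
  have key : ∀ (g : Fin d → ℤ) (l : List (Fin d)) (b : ℤ),
      l.foldl (fun acc j => acc + g j) b = b + (l.map g).sum := by
    intro g l
    induction l with
    | nil => simp
    | cons a l ih => intro b; simp [ih, add_assoc]
  funext i
  show (foldT _ _ _).val = _
  rw [foldT_val]
  simp only [bind_val, mulI_val, addI_val]
  rw [key, zero_add, Matrix.mulVec, dotProduct, Fin.sum_univ_def]
  rfl

theorem exists_mulVecT_bound (hμ : IsMulCost μ) (d a : ℕ) : ∃ A C, ∀ s, 1 ≤ s →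
    ∀ (M : Fin d → Fin d → ℤ) (x : Pt d), (∀ i j, bits (M i j) ≤ a * s) →
    (∀ i, bits (x i) ≤ a * s) →
    (∀ i, bits ((mulVecT μ M x).val i) ≤ A * s) ∧ (mulVecT μ M x).cost ≤ C * μ s := by
  obtain ⟨C, hC⟩ := hμ.exists_op (a + a + d)
  refine ⟨a + a + d, d * (1 + (1 + d * (1 + 3 * C))), fun s hs M x hM hx => ?_⟩
  have hw := hμ.one_le hs
  obtain ⟨h1, h2⟩ := hC s hs _ le_rfl
  have key : ∀ i, bits ((mulVecT μ M x).val i) ≤ (a + a + d) * s ∧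
      (foldT (fun acc j => do
        let m ← mulI μ (M i j) (x j)
        addI acc m) 0 (List.finRange d)).cost ≤ 1 + d * (1 + 3 * (C * μ s)) := by
    intro i
    have := foldT_le (f := fun acc j => do
        let m ← mulI μ (M i j) (x j)
        addI acc m) (fun n acc => bits acc ≤ (a + a + n) * s) (c := 3 * (C * μ s)) (N := d)
        (l := List.finRange d) (b := 0) (i := 0) ?_ (by simp [bits_zero]) (by simp)
    · rw [List.length_finRange, zero_add] at this
      exact this
    · intro n acc j _ hn hacc
      have e1 : (a + a + (n + 1)) * s = (a + a + n) * s + s := by ring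
      have e2 : (a + a + n) * s ≤ (a + a + d) * s := by gcongr
      have e3 : (a + a + n) * s = a * s + a * s + n * s := by ring
      have b1 := bits_mul_le (hM i j) (hx j)
      refine ⟨(bits_add_le (b := (a + a + n) * s) hacc (b1.trans (by omega))).trans (by omega), ?_⟩
      have c1 := mulI_cost_le hμ (b := (a + a + d) * s) (x := M i j) (y := x j)
        ((hM i j).trans (by omega)) ((hx j).trans (by omega)) h2
      have c2 := addI_cost_le (b := (a + a + d) * s) (x := acc) (y := M i j * x j)
        (by omega) (by omega) h1
      simp only [bind_cost, mulI_val]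
      omega
  refine ⟨fun i => (key i).1, ?_⟩
  have h3 : (mulVecT μ M x).cost ≤ d * (1 + (1 + d * (1 + 3 * (C * μ s)))) :=
    vecT_cost_le (by simp) fun i => (key i).2
  refine h3.trans ?_
  calc _ ≤ d * (μ s + (μ s + d * (μ s + 3 * (C * μ s)))) := by gcongr
    _ = _ := by ring

theorem exists_subPt_bound (hμ : IsMulCost μ) (d a : ℕ) : ∃ C, ∀ s, 1 ≤ s →
    ∀ p q : Pt d, (∀ i, bits (p i) ≤ a * s) → (∀ i, bits (q i) ≤ a * s) →
    (∀ i, bits ((subPt p q).val i) ≤ (a + 1) * s) ∧ (subPt p q).cost ≤ C * μ s := by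
  obtain ⟨C, hC⟩ := hμ.exists_op a
  refine ⟨d * (1 + 2 * C), fun s hs p q hp hq => ⟨fun i => ?_, ?_⟩⟩
  · exact (bits_sub_le (hp i) (hq i)).trans (by rw [add_mul, one_mul]; omega)
  · have hw := hμ.one_le hs
    have h3 : (subPt p q).cost ≤ d * (1 + 2 * (C * μ s)) :=
      vecT_cost_le (by simp) fun i => subI_cost_le (hp i) (hq i) (hC s hs _ le_rfl).1
    refine h3.trans ?_
    calc _ ≤ d * (μ s + 2 * (C * μ s)) := by gcongr
      _ = _ := by ring

/-- Translation followed by a linear transformation. -/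
theorem exists_transform_bound (hμ : IsMulCost μ) (d a : ℕ) : ∃ A C, ∀ s, 1 ≤ s →
    ∀ (M : Fin d → Fin d → ℤ) (x p : Pt d), (∀ i j, bits (M i j) ≤ a * s) →
    (∀ i, bits (x i) ≤ a * s) → (∀ i, bits (p i) ≤ a * s) →
    (∀ i, bits ((mulVecT μ M (subPt x p).val).val i) ≤ A * s) ∧
    (subPt x p).cost + (mulVecT μ M (subPt x p).val).cost ≤ C * μ s := by
  obtain ⟨C₁, h₁⟩ := exists_subPt_bound hμ d a
  obtain ⟨A, C₂, h₂⟩ := exists_mulVecT_bound hμ d (a + 1)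
  refine ⟨A, C₁ + C₂, fun s hs M x p hM hx hp => ?_⟩
  obtain ⟨h1, h2⟩ := h₁ s hs x p hx hp
  obtain ⟨h3, h4⟩ := h₂ s hs M _ (fun i j => (hM i j).trans (by gcongr; omega)) h1
  exact ⟨h3, by rw [add_mul]; omega⟩

theorem exists_coordT_bound (hμ : IsMulCost μ) (d a : ℕ) (ha : 1 ≤ a) : ∃ A C, ∀ s, 1 ≤ s →
    ∀ (B : List (Row (Fin (d + 1) ⊕ Fin (d + 1)))) (p : Pt d), B.length ≤ 2 * (d + 1) →
    (∀ r ∈ B, ∀ k, bits (r.2 k) ≤ a * s) → (∀ i, bits (p i) ≤ a * s) →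
    (∀ i, bits ((coordT μ B p).val i) ≤ A * s) ∧ (coordT μ B p).cost ≤ C * μ s := by
  obtain ⟨A, C, h⟩ := exists_reduceT_bound hμ (2 * (d + 1)) (2 * (d + 1)) a
  obtain ⟨C', h'⟩ := hμ.exists_op A
  refine ⟨A, C + d * (1 + 2 * C'), fun s hs B p hB hb hp => ?_⟩
  have hw := hμ.one_le hs
  obtain ⟨h1, h2⟩ := h s hs (by simp; omega) B (Sum.elim (hom p) fun _ => 0) hB hb (by
    rintro (k | k)
    · exact bits_hom_le hs ha hp k
    · simp [bits_zero])
  refine ⟨fun i => ?_, ?_⟩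
  · simp only [coordT, bind_val, vecT_val, subI_val, zero_sub, bits_neg]
    exact h1 _
  · simp only [coordT, bind_cost]
    have h3 := vecT_cost_le (f := fun i : Fin d => subI 0 ((reduceT μ B
      (Sum.elim (hom p) fun _ => 0)).val (Sum.inr i.succ))) (D := d) (c := 2 * (C' * μ s))
      (by simp) fun i => subI_cost_le (by simp [bits_zero]) (h1 _) (h' s hs _ le_rfl).1
    calc _ ≤ C * μ s + d * (μ s + 2 * (C' * μ s)) := by
          gcongr
          exact h3.trans (by gcongr)
      _ = _ := by ring

theorem exists_frameBasis_bound (hμ : IsMulCost μ) (d a N : ℕ) (ha : 1 ≤ a) :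
    ∃ A C, ∀ s, 1 ≤ s → ∀ Q : List (HPt d), Q.length ≤ N →
    (∀ q ∈ Q, ∀ k, bits (q k) ≤ a * s) →
    (frameBasis μ Q).val.length ≤ 2 * (d + 1) ∧
    (∀ r ∈ (frameBasis μ Q).val, ∀ k, bits (r.2 k) ≤ A * s) ∧
    (frameBasis μ Q).cost ≤ C * μ s := by
  obtain ⟨A, C, h⟩ := exists_foldT_extendT_bound hμ (2 * (d + 1)) a
  refine ⟨A, (1 + (2 * d + 2) * N) + (N + 1) * C, fun s hs Q hN hQ => ?_⟩
  have hw := hμ.one_le hs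
  obtain ⟨h1, h2, h3⟩ := h s hs (ι := Fin (d + 1) ⊕ Fin (d + 1)) (by simp; omega)
    ((List.finRange (d + 1)).map Sum.inl)
    (by rw [List.length_map, List.length_finRange]; omega)
    (Q.zipIdx.map fun qi => Sum.elim qi.1 fun j => if j.val = qi.2 then 1 else 0) (by
      intro x hx
      obtain ⟨⟨q, n⟩, hqn, rfl⟩ := List.mem_map.1 hx
      rintro (k | k)
      · exact hQ q (List.fst_mem_of_mem_zipIdx hqn) k
      · have : bits (if k.val = n then 1 else 0) ≤ 1 := by split <;> simp [bits_one, bits_zero]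
        exact this.trans (Nat.mul_pos ha hs))
  refine ⟨h1.length_le.trans (by simp; omega), h2, ?_⟩
  simp only [frameBasis, bind_cost, tick_cost]
  rw [List.length_map, List.length_zipIdx] at h3
  calc _ ≤ (μ s + (2 * d + 2) * (N * μ s)) + (N + 1) * (C * μ s) := by
        gcongr
        · exact hN.trans (Nat.le_mul_of_pos_right _ hw)
        · exact h3.trans (by gcongr)
    _ = _ := by ring

/-- The points that are added to a frame belong to the given set. -/
theorem exists_completeFrame_bound (hμ : IsMulCost μ) (d a N : ℕ) (ha : 1 ≤ a) :
    ∃ C, ∀ s, 1 ≤ s → ∀ (K : List (Pt d × (Fin d → ℤ))),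
    (∀ x ∈ K, ∀ i, bits (x.1 i) ≤ a * s) → (∀ x ∈ K, ∀ i, bits (x.2 i) ≤ a * s) →
    ∀ (m : ℕ) (T : List (Pt d)), T.length + m ≤ N → (∀ p ∈ T, ∀ i, bits (p i) ≤ a * s) →
    (∃ T', (completeFrame μ K m T).val = T ++ T' ∧ T'.length ≤ m ∧ ∀ p ∈ T', ∃ c, (p, c) ∈ K) ∧
    (completeFrame μ K m T).cost ≤ m * ((K.length + 1) * (C * μ s)) := by
  obtain ⟨A, C₁, h₁⟩ := exists_spanBasis_bound hμ d a
  obtain ⟨C₂, h₂⟩ := exists_inSpan_bound hμ d (A + a)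
  obtain ⟨C₃, h₃⟩ := hμ.exists_op a
  let J := 1 + N * (1 + (d + 1)) + (1 + 0)
  refine ⟨J + (N + 1) * C₁ + (1 + C₂ + 1) + (3 + 2 * (d * C₃)) + (1 + N),
    fun s hs K hK1 hK2 m => ?_⟩
  have hw := hμ.one_le hs
  induction m with
  | zero =>
    intro T _ _
    simp [completeFrame]
  | succ m ih =>
    intro T hT hb
    have hTN : T.length ≤ N := by omega
    set c := (J + (N + 1) * C₁ + (1 + C₂ + 1) + (3 + 2 * (d * C₃)) + (1 + N)) with hc
    have hJ : (joinFrame [] T).cost ≤ J := (joinFrame_cost _ _).trans (by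
      simp only [List.length_nil, J]; gcongr)
    obtain ⟨s1, s2, s3⟩ := h₁ s hs (T.map hom) (by
      intro q hq
      obtain ⟨p, hp, rfl⟩ := List.mem_map.1 hq
      exact bits_hom_le hs ha (hb p hp))
    rw [List.length_map] at s3
    have s4 := filterT_cost_le (l := K) (f := fun x : Pt d × (Fin d → ℤ) => do
        let b ← inSpan μ (spanBasis μ (T.map hom)).val x.1
        pure (!b)) le_rfl (c := C₂ * μ s) fun x hx => by
      simpa using h₂ s hs _ x.1 s1 (fun r hr k => (s2 r hr k).trans (by gcongr; omega))
        (fun i => (hK1 x hx i).trans (by gcongr; omega))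
    have hj : (joinFrame [] T).val = T.map hom := rfl
    have hlin : J + ((N + 1) * (C₁ * μ s) + ((1 + K.length * (1 + C₂ * μ s)) +
        ((1 + K.length * (1 + (1 + 2 * (d * (C₃ * μ s))))) + (1 + N)))) ≤ (K.length + 1) * (c * μ s) := by
      calc _ ≤ J * μ s + ((N + 1) * (C₁ * μ s) + ((μ s + K.length * (μ s + C₂ * μ s)) +
            ((μ s + K.length * (μ s + (μ s + 2 * (d * (C₃ * μ s))))) + (1 + N) * μ s))) := by
            gcongr
            · exact Nat.le_mul_of_pos_right _ hw
            · exact Nat.le_mul_of_pos_right _ hw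
        _ ≤ _ := (Nat.le_add_right _ (K.length * (J * μ s + ((N + 1) * (C₁ * μ s) +
            (2 * μ s + (1 + N) * μ s))) + (3 * μ s + C₂ * μ s + 2 * (d * (C₃ * μ s))))).trans_eq
            (by rw [hc]; ring)
    simp only [completeFrame, bind_val, bind_cost, hj]
    set cand := (filterT (fun x : Pt d × (Fin d → ℤ) => do
        let b ← inSpan μ (spanBasis μ (T.map hom)).val x.1
        pure (!b)) K).val with hcand
    have hsub : ∀ x ∈ cand, x ∈ K := fun x hx => (List.mem_filter.1 hx).1
    have hlen : cand.length ≤ K.length := List.length_filter_le _ _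
    clear_value cand
    have s3' : (spanBasis μ (T.map hom)).cost ≤ (N + 1) * (C₁ * μ s) := s3.trans (by gcongr)
    have hsucc : (m + 1) * ((K.length + 1) * (c * μ s)) =
      m * ((K.length + 1) * (c * μ s)) + (K.length + 1) * (c * μ s) := by ring
    match cand with
    | [] =>
      refine ⟨⟨[], by simp⟩, ?_⟩
      simp only [pure_cost]
      omega
    | x :: xs =>
      obtain ⟨f1, f2⟩ := foldT_inv (f := fun x y : Pt d × (Fin d → ℤ) => do
          let b ← ptLe x.2 y.2
          pure (if b then x else y)) (fun y => y ∈ K) (c := 1 + 2 * (d * (C₃ * μ s))) (N := K.length)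
          (l := xs) (b := x) (fun y z hz hy => by
            have hz' : z ∈ K := hsub z (by simp [hz])
            refine ⟨?_, ?_⟩
            · simp only [bind_val, pure_val]
              split
              · exact hy
              · exact hz'
            · simpa using ptLe_cost_le (hK2 y hy) (hK2 z hz') (h₃ s hs _ le_rfl).1)
          (hsub x (by simp)) (by simp at hlen; omega)
      simp only [bind_val, bind_cost, tick_cost]
      generalize hbest : foldT (fun x y : Pt d × (Fin d → ℤ) => do
          let b ← ptLe x.2 y.2
          pure (if b then x else y)) x xs = best at f1 f2 ⊢
      obtain ⟨⟨T', e1, e2, e3⟩, e4⟩ := ih (T ++ [best.val.1]) (by simp; omega) (by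
        intro p hp
        rcases List.mem_append.1 hp with hp | hp
        · exact hb p hp
        · rw [List.mem_singleton] at hp
          subst hp
          exact hK1 _ f1)
      refine ⟨⟨best.val.1 :: T', ?_, by simpa using e2, ?_⟩, ?_⟩
      · rw [e1]; simp
      · intro p hp
        rcases List.mem_cons.1 hp with rfl | hp
        · exact ⟨_, f1⟩
        · exact e3 p hp
      · omega

/-- The points of `Q ∩ Λ`. -/
def frameTrace (μ : ℕ → ℕ) (Λ : List (Pt d)) (Q : List (HPt d)) : List (Pt d) :=
  (Q.map fun q => Λ.filter fun p => (eqHom μ q p).val).flatten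

theorem eqHom_val (μ : ℕ → ℕ) (q : HPt d) (p : Pt d) :
    (eqHom μ q p).val = decide (∀ i : Fin d, q i.succ = q 0 * p i) := by
  simp [eqHom, isZero, sub_eq_zero]

theorem mem_frameTrace {Λ : List (Pt d)} {Q : List (HPt d)} {p : Pt d}
    (h : p ∈ frameTrace μ Λ Q) : p ∈ Λ := by
  obtain ⟨l, hl, hp⟩ := List.mem_flatten.1 h
  obtain ⟨q, _, rfl⟩ := List.mem_map.1 hl
  exact (List.mem_filter.1 hp).1

/-- As `q 0` is positive, a homogeneous vector matches at most one lattice point, and `Λ` has no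
repetitions. -/
theorem length_frameTrace_le (μ : ℕ → ℕ) {Λ : List (Pt d)} (hΛ : Λ.Nodup) {Q : List (HPt d)}
    (hQ : ∀ q ∈ Q, 0 < q 0) : (frameTrace μ Λ Q).length ≤ Q.length := by
  have h : (frameTrace μ Λ Q).length ≤ Q.length * 1 := by
    refine length_flatten_le (by simp) fun l hl => ?_
    obtain ⟨q, hq, rfl⟩ := List.mem_map.1 hl
    have hn := hΛ.filter fun p => (eqHom μ q p).val
    have hall : ∀ p ∈ Λ.filter (fun p => (eqHom μ q p).val), ∀ i, q i.succ = q 0 * p i := by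
      intro p hp
      have := (List.mem_filter.1 hp).2
      rw [eqHom_val] at this
      exact of_decide_eq_true this
    revert hn hall
    generalize Λ.filter (fun p => (eqHom μ q p).val) = L
    intro hn hall
    match L with
    | [] => simp
    | [x] => simp
    | x :: y :: l =>
      exfalso
      have : x = y := funext fun i => mul_left_cancel₀ (hQ q hq).ne'
        ((hall x (by simp) i).symm.trans (hall y (by simp) i))
      subst this
      simp at hn
  simpa using h

/-- Each point of `R` contributes precisely itself. Thus the images of the points of `R` occupy
known positions in the second component of the canonical form, and `R` can be read off from it,
given the chart. -/
theorem frameTrace_append (μ : ℕ → ℕ) {Λ : List (Pt d)} (hΛ : Λ.Nodup) (Q : List (HPt d))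
    {R : List (Pt d)} (hR : ∀ p ∈ R, p ∈ Λ) :
    frameTrace μ Λ (Q ++ R.map hom) = frameTrace μ Λ Q ++ R := by
  have h : ∀ r ∈ R, (Λ.filter fun p => (eqHom μ (hom r) p).val) = [r] := by
    intro r hr
    have e : (fun p => (eqHom μ (hom r) p).val) = fun p => decide (p = r) := by
      funext p
      rw [eqHom_val]
      congr 1
      simp only [hom, Fin.cons_succ, Fin.cons_zero, one_mul, eq_iff_iff]
      exact ⟨fun h => funext fun i => (h i).symm, fun h i => by rw [h]⟩
    rw [e, List.filter_eq, List.count_eq_one_of_mem hΛ (hR r hr), List.replicate_one]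
  rw [frameTrace, List.map_append, List.flatten_append, ← frameTrace, List.map_map]
  congr 1
  clear hR
  induction R with
  | nil => rfl
  | cons r R ih =>
    rw [List.map_cons, List.flatten_cons, ih fun x hx => h x (by simp [hx])]
    simp [h r (by simp)]

/-- Passing to the unit `n * ℓ * (s * w)`. -/
theorem linear_le_unit {n l s w c : ℕ} (hl : 1 ≤ l) (hs : 1 ≤ s) :
    n * (c * w) ≤ c * (n * l * (s * w)) := by
  calc n * (c * w) = c * (n * 1 * (1 * w)) := by ring
    _ ≤ c * (n * l * (s * w)) := by gcongr

theorem linear_le_unit' {n l s w c : ℕ} (hn : 1 ≤ n) (hl : 1 ≤ l) (hs : 1 ≤ s) (hw : 1 ≤ w) :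
    1 + n * (1 + c * w) ≤ (2 + c) * (n * l * (s * w)) := by
  calc 1 + n * (1 + c * w) ≤ n * w + n * (w + c * w) := by
        gcongr
        exact Nat.mul_pos hn hw
    _ = n * ((2 + c) * w) := by ring
    _ ≤ _ := linear_le_unit hl hs

theorem clog_le_log_add_one (n : ℕ) : Nat.clog 2 n ≤ Nat.log 2 n + 1 :=
  Nat.clog_le_of_le_pow (Nat.lt_pow_succ_log_self (by norm_num) n).le

/-- The coordinate changes that occur in a canonical form. -/
def IsChart (Λ T : List (Pt d)) (f : List (Pt d) × List (Pt d)) (A : Matrix (Fin d) (Fin d) ℤ)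
    (p : Pt d) : Prop :=
  IsUnit A ∧ f.1.Perm (Λ.map fun x => A.mulVec (x - p)) ∧ f.2 = T.map fun x => A.mulVec (x - p)

/-- For counting frames only the shape of the result matters: an invertible affine chart applied to
`Λ` and to some extension of the trace of `Q`. Which points complete the trace is irrelevant, hence
the existential `T`. The alternative without a chart is the program's default result for an empty
list of points. In the cost, the logarithm is due to the sorting and the factor `s` to the Hermite
form; all other steps are at most linear in `Λ.length * μ s`. -/
theorem exists_canonicalForm_bound (hμ : IsMulCost μ) (d a N : ℕ) (ha : 1 ≤ a) :
    ∃ A C, ∀ s, 1 ≤ s → ∀ (Λ : List (Pt d)) (Q : List (HPt d)), Λ ≠ [] → Λ.Nodup →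
    Q.length ≤ N → (∀ q ∈ Q, 0 < q 0) → (∀ q ∈ Q, ∀ k, bits (q k) ≤ a * s) →
    (∀ p ∈ Λ, ∀ i, bits (p i) ≤ a * s) →
    (∃ T, ((frameTrace μ Λ Q ++ T = [] ∧ (canonicalFormWithFrame μ Λ Q).val = ([], [])) ∨
      ∃ M p, IsChart Λ (frameTrace μ Λ Q ++ T) (canonicalFormWithFrame μ Λ Q).val M p)) ∧
    (canonicalFormWithFrame μ Λ Q).val.1.length ≤ Λ.length ∧
    (canonicalFormWithFrame μ Λ Q).val.2.length ≤ N + (d + 1) ∧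
    (∀ p ∈ (canonicalFormWithFrame μ Λ Q).val.1 ++ (canonicalFormWithFrame μ Λ Q).val.2,
      ∀ i, bits (p i) ≤ A * s) ∧
    (canonicalFormWithFrame μ Λ Q).cost ≤
      C * (Λ.length * (Nat.log 2 Λ.length + 1) * (s * μ s)) := by
  obtain ⟨C₁, h₁⟩ := exists_eqHom_bound hμ d a
  obtain ⟨A₂, C₂, h₂⟩ := exists_spanBasis_bound hμ d a
  obtain ⟨A₃, C₃, h₃⟩ := exists_frameBasis_bound hμ d a N ha
  obtain ⟨A₄, C₄, h₄⟩ := exists_coordT_bound hμ d (a + A₃) (by omega)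
  obtain ⟨C₅, h₅⟩ := exists_completeFrame_bound hμ d (a + A₄) (N + (d + 1)) (by omega)
  obtain ⟨C₆, h₆⟩ := exists_subPt_bound hμ d a
  obtain ⟨A₇, C₇, h₇⟩ := exists_hermiteT_bound hμ d (a + 1)
  obtain ⟨A₈, C₈, h₈⟩ := exists_transform_bound hμ d (a + A₇)
  obtain ⟨C₉, h₉⟩ := hμ.exists_op A₈
  refine ⟨A₈, (1 + N * (1 + (2 + C₁))) + (1 + N + N) + ((2 + (d + 1)) + 2) + 2 * C₂ + C₃ +
    (2 + C₄) + (1 + (d + 1) + N) + (d + 1) * (2 * C₅) + (1 + (N + (d + 1)) * (1 + C₆)) + C₇ +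
    (2 + C₈) + (1 + (N + (d + 1)) * (1 + C₈)) + (1 + (4 + (1 + 2 * (d * C₉)))),
    fun s hs Λ Q hΛ0 hΛ hN hQ0 hQ hp => ?_⟩
  have hw := hμ.one_le hs
  have hn : 1 ≤ Λ.length := List.length_pos_iff.2 hΛ0
  have hl : 1 ≤ Nat.log 2 Λ.length + 1 := by omega
  set l := Nat.log 2 Λ.length + 1 with hldef
  set U := Λ.length * l * (s * μ s) with hU
  have hU1 : 1 ≤ U := Nat.mul_pos (Nat.mul_pos hn hl) (Nat.mul_pos hs hw)
  have hnU : ∀ c, Λ.length * (c * μ s) ≤ c * U := fun c => linear_le_unit hl hs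
  have hnU' : ∀ c, 1 + Λ.length * (1 + c * μ s) ≤ (2 + c) * U := fun c =>
    linear_le_unit' hn hl hs hw
  have hcU : ∀ c, c ≤ c * U := fun c => Nat.le_mul_of_pos_right _ hU1
  have hswU : ∀ c, c * (s * μ s) ≤ c * U := fun c =>
    Nat.mul_le_mul_left _ (Nat.le_mul_of_pos_left _ (Nat.mul_pos hn hl))
  have hwU : ∀ c, c * μ s ≤ c * U := fun c =>
    (Nat.mul_le_mul_left _ (Nat.le_mul_of_pos_left _ hs)).trans (hswU c)
  have up : ∀ {b x : ℕ}, x ≤ a * s → x ≤ (a + b) * s := fun h => h.trans (by gcongr; omega)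
  have up' : ∀ {b x : ℕ}, x ≤ b * s → x ≤ (a + b) * s := fun h => h.trans (by gcongr; omega)
  have trace_le := length_frameTrace_le μ hΛ hQ0
  -- the steps before the completion of the frame
  have c1 : (mapT (fun q => filterT (eqHom μ q) Λ) Q).cost ≤ (1 + N * (1 + (2 + C₁))) * U := by
    have := mapT_cost_le (f := fun q => filterT (eqHom μ q) Λ) hN (c := (2 + C₁) * U)
      fun q hq => (filterT_cost_le le_rfl fun p hp' => h₁ s hs q p (hQ q hq) (hp p hp')).trans
        (hnU' C₁)
    calc _ ≤ U + N * (U + (2 + C₁) * U) := this.trans (by gcongr)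
      _ = _ := by ring
  have c2 : (flattenT (mapT (fun q => filterT (eqHom μ q) Λ) Q).val).cost ≤ (1 + N + N) * U :=
    (flattenT_cost_le (by simpa using hN) (trace_le.trans hN)).trans (hcU _)
  have c3 : (joinFrame [] Λ).cost ≤ ((2 + (d + 1)) + 2) * U := by
    have h1 := hnU' (d + 1)
    have h2 : Λ.length * (1 + (d + 1)) ≤ Λ.length * (1 + (d + 1) * μ s) := by
      gcongr
      exact Nat.le_mul_of_pos_right _ hw
    refine (joinFrame_cost _ _).trans ?_
    rw [add_mul, List.length_nil]
    omega
  obtain ⟨b1, -, b3⟩ := h₂ s hs (Λ.map hom) fun q hq => by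
    obtain ⟨p, hp', rfl⟩ := List.mem_map.1 hq
    exact bits_hom_le hs ha (hp p hp')
  have c4 : (spanBasis μ (Λ.map hom)).cost ≤ 2 * C₂ * U := by
    rw [List.length_map] at b3
    refine b3.trans ((hnU (2 * C₂)).trans' ?_)
    calc (Λ.length + 1) * (C₂ * μ s) ≤ (Λ.length + Λ.length) * (C₂ * μ s) := by gcongr
      _ = _ := by ring
  obtain ⟨f1, f2, f3⟩ := h₃ s hs Q hN hQ
  have c5 := f3.trans (hwU C₃)
  set B := (spanBasis μ (Λ.map hom)).val with hB
  set E := (frameBasis μ Q).val with hE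
  have k1 : ∀ p ∈ Λ, (∀ i, bits ((coordT μ E p).val i) ≤ A₄ * s) ∧
      (coordT μ E p).cost ≤ C₄ * μ s := fun p hp' =>
    h₄ s hs E p f1 (fun r hr k => up' (f2 r hr k)) fun i => up (hp p hp' i)
  have c6 : (mapT (fun p => do
      let c ← coordT μ E p
      pure (p, c)) Λ).cost ≤ (2 + C₄) * U :=
    (mapT_cost_le le_rfl (c := C₄ * μ s) fun p hp' => by simpa using (k1 p hp').2).trans (hnU' C₄)
  have c7 : 1 + B.length + (frameTrace μ Λ Q).length ≤ (1 + (d + 1) + N) * U :=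
    (hcU _).trans' (by omega)
  set K := (mapT (fun p => do
      let c ← coordT μ E p
      pure (p, c)) Λ).val with hK
  have hKmem : ∀ x ∈ K, x.1 ∈ Λ ∧ x.2 = (coordT μ E x.1).val := by
    intro x hx
    obtain ⟨p, hp', rfl⟩ := List.mem_map.1 hx
    exact ⟨hp', rfl⟩
  have hKlen : K.length = Λ.length := List.length_map _
  obtain ⟨⟨T', t1, t2, t3⟩, t4⟩ := h₅ s hs K (fun x hx i => up (hp _ (hKmem x hx).1 i))
    (fun x hx i => by rw [(hKmem x hx).2]; exact up' ((k1 _ (hKmem x hx).1).1 i))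
    (B.length - (frameTrace μ Λ Q).length) (frameTrace μ Λ Q) (by omega)
    fun p hp' i => up (hp p (mem_frameTrace hp') i)
  have c8 : (completeFrame μ K (B.length - (frameTrace μ Λ Q).length) (frameTrace μ Λ Q)).cost ≤
      (d + 1) * (2 * C₅) * U := by
    refine t4.trans ?_
    rw [hKlen]
    calc _ ≤ (d + 1) * ((Λ.length + Λ.length) * (C₅ * μ s)) := by gcongr; omega
      _ = (d + 1) * (Λ.length * (2 * C₅ * μ s)) := by ring
      _ ≤ (d + 1) * (2 * C₅ * U) := Nat.mul_le_mul_left _ (hnU _)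
      _ = _ := by ring
  have hTmem : ∀ p ∈ frameTrace μ Λ Q ++ T', p ∈ Λ := fun p hp' => by
    rcases List.mem_append.1 hp' with h | h
    · exact mem_frameTrace h
    · obtain ⟨c, hc⟩ := t3 p h
      exact (hKmem _ hc).1
  have hTlen : (frameTrace μ Λ Q ++ T').length ≤ N + (d + 1) := by
    rw [List.length_append]; omega
  have hj : (joinFrame [] Λ).val = Λ.map hom := rfl
  have ht : (flattenT (mapT (fun q => filterT (eqHom μ q) Λ) Q).val).val = frameTrace μ Λ Q := rfl
  simp only [canonicalFormWithFrame, bind_val, bind_cost, tick_cost, hj, ht, ← hB, ← hE, ← hK]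
  -- The last five costs are left as variables, so that the estimate also covers the branch that
  -- stops early, where they are zero.
  have hcost : ∀ x9 x10 x11 x12 x13 : ℕ, x9 ≤ (1 + (N + (d + 1)) * (1 + C₆)) * U → x10 ≤ C₇ * U →
      x11 ≤ (2 + C₈) * U → x12 ≤ (1 + (N + (d + 1)) * (1 + C₈)) * U →
      x13 ≤ (1 + (4 + (1 + 2 * (d * C₉)))) * U →
      (mapT (fun q => filterT (eqHom μ q) Λ) Q).cost +
        ((flattenT (mapT (fun q => filterT (eqHom μ q) Λ) Q).val).cost +
        ((joinFrame [] Λ).cost + ((spanBasis μ (Λ.map hom)).cost + ((frameBasis μ Q).cost +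
        ((mapT (fun p => do
          let c ← coordT μ E p
          pure (p, c)) Λ).cost + (1 + B.length + (frameTrace μ Λ Q).length +
        ((completeFrame μ K (B.length - (frameTrace μ Λ Q).length) (frameTrace μ Λ Q)).cost +
        (x9 + (x10 + (x11 + (x12 + (x13 + 0))))))))))))  ≤
      ((1 + N * (1 + (2 + C₁))) + (1 + N + N) + ((2 + (d + 1)) + 2) + 2 * C₂ + C₃ +
        (2 + C₄) + (1 + (d + 1) + N) + (d + 1) * (2 * C₅) + (1 + (N + (d + 1)) * (1 + C₆)) + C₇ +
        (2 + C₈) + (1 + (N + (d + 1)) * (1 + C₈)) + (1 + (4 + (1 + 2 * (d * C₉))))) * U := by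
    intro x9 x10 x11 x12 x13 h9 h10 h11 h12 h13
    calc _ ≤ (1 + N * (1 + (2 + C₁))) * U + ((1 + N + N) * U + (((2 + (d + 1)) + 2) * U +
          (2 * C₂ * U + (C₃ * U + ((2 + C₄) * U + ((1 + (d + 1) + N) * U +
          ((d + 1) * (2 * C₅) * U + ((1 + (N + (d + 1)) * (1 + C₆)) * U + (C₇ * U +
          ((2 + C₈) * U + ((1 + (N + (d + 1)) * (1 + C₈)) * U +
          ((1 + (4 + (1 + 2 * (d * C₉)))) * U + 0)))))))))))) := by gcongr
      _ = _ := by ring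
  generalize completeFrame μ K (B.length - (frameTrace μ Λ Q).length) (frameTrace μ Λ Q) = F
    at t1 c8 hcost ⊢
  rw [← t1] at hTmem hTlen
  rcases hF : F.val with _ | ⟨p₀, ps⟩
  · simp only [pure_val, pure_cost]
    refine ⟨⟨T', Or.inl ⟨by rw [← t1, hF], trivial⟩⟩, by simp, by simp, by simp, ?_⟩
    exact (hcost 0 0 0 0 0 (Nat.zero_le _) (Nat.zero_le _) (Nat.zero_le _) (Nat.zero_le _)
      (Nat.zero_le _)).trans' (by simp)
  · rw [hF] at hTmem hTlen t1
    have hp₀ : ∀ i, bits (p₀ i) ≤ a * s := hp p₀ (hTmem p₀ (by simp))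
    have hps : ∀ p ∈ p₀ :: ps, ∀ i, bits (p i) ≤ a * s := fun p hp' => hp p (hTmem p hp')
    have hpl : ps.length ≤ N + (d + 1) := by rw [List.length_cons] at hTlen; omega
    simp only [bind_val, bind_cost, pure_val, pure_cost]
    set cols := (mapT (fun p => subPt p p₀) ps).val with hcols
    have hcolb : ∀ i j : Fin d, bits (cols.getD j (fun _ => 0) i) ≤ (a + 1) * s := by
      intro i j
      by_cases hj : j.val < cols.length
      · rw [List.getD_eq_getElem _ _ hj]
        obtain ⟨p, hp', e⟩ := List.mem_map.1 (List.getElem_mem hj)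
        rw [← e]
        exact (h₆ s hs p p₀ (hps p (by simp [hp'])) hp₀).1 i
      · rw [List.getD_eq_default _ _ (by omega), bits_zero]
        exact Nat.zero_le _
    obtain ⟨m1, m2, m3⟩ := h₇ s hs (fun i j => cols.getD j (fun _ => 0) i) hcolb
    set M := (hermiteT μ (fun i j : Fin d => cols.getD j (fun _ => 0) i)).val with hM
    have tr : ∀ x : Pt d, (∀ i, bits (x i) ≤ a * s) →
        (∀ i, bits ((mulVecT μ M (subPt x p₀).val).val i) ≤ A₈ * s) ∧
        (subPt x p₀).cost + (mulVecT μ M (subPt x p₀).val).cost ≤ C₈ * μ s := fun x hx =>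
      h₈ s hs M x p₀ (fun i j => up' (m1 i j)) (fun i => up (hx i)) fun i => up (hp₀ i)
    have ev : ∀ x : Pt d, (mulVecT μ M (subPt x p₀).val).val =
        (Matrix.of M).mulVec (x - p₀) := fun x => mulVecT_val μ M _
    have hmv : ∀ L : List (Pt d), (mapT (fun x => do
        let y ← subPt x p₀
        mulVecT μ M y) L).val = L.map fun x => (Matrix.of M).mulVec (x - p₀) := fun L =>
      List.map_congr_left fun x _ => ev x
    have hbits : ∀ L : List (Pt d), (∀ x ∈ L, ∀ i, bits (x i) ≤ a * s) →
        ∀ y ∈ L.map (fun x => (Matrix.of M).mulVec (x - p₀)), ∀ i, bits (y i) ≤ A₈ * s := by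
      intro L hL y hy i
      obtain ⟨x, hx, rfl⟩ := List.mem_map.1 hy
      rw [← ev]
      exact (tr x (hL x hx)).1 i
    rw [hmv, hmv]
    obtain ⟨s1, s2⟩ := sortT_spec (le := ptLe) (c := 1 + 2 * (d * (C₉ * μ s)))
      (Λ.map fun x => (Matrix.of M).mulVec (x - p₀)) fun x hx y hy =>
        ptLe_cost_le (hbits Λ hp x hx) (hbits Λ hp y hy) (h₉ s hs _ le_rfl).1
    rw [List.length_map] at s2
    refine ⟨⟨T', Or.inr ⟨Matrix.of M, p₀, m2, s1, by rw [← t1]⟩⟩, ?_, ?_, ?_, ?_⟩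
    · rw [s1.length_eq, List.length_map]
    · rw [List.length_map]
      exact hTlen
    · intro p hp'
      rcases List.mem_append.1 hp' with h | h
      · exact hbits Λ hp p (s1.subset h)
      · exact hbits _ hps p h
    · refine hcost _ _ _ _ _ ?_ ((m3).trans (hswU _)) ?_ ?_ ?_
      · have := mapT_cost_le (f := fun p => subPt p p₀) hpl (c := C₆ * μ s) fun p hp' =>
          (h₆ s hs p p₀ (hps p (by simp [hp'])) hp₀).2
        refine this.trans ((hwU _).trans' ?_)
        calc _ ≤ μ s + (N + (d + 1)) * (μ s + C₆ * μ s) := by gcongr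
          _ = _ := by ring
      · exact (mapT_cost_le le_rfl fun x hx => (tr x (hp x hx)).2).trans (hnU' _)
      · have := mapT_cost_le (f := fun x => do
          let y ← subPt x p₀
          mulVecT μ M y) hTlen (c := C₈ * μ s) fun x hx => (tr x (hps x hx)).2
        refine this.trans ((hwU _).trans' ?_)
        calc _ ≤ μ s + (N + (d + 1)) * (μ s + C₈ * μ s) := by gcongr
          _ = _ := by ring
      · refine s2.trans ?_
        have hc := clog_le_log_add_one Λ.length
        have hs1 : μ s ≤ s * μ s := Nat.le_mul_of_pos_left _ hs
        calc _ ≤ U + Λ.length * l * (4 * (s * μ s) + (s * μ s + 2 * (d * (C₉ * (s * μ s))))) := by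
              gcongr
              · exact Nat.le_mul_of_pos_right _ (Nat.mul_pos hs hw)
              · exact Nat.mul_pos hs hw
          _ = _ := by rw [hU]; ring

/-! ### Selection of the frames with minimal canonical form -/

/-- All blocks have the same positive length `d`. In dimension zero the number of points would be
lost, which is why that case is treated separately below. -/
theorem flatten_ofFn_injective (hd : 0 < d) {L L' : List (Pt d)}
    (h : (L.map List.ofFn).flatten = (L'.map List.ofFn).flatten) : L = L' := by
  induction L generalizing L' with
  | nil =>
    cases L' with
    | nil => rfl
    | cons x L' =>
      have := congrArg List.length h
      simp at this
      omega
  | cons x L ih =>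
    cases L' with
    | nil =>
      have := congrArg List.length h
      simp at this
      omega
    | cons y L' =>
      rw [List.map_cons, List.map_cons, List.flatten_cons, List.flatten_cons] at h
      obtain ⟨h1, h2⟩ := List.append_inj h (by simp)
      rw [List.ofFn_injective h1, ih h2]

/-- The canonical form as a list of integers. -/
def canonicalKey (μ : ℕ → ℕ) (Λ : List (Pt d)) (Q : List (HPt d)) : List ℤ :=
  (((canonicalFormWithFrame μ Λ Q).val.1 ++ (canonicalFormWithFrame μ Λ Q).val.2).map
    List.ofFn).flatten

/-- It suffices for the count that all survivors share one key; that this key is the least one plays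
no role, so `least` is left unspecified. -/
theorem selectMinimal_val (μ : ℕ → ℕ) (Λ : List (Pt d)) (Q : List (HPt d))
    (L : List (List (Pt d))) : ∃ least, (selectMinimal μ Λ Q L).val =
      L.filter fun R => decide (canonicalKey μ Λ (Q ++ R.map hom) = least) := by
  have hK : (mapT (fun R => do
    let QR ← joinFrame Q R
    let f ← canonicalFormWithFrame μ Λ QR
    let key ← flattenT ((f.1 ++ f.2).map List.ofFn)
    pure (R, key)) L).val = L.map fun R => (R, canonicalKey μ Λ (Q ++ R.map hom)) := rfl
  simp only [selectMinimal, bind_val, hK]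
  rcases L with _ | ⟨R, L⟩
  · exact ⟨[], rfl⟩
  · rw [List.map_cons]
    refine ⟨(foldT (fun (m : List ℤ) (x : List (Pt d) × List ℤ) => do
        let b ← lexLe m x.2
        pure (if b then m else x.2)) (canonicalKey μ Λ (Q ++ R.map hom))
        (L.map fun R => (R, canonicalKey μ Λ (Q ++ R.map hom)))).val, ?_⟩
    simp only [bind_val, mapT_val, filterT_val, pure_val]
    have e : (R, canonicalKey μ Λ (Q ++ R.map hom)) ::
        L.map (fun R : List (Pt d) => (R, canonicalKey μ Λ (Q ++ R.map hom))) =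
        (R :: L).map fun R : List (Pt d) => (R, canonicalKey μ Λ (Q ++ R.map hom)) := rfl
    rw [e, List.filter_map, List.map_map]
    exact List.map_id _

/-- There are at most `H` candidates, and their keys have length linear in `Λ.length`. Comparing
keys is therefore dominated by the computation of the canonical forms. -/
theorem exists_selectMinimal_bound (hμ : IsMulCost μ) (d a N H : ℕ) (ha : 1 ≤ a) : ∃ C, ∀ s,
    1 ≤ s → ∀ (Λ : List (Pt d)) (Q : List (HPt d)) (L : List (List (Pt d))), Λ ≠ [] → Λ.Nodup →
    L.length ≤ H → (∀ R ∈ L, Q.length + R.length ≤ N) → (∀ R ∈ L, ∀ p ∈ R, p ∈ Λ) →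
    (∀ q ∈ Q, 0 < q 0) → (∀ q ∈ Q, ∀ k, bits (q k) ≤ a * s) →
    (∀ p ∈ Λ, ∀ i, bits (p i) ≤ a * s) →
    (selectMinimal μ Λ Q L).cost ≤ C * (Λ.length * (Nat.log 2 Λ.length + 1) * (s * μ s)) := by
  obtain ⟨A, C, h⟩ := exists_canonicalForm_bound hμ d a N ha
  obtain ⟨C', h'⟩ := hμ.exists_op A
  let J := 1 + N * (1 + (d + 1)) + (1 + N)
  let N' := N + (d + 1)
  let F := 1 + 2 * ((1 + N') * (d * C'))
  refine ⟨(1 + H * (1 + (J + (C + (1 + (1 + N') + (1 + N') * d))))) + ((1 + H * (1 + F)) +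
    ((1 + H * (1 + F)) + (1 + H * (1 + 0)))), fun s hs Λ Q L hΛ0 hΛ hL hN hmem hQ0 hQ hp => ?_⟩
  have hw := hμ.one_le hs
  have hn : 1 ≤ Λ.length := List.length_pos_iff.2 hΛ0
  have hl : 1 ≤ Nat.log 2 Λ.length + 1 := by omega
  set l := Nat.log 2 Λ.length + 1 with hldef
  set U := Λ.length * l * (s * μ s) with hU
  have hU1 : 1 ≤ U := Nat.mul_pos (Nat.mul_pos hn hl) (Nat.mul_pos hs hw)
  have hnU : ∀ c, Λ.length * (c * μ s) ≤ c * U := fun c => linear_le_unit hl hs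
  have hnU1 : Λ.length ≤ U := by
    have := hnU 1
    rw [one_mul, one_mul] at this
    exact (Nat.le_mul_of_pos_right _ hw).trans this
  have hcU : ∀ c, c ≤ c * U := fun c => Nat.le_mul_of_pos_right _ hU1
  have hfr : ∀ R ∈ L, (∀ q ∈ Q ++ R.map hom, 0 < q 0) ∧
      ∀ q ∈ Q ++ R.map hom, ∀ k, bits (q k) ≤ a * s := by
    intro R hR
    refine ⟨fun q hq => ?_, fun q hq => ?_⟩
    · rcases List.mem_append.1 hq with hq | hq
      · exact hQ0 q hq
      · obtain ⟨p, hp', rfl⟩ := List.mem_map.1 hq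
        simp [hom]
    · rcases List.mem_append.1 hq with hq | hq
      · exact hQ q hq
      · obtain ⟨p, hp', rfl⟩ := List.mem_map.1 hq
        exact bits_hom_le hs ha (hp p (hmem R hR p hp'))
  have hcan := fun R (hR : R ∈ L) => (h s hs Λ (Q ++ R.map hom) hΛ0 hΛ
    (by simpa using hN R hR) (hfr R hR).1 (hfr R hR).2 hp).2
  have hlen : ∀ R ∈ L, ((canonicalFormWithFrame μ Λ (Q ++ R.map hom)).val.1 ++
      (canonicalFormWithFrame μ Λ (Q ++ R.map hom)).val.2).length ≤ (1 + N') * Λ.length := by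
    intro R hR
    obtain ⟨h1, h2, -⟩ := hcan R hR
    rw [List.length_append, add_mul, one_mul]
    exact add_le_add h1 (h2.trans (Nat.le_mul_of_pos_right _ hn))
  have hkl : ∀ R ∈ L, (canonicalKey μ Λ (Q ++ R.map hom)).length ≤ (1 + N') * Λ.length * d := by
    intro R hR
    refine length_flatten_le (by rw [List.length_map]; exact hlen R hR) fun x hx => ?_
    obtain ⟨p, _, rfl⟩ := List.mem_map.1 hx
    simp
  have hkb : ∀ R ∈ L, ∀ x ∈ canonicalKey μ Λ (Q ++ R.map hom), bits x ≤ A * s := by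
    intro R hR x hx
    obtain ⟨v, hv, hx⟩ := List.mem_flatten.1 hx
    obtain ⟨p, hp', rfl⟩ := List.mem_map.1 hv
    obtain ⟨i, rfl⟩ := List.mem_ofFn.1 hx
    exact (hcan R hR).2.2.1 p hp' i
  have hF : 1 + 2 * ((1 + N') * Λ.length * d * (C' * μ s)) ≤ F * U := by
    calc _ = 1 + 2 * ((1 + N') * d * (Λ.length * (C' * μ s))) := by ring
      _ ≤ U + 2 * ((1 + N') * d * (C' * U)) :=
        Nat.add_le_add hU1 (Nat.mul_le_mul_left _ (Nat.mul_le_mul_left _ (hnU C')))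
      _ = F * U := by dsimp only [F]; ring
  have c1 := mapT_cost_le (f := fun R => do
    let QR ← joinFrame Q R
    let f ← canonicalFormWithFrame μ Λ QR
    let key ← flattenT ((f.1 ++ f.2).map List.ofFn)
    pure (R, key)) hL (c := J * U + (C * U + (1 + (1 + N') + (1 + N') * d) * U)) fun R hR => by
      have e1 : (joinFrame Q R).cost ≤ J * U := by
        refine ((joinFrame_cost Q R).trans ?_).trans (hcU J)
        have := hN R hR
        dsimp only [J]
        gcongr <;> omega
      have e2 : (canonicalFormWithFrame μ Λ (Q ++ R.map hom)).cost ≤ C * U := (hcan R hR).2.2.2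
      have e3 : (flattenT (((canonicalFormWithFrame μ Λ (Q ++ R.map hom)).val.1 ++
          (canonicalFormWithFrame μ Λ (Q ++ R.map hom)).val.2).map List.ofFn)).cost ≤
          (1 + (1 + N') + (1 + N') * d) * U := by
        refine (flattenT_cost_le (M := (1 + N') * Λ.length)
          (by rw [List.length_map]; exact hlen R hR) (hkl R hR)).trans ?_
        calc _ ≤ 1 * U + (1 + N') * U + (1 + N') * U * d := by rw [one_mul]; gcongr
          _ = _ := by ring
      simp only [bind_cost, pure_cost, joinFrame_val]
      omega
  have hK : (mapT (fun R => do
    let QR ← joinFrame Q R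
    let f ← canonicalFormWithFrame μ Λ QR
    let key ← flattenT ((f.1 ++ f.2).map List.ofFn)
    pure (R, key)) L).val = L.map fun R => (R, canonicalKey μ Λ (Q ++ R.map hom)) := rfl
  have c1' : 1 + H * (1 + (J * U + (C * U + (1 + (1 + N') + (1 + N') * d) * U))) ≤
      (1 + H * (1 + (J + (C + (1 + (1 + N') + (1 + N') * d))))) * U := by
    calc _ ≤ U + H * (U + (J * U + (C * U + (1 + (1 + N') + (1 + N') * d) * U))) := by gcongr
      _ = _ := by ring
  have c2' : 1 + H * (1 + F * U) ≤ (1 + H * (1 + F)) * U := by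
    calc _ ≤ U + H * (U + F * U) := by gcongr
      _ = _ := by ring
  have c3' := hcU (1 + H * (1 + 0))
  rw [add_mul, add_mul (1 + H * (1 + F)), add_mul (1 + H * (1 + F))]
  simp only [selectMinimal, bind_cost, hK]
  rcases L with _ | ⟨R, L⟩
  · simp only [List.map_nil, pure_cost]
    omega
  · rw [List.map_cons]
    simp only [bind_cost]
    have hLl : L.length ≤ H := by rw [List.length_cons] at hL; omega
    obtain ⟨f1, f2⟩ := foldT_inv (f := fun (m : List ℤ) (x : List (Pt d) × List ℤ) => do
        let b ← lexLe m x.2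
        pure (if b then m else x.2)) (fun m => ∃ R' ∈ R :: L,
          m = canonicalKey μ Λ (Q ++ R'.map hom)) (c := F * U) (N := H)
        (l := L.map fun R => (R, canonicalKey μ Λ (Q ++ R.map hom)))
        (b := canonicalKey μ Λ (Q ++ R.map hom)) (fun m x hx hm => by
          obtain ⟨R₁, hR₁, rfl⟩ := hm
          obtain ⟨R₂, hR₂, rfl⟩ := List.mem_map.1 hx
          have hR₂' : R₂ ∈ R :: L := by simp [hR₂]
          refine ⟨?_, ?_⟩
          · simp only [bind_val, pure_val]
            split
            · exact ⟨R₁, hR₁, rfl⟩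
            · exact ⟨R₂, hR₂', rfl⟩
          · have := lexLe_cost_le (hkl R₁ hR₁) (hkl R₂ hR₂') (hkb R₁ hR₁) (hkb R₂ hR₂')
              (h' s hs _ le_rfl).1
            simp only [bind_cost, pure_cost]
            omega) ⟨R, by simp, rfl⟩ (by simpa using hLl)
    generalize foldT (fun (m : List ℤ) (x : List (Pt d) × List ℤ) => do
        let b ← lexLe m x.2
        pure (if b then m else x.2)) (canonicalKey μ Λ (Q ++ R.map hom))
        (L.map fun R => (R, canonicalKey μ Λ (Q ++ R.map hom))) = least at f1 f2 ⊢
    obtain ⟨R₁, hR₁, e₁⟩ := f1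
    have c3 := filterT_cost_le (f := fun x : List (Pt d) × List ℤ => listEq x.2 least.val)
      (l := (R :: L).map fun R => (R, canonicalKey μ Λ (Q ++ R.map hom))) (N := H)
      (by simpa using hL) (c := F * U) fun x hx => by
        obtain ⟨R₂, hR₂, rfl⟩ := List.mem_map.1 hx
        rw [e₁]
        exact (listEq_cost_le (hkl R₂ hR₂) (hkl R₁ hR₁) (hkb R₂ hR₂) (hkb R₁ hR₁)
              (h' s hs _ le_rfl).1).trans hF
    have c4 := mapT_cost_le (f := fun x : List (Pt d) × List ℤ => (pure x.1 : Timed _))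
      (l := (filterT (fun x : List (Pt d) × List ℤ => listEq x.2 least.val)
        ((R :: L).map fun R => (R, canonicalKey μ Λ (Q ++ R.map hom)))).val) (N := H) (c := 0)
      ((List.length_filter_le _ _).trans (by simpa using hL)) (by simp)
    rw [List.map_cons] at c3 c4
    omega

/-- Up to repetitions, the number of frames with minimal canonical form is bounded. -/
theorem card_toFinset_selectMinimal_le (hμ : IsMulCost μ) {a N s : ℕ} (ha : 1 ≤ a) (hs : 1 ≤ s)
    {Λ : List (Pt d)} {Q : List (HPt d)} {L : List (List (Pt d))} (hΛ0 : Λ ≠ []) (hΛ : Λ.Nodup)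
    (hN : ∀ R ∈ L, R.length ≤ N) (hmem : ∀ R ∈ L, ∀ p ∈ R, p ∈ Λ)
    (hQ0 : ∀ q ∈ Q, 0 < q 0) (hQ : ∀ q ∈ Q, ∀ k, bits (q k) ≤ a * s)
    (hp : ∀ p ∈ Λ, ∀ i, bits (p i) ≤ a * s) :
    (selectMinimal μ Λ Q L).val.toFinset.card ≤
      Fintype.card (Fin (N + 1) × (Fin d → Fin d → ZMod 3)) := by
  classical
  obtain ⟨_, _, h⟩ := exists_canonicalForm_bound hμ d a (Q.length + N) ha
  obtain ⟨least, hleast⟩ := selectMinimal_val μ Λ Q L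
  have hS : ∀ R ∈ (selectMinimal μ Λ Q L).val.toFinset, R ∈ L ∧
      canonicalKey μ Λ (Q ++ R.map hom) = least := by
    intro R hR
    rw [List.mem_toFinset, hleast, List.mem_filter] at hR
    exact ⟨hR.1, by simpa using hR.2⟩
  -- The matrix is chosen for every `R`, with the dummy value 0 if no chart exists. A nonempty `R`
  -- contributes to the frame, so that a chart is available.
  have hchart : ∀ R ∈ L, ∃ M : Matrix (Fin d) (Fin d) ℤ, R ≠ [] → ∃ p T,
      IsChart Λ (frameTrace μ Λ Q ++ (R ++ T)) (canonicalFormWithFrame μ Λ (Q ++ R.map hom)).val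
        M p := by
    intro R hR
    obtain ⟨⟨T, hT⟩, -⟩ := h s hs Λ (Q ++ R.map hom) hΛ0 hΛ
      (by have := hN R hR; simp; omega)
      (fun q hq => by
        rcases List.mem_append.1 hq with hq | hq
        · exact hQ0 q hq
        · obtain ⟨p, hp', rfl⟩ := List.mem_map.1 hq
          simp [hom])
      (fun q hq => by
        rcases List.mem_append.1 hq with hq | hq
        · exact hQ q hq
        · obtain ⟨p, hp', rfl⟩ := List.mem_map.1 hq
          exact bits_hom_le hs ha (hp p (hmem R hR p hp'))) hp
    rw [frameTrace_append μ hΛ Q (hmem R hR), List.append_assoc] at hT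
    rcases hT with ⟨hT, -⟩ | ⟨M, p, hM⟩
    · refine ⟨0, fun hR0 => absurd ?_ hR0⟩
      simp only [List.append_eq_nil_iff] at hT
      exact hT.2.1
    · exact ⟨M, fun _ => ⟨p, T, hM⟩⟩
  choose! M hM using hchart
  refine Finset.card_le_card_of_injOn (t := Finset.univ)
    (fun R => ((Fin.ofNat (N + 1) R.length), fun i j => (M R i j : ZMod 3)))
    (fun _ _ => Finset.mem_coe.2 (Finset.mem_univ _)) ?_
  intro R hR R' hR' e
  obtain ⟨hRL, hkey⟩ := hS R hR
  obtain ⟨hRL', hkey'⟩ := hS R' hR'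
  rw [Prod.mk.injEq] at e
  obtain ⟨e1, e2⟩ := e
  have hlen : R.length = R'.length := by
    have h1 := hN R hRL
    have h2 := hN R' hRL'
    have := congrArg Fin.val e1
    simpa [Fin.ofNat, Nat.mod_eq_of_lt (Nat.lt_succ_of_le h1),
      Nat.mod_eq_of_lt (Nat.lt_succ_of_le h2)] using this
  -- In dimension zero there is only one point, so the length alone determines the list.
  rcases Nat.eq_zero_or_pos d with hd | hd
  · subst hd
    exact List.ext_getElem hlen fun i _ _ => Subsingleton.elim _ _
  by_cases hR0 : R = []
  · rw [hR0, List.length_nil] at hlen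
    rw [hR0, List.length_eq_zero_iff.1 hlen.symm]
  have hR0' : R' ≠ [] := fun h0 => hR0 (List.length_eq_zero_iff.1 (by rw [hlen, h0]; rfl))
  obtain ⟨p, T, u1, v1, w1⟩ := hM R hRL hR0
  obtain ⟨p', T', u2, v2, w2⟩ := hM R' hRL' hR0'
  have hf := flatten_ofFn_injective hd (hkey.trans hkey'.symm)
  obtain ⟨g1, g2⟩ := List.append_inj hf (by
    rw [v1.length_eq, v2.length_eq, List.length_map, List.length_map])
  -- The trace of `Q` is the same list for both frames, and `R` and `R'` have equal lengths.
  -- Splitting at these positions compares the images of `R` and `R'` entry by entry.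
  rw [w1, w2] at g2
  simp only [List.map_append] at g2
  have g3 := (List.append_inj g2 (by simp)).2
  have g4 := (List.append_inj g3 (by simp [hlen])).1
  have himg : ∀ x' ∈ {x | x ∈ Λ}, ∃ x ∈ {x | x ∈ Λ},
      (M R).mulVec (x - p) = (M R').mulVec (x' - p') := by
    intro x' hx'
    have h1 : (M R').mulVec (x' - p') ∈ Λ.map fun x => (M R).mulVec (x - p) := by
      refine v1.subset ?_
      rw [g1]
      exact v2.symm.subset (List.mem_map.2 ⟨x', hx', rfl⟩)
    obtain ⟨x, hx, e⟩ := List.mem_map.1 h1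
    exact ⟨x, hx, e⟩
  refine List.ext_getElem hlen fun i h1 h2 => ?_
  refine eq_of_mulVec_eq u1 u2 (fun i j => congrFun (congrFun e2 i) j) (List.finite_toSet Λ) himg
    (hmem R' hRL' _ (List.getElem_mem h2)) ?_
  have := List.getElem_of_eq g4 (i := i) (by simpa using h1)
  simpa using this

theorem length_le_of_count_le {α : Type} [DecidableEq α] {l : List α} {M : ℕ}
    (h : ∀ a, l.count a ≤ M) : l.length ≤ l.toFinset.card * M := by
  rw [← List.sum_toFinset_count_eq_length l]
  exact Finset.sum_le_card_nsmul _ _ _ fun a _ => h a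

theorem selectMinimal_sublist (μ : ℕ → ℕ) (Λ : List (Pt d)) (Q : List (HPt d))
    (L : List (List (Pt d))) : (selectMinimal μ Λ Q L).val.Sublist L := by
  obtain ⟨_, h⟩ := selectMinimal_val μ Λ Q L
  rw [h]
  exact List.filter_sublist

/-! ### Terminating computations -/

/-- The computation `m` terminates with the value `v` after `c` operations. -/
def Computes {α : Type} (m : Run α) (v : α) (c : ℕ) : Prop := ∀ t, m t = some (v, t + c)

theorem computes_pure {α : Type} (v : α) : Computes (pure v : Run α) v 0 := fun _ => rfl

theorem computes_exec {α : Type} (x : Timed α) : Computes (exec x) x.val x.cost := fun _ => rfl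

theorem Computes.bind {α β : Type} {m : Run α} {f : α → Run β} {v : α} {w : β} {c c' : ℕ}
    (h : Computes m v c) (h' : Computes (f v) w c') : Computes (m >>= f) w (c + c') := fun t => by
  have e : (m >>= f) t = (m t).bind fun x => f x.1 x.2 := rfl
  rw [e, h t, Option.bind_some, h' (t + c), add_assoc]

theorem Computes.exec_bind {α β : Type} {x : Timed α} {f : α → Run β} {w : β} {c : ℕ}
    (h : Computes (f x.val) w c) : Computes (exec x >>= f) w (x.cost + c) :=
  (computes_exec x).bind h

theorem exists_computes_mapM {α β : Type} {f : α → Run β} {P : α → β → Prop} {g : α → ℕ}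
    {l : List α} (h : ∀ a ∈ l, ∃ v c, Computes (f a) v c ∧ P a v ∧ c ≤ g a) :
    ∃ vs c, Computes (l.mapM f) vs c ∧ List.Forall₂ P l vs ∧ c ≤ (l.map g).sum := by
  induction l with
  | nil => exact ⟨[], 0, by rw [List.mapM_nil]; exact computes_pure _, .nil, le_rfl⟩
  | cons a l ih =>
    obtain ⟨v, c, h1, h2, h3⟩ := h a (by simp)
    obtain ⟨vs, c', h4, h5, h6⟩ := ih fun b hb => h b (by simp [hb])
    refine ⟨v :: vs, c + (c' + 0), ?_, .cons h2 h5, ?_⟩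
    · rw [List.mapM_cons]
      exact h1.bind (h4.bind (computes_pure _))
    · rw [List.map_cons, List.sum_cons]
      omega

theorem exists_of_forall₂_of_mem {α β : Type} {P : α → β → Prop} {l : List α} {vs : List β}
    (h : List.Forall₂ P l vs) {v : β} (hv : v ∈ vs) : ∃ a ∈ l, P a v := by
  induction h with
  | nil => simp at hv
  | cons h _ ih =>
    rcases List.mem_cons.1 hv with rfl | hv
    · exact ⟨_, by simp, h⟩
    · obtain ⟨a, ha, h⟩ := ih hv
      exact ⟨a, by simp [ha], h⟩

/-! ### The invariant of the recursion -/

/-- The lattice points have at most `s` bits and their coordinates differ by less than `2 ^ k`; the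
elements of the frame are of bounded size, in terms of `s` and `k`. -/
structure Admissible (s k : ℕ) (Λ : List (Pt d)) (Q : List (HPt d)) : Prop where
  nodup : Λ.Nodup
  le : k ≤ s + 1
  bits_le : ∀ p ∈ Λ, ∀ i, bits (p i) ≤ s
  sub_lt : ∀ p ∈ Λ, ∀ q ∈ Λ, ∀ i, |p i - q i| < 2 ^ k
  pos : ∀ q ∈ Q, 0 < q 0
  scale : ∀ q ∈ Q, q 0 * 2 ^ k ≤ 2 ^ ((d + 2) * s)
  coord : ∀ q ∈ Q, ∀ i : Fin d, |q i.succ| ≤ q 0 * 2 ^ s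
  length_le : Q.length ≤ d + 1

namespace Admissible

variable {s k : ℕ} {Λ : List (Pt d)} {Q : List (HPt d)}

theorem bits_pt (h : Admissible s k Λ Q) : ∀ p ∈ Λ, ∀ i, bits (p i) ≤ (d + 4) * s :=
  fun p hp i => (h.bits_le p hp i).trans (Nat.le_mul_of_pos_left s (by omega))

/-- The denominator is at most `2 ^ ((d + 2) * s)` and the affine coordinates at most `2 ^ s`, which
gives `(d + 3) * s` for the exponent; one more `s` absorbs the rounding. -/
theorem bits_hpt (h : Admissible s k Λ Q) (hs : 1 ≤ s) :
    ∀ q ∈ Q, ∀ i, bits (q i) ≤ (d + 4) * s := by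
  intro q hq i
  have h0 := h.pos q hq
  have h1 : q 0 ≤ 2 ^ ((d + 2) * s) :=
    (le_mul_of_one_le_right h0.le (one_le_pow₀ (by norm_num))).trans (h.scale q hq)
  have h2 : (2 : ℤ) ^ ((d + 2) * s) * 2 ^ s = 2 ^ ((d + 3) * s) := by
    rw [← pow_add]; congr 1; ring
  have key : |q i| ≤ 2 ^ ((d + 3) * s) := by
    refine Fin.cases ?_ (fun i => ?_) i
    · rw [abs_of_pos h0]
      exact h1.trans (pow_le_pow_right₀ (by norm_num) (by gcongr; omega))
    · refine (h.coord q hq i).trans ?_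
      rw [← h2]
      gcongr
  refine (bits_le_of_abs_le key).trans ?_
  rw [show (d + 4) * s = (d + 3) * s + s by ring]
  omega

theorem subset (h : Admissible s k Λ Q) {Λ' : List (Pt d)} (hn : Λ'.Nodup) (hs : Λ' ⊆ Λ) :
    Admissible s k Λ' Q :=
  ⟨hn, h.le, fun p hp => h.bits_le p (hs hp), fun p hp q hq => h.sub_lt p (hs hp) q (hs hq),
    h.pos, h.scale, h.coord, h.length_le⟩

/-- The new points have denominator 1, and `k ≤ s + 1 ≤ (d + 2) * s`. -/
theorem join (h : Admissible s k Λ Q) (hs : 1 ≤ s) {R : List (Pt d)} (hR : R ⊆ Λ)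
    (hl : Q.length + R.length ≤ d + 1) : Admissible s k Λ (Q ++ R.map hom) := by
  refine ⟨h.nodup, h.le, h.bits_le, h.sub_lt, ?_, ?_, ?_, by simpa using hl⟩
  all_goals
    intro q hq
    rcases List.mem_append.1 hq with hq | hq
  · exact h.pos q hq
  · obtain ⟨p, -, rfl⟩ := List.mem_map.1 hq
    simp [hom]
  · exact h.scale q hq
  · obtain ⟨p, -, rfl⟩ := List.mem_map.1 hq
    simp only [hom, Fin.cons_zero, one_mul]
    refine pow_le_pow_right₀ (by norm_num) (h.le.trans ?_)
    nlinarith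
  · exact h.coord q hq
  · obtain ⟨p, hp, rfl⟩ := List.mem_map.1 hq
    intro i
    simp only [hom, Fin.cons_zero, one_mul, Fin.cons_succ]
    exact (abs_lt_of_bits_le (h.bits_le p (hR hp) i)).le

/-- The denominator doubles while `2 ^ k` is halved, so the bound for their product is unchanged.
The halved lattice points are differences divided by 2, hence smaller than `2 ^ k ≤ 2 ^ s`. For
rational points, `(q - p) / 2` stays in the box of radius `2 ^ s` that contains `q` and `p`. -/
theorem halve (h : Admissible s (k + 1) Λ Q) {p : Pt d} (hp : p ∈ Λ)
    (hc : ∀ x ∈ Λ, (congrTwo p x).val = true) :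
    Admissible s k (Λ.map fun x => (halvePt p x).val) (Q.map fun q => (halveHPt μ p q).val) := by
  have hdbl : ∀ x ∈ Λ, ∀ i, 2 * (halvePt p x).val i = x i - p i := fun x hx i => by
    have := congrFun (doublePt_halvePt (hc x hx)) i
    simp only [doublePt_val] at this
    omega
  have hlt : ∀ x ∈ Λ, ∀ i, |(halvePt p x).val i| < 2 ^ k := fun x hx i => by
    have h1 := h.sub_lt x hx p hp i
    rw [← hdbl x hx i, abs_mul, pow_succ'] at h1
    simpa using h1
  have hks : k ≤ s := by have := h.le; omega
  refine ⟨?_, by omega, ?_, ?_, ?_, ?_, ?_, by simpa using h.length_le⟩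
  · refine h.nodup.map_on fun x hx y hy e => ?_
    rw [← doublePt_halvePt (hc x hx), ← doublePt_halvePt (hc y hy), e]
  · intro y hy i
    obtain ⟨x, hx, rfl⟩ := List.mem_map.1 hy
    rw [bits_le_iff]
    have h1 := hlt x hx i
    have h2 : (2 : ℤ) ^ k ≤ 2 ^ s := pow_le_pow_right₀ (by norm_num) hks
    rw [Int.abs_eq_natAbs] at h1
    exact_mod_cast h1.trans_le h2
  · intro y hy z hz i
    obtain ⟨x, hx, rfl⟩ := List.mem_map.1 hy
    obtain ⟨x', hx', rfl⟩ := List.mem_map.1 hz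
    have h1 := h.sub_lt x hx x' hx' i
    have e : x i - x' i = 2 * ((halvePt p x).val i - (halvePt p x').val i) := by
      rw [mul_sub, hdbl x hx, hdbl x' hx']; ring
    rw [e, abs_mul, pow_succ'] at h1
    simpa using h1
  all_goals
    intro y hy
    obtain ⟨q, hq, rfl⟩ := List.mem_map.1 hy
    have h0 := h.pos q hq
  · rw [halveHPt_zero]; omega
  · have := h.scale q hq
    rw [halveHPt_zero]
    rw [pow_succ'] at this
    linarith
  · intro i
    rw [halveHPt_zero, halveHPt_succ]
    have h1 := h.coord q hq i
    have h2 := (abs_lt_of_bits_le (h.bits_le p hp i)).le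
    calc |q i.succ - q 0 * p i| ≤ |q i.succ| + |q 0 * p i| := abs_sub _ _
      _ ≤ q 0 * 2 ^ s + q 0 * 2 ^ s := by
        rw [abs_mul, abs_of_pos h0]
        gcongr
      _ = _ := by ring

theorem length_le_one (h : Admissible s 0 Λ Q) : Λ.length ≤ 1 := by
  rcases hΛ : Λ with _ | ⟨p, _ | ⟨q, l⟩⟩
  · simp
  · simp
  · have hn := h.nodup
    rw [hΛ, List.nodup_cons] at hn
    refine absurd ?_ hn.1
    have : p = q := by
      funext i
      have := h.sub_lt p (by simp [hΛ]) q (by simp [hΛ]) i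
      rw [pow_zero, Int.abs_lt_one_iff] at this
      omega
    simp [this]

end Admissible

/-! ### Output of the recursion -/

/-- The list `S` consists of at most `M` frames of at most `M` points of `Λ`. -/
structure IsOutput (M : ℕ) (Λ : List (Pt d)) (S : List (List (Pt d))) : Prop where
  length_le : S.length ≤ M
  card_le : ∀ V ∈ S, V.length ≤ M
  subset : ∀ V ∈ S, V ⊆ Λ
  count_le : ∀ V, S.count V ≤ M

theorem IsOutput.mono {M M' : ℕ} {Λ Λ' : List (Pt d)} {S : List (List (Pt d))}
    (h : IsOutput M Λ S) (hM : M ≤ M') (hΛ : Λ ⊆ Λ') : IsOutput M' Λ' S :=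
  ⟨h.length_le.trans hM, fun V hV => (h.card_le V hV).trans hM,
    fun V hV _ hp => hΛ (h.subset V hV hp), fun V => (h.count_le V).trans hM⟩

theorem isOutput_singleton {M : ℕ} {Λ V : List (Pt d)} (hM : 1 ≤ M) (hl : V.length ≤ 1)
    (hV : V ⊆ Λ) : IsOutput M Λ [V] :=
  ⟨by simpa using hM, by simpa using hl.trans hM, by simpa using hV,
    fun W => (List.count_le_length.trans (by simp)).trans hM⟩

/-- A bound for the output of a step, in terms of a bound for the output of the recursive calls with
larger frames. -/
def outputBound (d M : ℕ) : ℕ :=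
  (d + 1 + M) + (Fintype.card (Fin (d + 1 + M + 1) × (Fin d → Fin d → ZMod 3)) + 1) *
    ((d + 2) * M + 1)

/-- The length is at most the number of distinct frames times the maximal multiplicity. The number
of candidates does not enter, and therefore the bound does not deteriorate along a recursion with a
fixed `Q`. -/
theorem isOutput_selectMinimal (hμ : IsMulCost μ) {s k M : ℕ} (hs : 1 ≤ s) {Λ : List (Pt d)}
    {Q : List (HPt d)} (h : Admissible s k Λ Q) {L : List (List (Pt d))} (hΛ0 : Λ ≠ [])
    (hN : ∀ R ∈ L, R.length ≤ d + 1 + M) (hmem : ∀ R ∈ L, R ⊆ Λ)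
    (hc : ∀ R, L.count R ≤ (d + 2) * M + 1) :
    IsOutput (outputBound d M) Λ (selectMinimal μ Λ Q L).val := by
  have hsub := selectMinimal_sublist μ Λ Q L
  have h1 := card_toFinset_selectMinimal_le hμ (by omega) hs hΛ0 h.nodup hN
    (fun R hR p hp => hmem R hR hp) h.pos (h.bits_hpt hs) h.bits_pt
  have h2 : ∀ R, (selectMinimal μ Λ Q L).val.count R ≤ (d + 2) * M + 1 :=
    fun R => (hsub.count_le R).trans (hc R)
  refine ⟨?_, fun V hV => ?_, fun V hV => hmem V (hsub.subset hV), fun V => ?_⟩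
  · refine (length_le_of_count_le fun R => by convert h2 R).trans (le_add_left ?_)
    gcongr
    exact h1.trans (Nat.le_succ _)
  · exact (hN V (hsub.subset hV)).trans (Nat.le_add_right _ _)
  · refine (h2 V).trans (le_add_left (Nat.le_mul_of_pos_left _ (Nat.succ_pos _)))

/-- The number of lists from `E` that are initial segments of a given list. -/
theorem length_filter_isPrefix_le {α : Type} [DecidableEq α] {N : ℕ} {E : List (List α)}
    (hE : E.Nodup) (hN : ∀ R ∈ E, R.length ≤ N) (V : List α) :
    (E.filter fun R => decide (R <+: V)).length ≤ N + 1 := by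
  have hnd : ((E.filter fun R => decide (R <+: V)).map List.length).Nodup := by
    refine (hE.filter _).map_on fun R hR R' hR' e => ?_
    have h1 : R <+: V := by simpa using (List.mem_filter.1 hR).2
    have h2 : R' <+: V := by simpa using (List.mem_filter.1 hR').2
    exact (List.prefix_of_prefix_length_le h1 h2 e.le).eq_of_length e
  have := hnd.subperm (l₂ := List.range (N + 1)) fun n hn => by
    obtain ⟨R, hR, rfl⟩ := List.mem_map.1 hn
    have := hN R (List.mem_filter.1 hR).1
    simp only [List.mem_range]
    omega
  simpa using this.length_le

/-- If `V = R ++ T`, then `R` is an initial segment of `V` and determines `T`; each such `R`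
contributes at most the multiplicity of `T` in its own list. -/
theorem count_flatten_map_append_le {α : Type} [DecidableEq α] {M : ℕ} {E : List (List α)}
    {Ls : List (List (List α))}
    (h : List.Forall₂ (fun R L => ∃ S : List (List α), (∀ T, S.count T ≤ M) ∧ L = S.map (R ++ ·)) E Ls)
    (V : List α) : Ls.flatten.count V ≤ (E.filter fun R => decide (R <+: V)).length * M := by
  induction h with
  | nil => simp
  | @cons R L E Ls h _ ih =>
    obtain ⟨S, hS, rfl⟩ := h
    rw [List.flatten_cons, List.count_append, List.filter_cons]
    split
    · rename_i hp
      obtain ⟨T, rfl⟩ : R <+: V := by simpa using hp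
      rw [List.count_map_of_injective _ _ (List.append_right_injective R), List.length_cons,
        add_mul, one_mul]
      have := hS T
      omega
    · rename_i hp
      rw [List.count_eq_zero_of_not_mem, zero_add]
      · exact ih
      · intro hV
        obtain ⟨T, -, rfl⟩ := List.mem_map.1 hV
        exact hp (by simp)

/-! ### The steps of the recursion -/

/-- The step for points that are not congruent modulo `2`. -/
def splitStep (μ : ℕ → ℕ) (Λ : List (Pt d)) (Q : List (HPt d)) : Run (List (List (Pt d))) := do
  let classes ← exec (partitionTwo Λ)
  let sorted ← exec (sortBySize classes)
  let small := sorted.dropLast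
  let big := sorted.getLastD []
  exec (tick (1 + sorted.length + Λ.length))
  if 2 * big.length ≤ Λ.length then
    let Ss ← sorted.mapM fun c => equivariantFramesRec μ c Q
    let Λ' ← exec (unionT Ss)
    let L ← exec (complementaryFrames μ Λ' Λ Q)
    exec (selectMinimal μ Λ Q L)
  else
    let Ss ← small.mapM fun c => equivariantFramesRec μ c Q
    let Λ' ← exec (unionT Ss)
    let rest ← exec (flattenT small)
    let E ← exec (complementaryFrames μ Λ' rest Q)
    let Ls ← E.mapM fun R => do
      let QR ← exec (joinFrame Q R)
      let S ← equivariantFramesRec μ big QR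
      exec (mapT (fun T => do tick (1 + R.length); pure (R ++ T)) S)
    let L ← exec (flattenT Ls)
    exec (selectMinimal μ Λ Q L)

/-- One unfolding of the fixed point, with the branch for several congruence classes isolated. -/
theorem equivariantFramesRec_eq (μ : ℕ → ℕ) (Λ₀ : List (Pt d)) (Q : List (HPt d)) :
    equivariantFramesRec μ Λ₀ Q = exec (minusSpan μ Λ₀ Q) >>= fun Λ =>
      exec (tick (1 + Λ.length)) >>= fun _ =>
      match Λ with
      | [] => pure [[]]
      | [p] => pure [[p]]
      | p :: q :: l => exec (allT (congrTwo p) (p :: q :: l)) >>= fun same =>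
          if same then exec (mapT (halvePt p) (p :: q :: l)) >>= fun Λ' =>
            exec (mapT (halveHPt μ p) Q) >>= fun Q' =>
            equivariantFramesRec μ Λ' Q' >>= fun S' =>
            exec (mapT (mapT (doublePt p)) S')
          else splitStep μ (p :: q :: l) Q := by
  rw [equivariantFramesRec]
  congr 1
  funext Λ
  congr 1
  funext _
  rcases Λ with _ | ⟨p, _ | ⟨q, l⟩⟩ <;> rfl

/-- Two incongruent points yield at least two classes, so there is a last class as well as a
nonempty list of others. The number of classes is a constant, which keeps sorting by size linear. -/
theorem exists_classes_bound (hμ : IsMulCost μ) (d : ℕ) : ∃ C, ∀ s, 1 ≤ s → ∀ Λ : List (Pt d),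
    (∀ p ∈ Λ, ∀ i, bits (p i) ≤ s) → Λ.Nodup → (∃ p ∈ Λ, ∃ q ∈ Λ, ¬ Congr p q) →
    ∃ small big, (sortBySize (partitionTwo Λ).val).val = small ++ [big] ∧ small ≠ [] ∧
      (∀ c ∈ small ++ [big], c ≠ [] ∧ c ⊆ Λ ∧ c.Nodup) ∧ (small ++ [big]).length ≤ 2 ^ d ∧
      (small ++ [big]).flatten.Perm Λ ∧ (∀ c ∈ small, 2 * c.length ≤ Λ.length) ∧
      (partitionTwo Λ).cost + ((sortBySize (partitionTwo Λ).val).cost +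
        (1 + (small ++ [big]).length + Λ.length)) ≤ Λ.length * (C * μ s) := by
  obtain ⟨C, hC⟩ := hμ.exists_op 1
  refine ⟨1 + (2 + 2 ^ d * (1 + d * (2 * C))) + (1 + 2 ^ d * 2 ^ d * 7) + (1 + 2 ^ d + 1),
    fun s hs Λ hΛ hn hne => ?_⟩
  have hw := hμ.one_le hs
  have hop := (hC s hs s (by omega)).1
  obtain ⟨h1, h2, h3⟩ := partitionTwo_spec (c := 1 + d * (2 * (C * μ s))) Λ fun p hp q hq =>
    congrTwo_cost_le (hΛ p hp) (hΛ q hq) hop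
  obtain ⟨g1, g2, g3⟩ := sortBySize_spec (partitionTwo Λ).val
  have hlen := h1.length_le
  have hfl : (sortBySize (partitionTwo Λ).val).val.flatten.Perm Λ := g1.flatten.trans h2
  have hlen2 : 2 ≤ (partitionTwo Λ).val.length := by
    by_contra hlt
    obtain ⟨p, hp, q, hq, hpq⟩ := hne
    rcases hL : (partitionTwo Λ).val with _ | ⟨c, _ | ⟨c', l⟩⟩
    · rw [hL] at h2
      have := h2.symm.subset hp
      simp at this
    · have hc := h1.congr c (by simp [hL])
      rw [hL] at h2
      have e : [c].flatten = c := by simp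
      rw [e] at h2
      exact hpq (hc p (h2.symm.subset hp) q (h2.symm.subset hq))
    · rw [hL] at hlt
      simp at hlt
  have hlen' : 2 ≤ (sortBySize (partitionTwo Λ).val).val.length := by rw [g1.length_eq]; exact hlen2
  rcases List.eq_nil_or_concat (sortBySize (partitionTwo Λ).val).val with h0 | ⟨small, big, e⟩
  · rw [h0] at hlen'; simp at hlen'
  rw [List.concat_eq_append] at e
  have hne' : ∀ c ∈ small ++ [big], c ∈ (partitionTwo Λ).val := fun c hc => by
    rw [← e] at hc
    exact g1.subset hc
  rw [e] at hfl g2 hlen' g1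
  have hnd := hfl.nodup_iff.2 hn
  have hlen3 : (small ++ [big]).length ≤ 2 ^ d := by rw [g1.length_eq]; exact hlen
  have hn1 : 1 ≤ Λ.length := by
    obtain ⟨p, hp, -⟩ := hne
    exact List.length_pos_of_mem hp
  refine ⟨small, big, e, ?_, fun c hc => ⟨h1.ne_nil c (hne' c hc), fun p hp =>
      hfl.subset (List.mem_flatten.2 ⟨c, hc, hp⟩), (List.nodup_flatten.1 hnd).1 c hc⟩,
    hlen3, hfl, ?_, ?_⟩
  · rintro rfl
    simp at hlen'
  · intro c hc
    -- A class that precedes the largest one has at most half of the points, as the two together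
    -- have at most all of them.
    have h4 : c.length ≤ big.length := (List.pairwise_append.1 g2).2.2 c hc big (by simp)
    have h5 := hfl.length_eq
    have h6 := (List.sublist_flatten_of_mem hc).length_le
    rw [List.flatten_append, List.length_append] at h5
    simp only [List.flatten_singleton] at h5
    omega
  · have h4 : (sortBySize (partitionTwo Λ).val).cost ≤
        1 + 2 ^ d * 2 ^ d * (4 + (1 + 2 * Λ.length)) := by
      refine g3.trans ?_
      rw [h2.length_eq]
      gcongr
      refine le_trans ?_ hlen
      exact Nat.clog_le_of_le_pow (Nat.lt_two_pow_self).le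
    calc _ ≤ (1 + Λ.length * (2 + 2 ^ d * (1 + d * (2 * (C * μ s))))) +
          ((1 + 2 ^ d * 2 ^ d * (4 + (1 + 2 * Λ.length))) + (1 + 2 ^ d + Λ.length)) := by
          gcongr
      _ ≤ (Λ.length * μ s + Λ.length * (2 * μ s + 2 ^ d * (μ s + d * (2 * (C * μ s))))) +
          ((Λ.length * μ s + 2 ^ d * 2 ^ d * (4 * (Λ.length * μ s) +
            (Λ.length * μ s + 2 * (Λ.length * μ s)))) +
            (Λ.length * μ s + 2 ^ d * (Λ.length * μ s) + Λ.length * μ s)) := by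
          have : 1 ≤ Λ.length * μ s := Nat.mul_pos hn1 hw
          have : Λ.length ≤ Λ.length * μ s := Nat.le_mul_of_pos_right _ hw
          have : 2 ^ d * 1 ≤ 2 ^ d * (Λ.length * μ s) := by gcongr
          gcongr
          all_goals first | assumption | omega
      _ = _ := by ring

/-- The recursive call for `Λ` and `Q` terminates, with a bounded output and a bounded cost. -/
def Solves (μ : ℕ → ℕ) (s k C M : ℕ) (Λ : List (Pt d)) (Q : List (HPt d)) : Prop :=
  ∃ S c, Computes (equivariantFramesRec μ Λ Q) S c ∧ IsOutput M Λ S ∧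
    c ≤ C * (μ s * (Λ.length * (k + s * (Nat.log 2 Λ.length + 1) ^ 2)))

theorem exists_union_bound (hμ : IsMulCost μ) (d M : ℕ) : ∃ C, ∀ s, 1 ≤ s →
    ∀ (Λ : List (Pt d)) (Ss : List (List (List (Pt d)))), (∀ p ∈ Λ, ∀ i, bits (p i) ≤ s) →
    Ss.length ≤ 2 ^ d → (∀ S ∈ Ss, IsOutput M Λ S) →
    (unionT Ss).val.Nodup ∧ (unionT Ss).val ⊆ Λ ∧ (unionT Ss).val.length ≤ 2 ^ d * M * M ∧
    (unionT Ss).cost ≤ C * μ s := by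
  obtain ⟨C, hC⟩ := exists_unionT_bound hμ d 1 (2 ^ d) M M
  refine ⟨C, fun s hs Λ Ss hΛ hl h => ?_⟩
  obtain ⟨h1, h2⟩ := unionT_spec Ss
  obtain ⟨h3, h4⟩ := hC s hs Ss hl (fun S hS => (h S hS).length_le)
    (fun S hS => (h S hS).card_le)
    (fun S hS V hV p hp i => by rw [one_mul]; exact hΛ p ((h S hS).subset V hV hp) i)
  refine ⟨h1, fun p hp => ?_, h3, h4⟩
  obtain ⟨S, hS, V, hV, hp⟩ := h2 p hp
  exact (h S hS).subset V hV hp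

/-- The recursive calls for the classes of a partition. -/
theorem exists_computes_classes {s k C M K : ℕ} {Λ : List (Pt d)} {Q : List (HPt d)}
    {cs : List (List (Pt d))}
    (h : ∀ c ∈ cs, c ⊆ Λ ∧ Nat.log 2 c.length + 1 ≤ K ∧ Solves μ s k C M c Q) :
    ∃ Ss c, Computes (cs.mapM fun c => equivariantFramesRec μ c Q) Ss c ∧
      Ss.length = cs.length ∧ (∀ S ∈ Ss, IsOutput M Λ S) ∧
      c ≤ C * (μ s * (cs.flatten.length * (k + s * K ^ 2))) := by
  obtain ⟨Ss, c, h1, h2, h3⟩ := exists_computes_mapM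
    (f := fun c => equivariantFramesRec μ c Q) (P := fun _ S => IsOutput M Λ S)
    (g := fun c => c.length * (C * (μ s * (k + s * K ^ 2)))) (l := cs) fun c hc => by
      obtain ⟨hsub, hK, S, t, g1, g2, g3⟩ := h c hc
      refine ⟨S, t, g1, g2.mono le_rfl hsub, g3.trans ?_⟩
      calc _ ≤ C * (μ s * (c.length * (k + s * K ^ 2))) := by gcongr
        _ = _ := by ring
  refine ⟨Ss, c, h1, h2.length_eq.symm, fun S hS => ?_, h3.trans (le_of_eq ?_)⟩
  · obtain ⟨_, -, hP⟩ := exists_of_forall₂_of_mem h2 hS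
    exact hP
  · rw [List.sum_map_mul_right, List.length_flatten]
    ring

/-- The constant `C` may depend on the sizes of the recursive outputs, but not on the recursive cost
`C₁`, which is chosen afterwards. In the recursive term `Nat.log 2 Λ.length` replaces `Nat.log 2
Λ.length + 1`; this gain pays for the step. -/
theorem exists_balanced_bound (hμ : IsMulCost μ) (d M₀ M₁ : ℕ) : ∃ C, ∀ s, 1 ≤ s →
    ∀ (k C₁ : ℕ) (Λ : List (Pt d)) (Q : List (HPt d)) (cs : List (List (Pt d))),
    Admissible s k Λ Q → Λ ≠ [] → cs.length ≤ 2 ^ d → cs.flatten.Perm Λ →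
    (∀ c ∈ cs, c ≠ [] ∧ c ⊆ Λ ∧ 2 * c.length ≤ Λ.length ∧ Solves μ s k C₁ M₁ c Q) →
    ∃ S c, Computes (cs.mapM (fun c => equivariantFramesRec μ c Q) >>= fun Ss =>
        exec (unionT Ss) >>= fun Λ' => exec (complementaryFrames μ Λ' Λ Q) >>= fun L =>
        exec (selectMinimal μ Λ Q L)) S c ∧
      IsOutput (outputBound d M₀) Λ S ∧
      c ≤ C * (Λ.length * (Nat.log 2 Λ.length + 1) * (s * μ s)) +
        C₁ * (μ s * (Λ.length * (k + s * Nat.log 2 Λ.length ^ 2))) := by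
  obtain ⟨A₁, h₁⟩ := exists_union_bound hμ d M₁
  obtain ⟨A₂, h₂⟩ := exists_complementaryFrames_bound hμ d (d + 4) (2 ^ d * M₁ * M₁ + (d + 1))
    (by omega)
  obtain ⟨A₃, h₃⟩ := exists_selectMinimal_bound hμ d (d + 4) (d + 1 + (d + 1)) A₂ (by omega)
  refine ⟨A₁ + (2 * A₂ + A₃), fun s hs k C₁ Λ Q cs hadm hΛ0 hcs hperm h => ?_⟩
  have hw := hμ.one_le hs
  have hn : 1 ≤ Λ.length := List.length_pos_iff.2 hΛ0
  obtain ⟨Ss, c, r1, r2, r3, r4⟩ := exists_computes_classes (K := Nat.log 2 Λ.length)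
    (fun c hc => by
      obtain ⟨g1, g2, g3, g4⟩ := h c hc
      refine ⟨g2, ?_, g4⟩
      have h1 : c.length ≠ 0 := by simpa using g1
      -- Halving lowers the logarithm: `log c + 1 = log (2 c) ≤ log n`.
      rw [← Nat.log_mul_base (by norm_num) h1]
      exact Nat.log_mono_right (by omega))
  obtain ⟨u1, u2, u3, u4⟩ := h₁ s hs Λ Ss hadm.bits_le (r2.trans_le hcs) r3
  obtain ⟨v1, v2⟩ := h₂ s hs (unionT Ss).val Λ Q (by omega)
    (hadm.length_le.trans (by omega)) (hadm.bits_hpt hs)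
    (fun p hp => hadm.bits_pt p (u2 hp)) hadm.bits_pt
  have hmem : ∀ R ∈ (complementaryFrames μ (unionT Ss).val Λ Q).val, R.length ≤ d + 1 ∧ R ⊆ Λ :=
    fun R hR => by
      obtain ⟨m1, m2, -⟩ := mem_complementaryFrames hR
      exact ⟨m1, fun p hp => u2 (m2 p hp)⟩
  have w := h₃ s hs Λ Q _ hΛ0 hadm.nodup v1
    (fun R hR => Nat.add_le_add hadm.length_le (hmem R hR).1) (fun R hR p hp => (hmem R hR).2 hp)
    hadm.pos (hadm.bits_hpt hs) hadm.bits_pt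
  refine ⟨_, _, r1.bind (Computes.exec_bind (Computes.exec_bind (by exact computes_exec _))),
    isOutput_selectMinimal hμ hs hadm hΛ0 (fun R hR => (hmem R hR).1.trans (by omega))
      (fun R hR => (hmem R hR).2) (fun R => ?_), ?_⟩
  · exact (List.nodup_iff_count_le_one.1 (complementaryFrames_nodup μ u1 Λ Q) R).trans (by omega)
  · rw [hperm.length_eq] at r4
    have e1 : A₁ * μ s ≤ A₁ * (Λ.length * (Nat.log 2 Λ.length + 1) * (s * μ s)) := by
      refine le_trans ?_ (linear_le_unit (n := Λ.length) (Nat.le_add_left 1 _) hs)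
      exact Nat.le_mul_of_pos_left _ hn
    have e2 : (Λ.length + 1) * (A₂ * μ s) ≤
        2 * A₂ * (Λ.length * (Nat.log 2 Λ.length + 1) * (s * μ s)) := by
      refine le_trans ?_ (linear_le_unit (n := Λ.length) (Nat.le_add_left 1 _) hs)
      calc (Λ.length + 1) * (A₂ * μ s) ≤ (Λ.length + Λ.length) * (A₂ * μ s) := by gcongr
        _ = _ := by ring
    rw [add_mul, add_mul]
    omega

/-- Here `E` bounds the number of frames `R`, hence the number of calls for the large class. Like
`C` it does not depend on `C₀` and `C₁`. The calls for the large class use only the constants for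
frames with more points than `Q`. -/
theorem exists_unbalanced_bound (hμ : IsMulCost μ) (d M₀ M₁ : ℕ) : ∃ C E, ∀ s, 1 ≤ s →
    ∀ (k C₀ C₁ : ℕ) (Λ : List (Pt d)) (Q : List (HPt d)) (small : List (List (Pt d)))
      (big : List (Pt d)),
    Admissible s k Λ Q → (∀ p ∈ Λ, (inSpan μ (spanBasis μ Q).val p).val = false) →
    small.length ≤ 2 ^ d → small ≠ [] → small.flatten.length ≤ Λ.length →
    (∀ c ∈ small, c ≠ [] ∧ c ⊆ Λ ∧ Solves μ s k C₁ M₁ c Q) →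
    big ⊆ Λ → big.length ≤ Λ.length →
    (∀ R : List (Pt d), R ≠ [] → R ⊆ Λ → Q.length + R.length ≤ d + 1 →
      Solves μ s k C₀ M₀ big (Q ++ R.map hom)) →
    ∃ S c, Computes (small.mapM (fun c => equivariantFramesRec μ c Q) >>= fun Ss =>
        exec (unionT Ss) >>= fun Λ' => exec (flattenT small) >>= fun rest =>
        exec (complementaryFrames μ Λ' rest Q) >>= fun E =>
        (E.mapM fun R => exec (joinFrame Q R) >>= fun QR => equivariantFramesRec μ big QR >>=
          fun S => exec (mapT (fun T => do tick (1 + R.length); pure (R ++ T)) S)) >>= fun Ls =>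
        exec (flattenT Ls) >>= fun L => exec (selectMinimal μ Λ Q L)) S c ∧
      IsOutput (outputBound d M₀) Λ S ∧
      c ≤ C * (Λ.length * (Nat.log 2 Λ.length + 1) * (s * μ s)) +
        C₁ * (μ s * (small.flatten.length * (k + s * (Nat.log 2 Λ.length + 1) ^ 2))) +
        E * (C₀ * (μ s * (big.length * (k + s * (Nat.log 2 Λ.length + 1) ^ 2)))) := by
  obtain ⟨A₁, h₁⟩ := exists_union_bound hμ d M₁
  obtain ⟨A₂, h₂⟩ := exists_complementaryFrames_bound hμ d (d + 4) (2 ^ d * M₁ * M₁ + (d + 1))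
    (by omega)
  obtain ⟨A₃, h₃⟩ := exists_selectMinimal_bound hμ d (d + 4) (d + 1 + (d + 1 + M₀)) (A₂ * M₀)
    (by omega)
  let J := 1 + (d + 1) * (1 + (d + 1)) + (1 + (d + 1)) + (1 + M₀ * (1 + (1 + (d + 1))))
  refine ⟨A₁ + (1 + 2 ^ d + 1) + 2 * A₂ + A₂ * J + (1 + A₂ + A₂ * M₀) + A₃, A₂,
    fun s hs k C₀ C₁ Λ Q small big hadm hspan hsl hs0 hsf hsmall hbig hbigl hrec => ?_⟩
  have hw := hμ.one_le hs
  obtain ⟨c₀, hc₀⟩ := List.exists_mem_of_ne_nil _ hs0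
  obtain ⟨p₀, hp₀⟩ := List.exists_mem_of_ne_nil _ (hsmall c₀ hc₀).1
  have hp₀Λ := (hsmall c₀ hc₀).2.1 hp₀
  have hΛ0 : Λ ≠ [] := List.ne_nil_of_mem hp₀Λ
  have hn : 1 ≤ Λ.length := List.length_pos_iff.2 hΛ0
  have hrestΛ : ∀ p ∈ small.flatten, p ∈ Λ := fun p hp => by
    obtain ⟨c, hc, hp⟩ := List.mem_flatten.1 hp
    exact (hsmall c hc).2.1 hp
  obtain ⟨Ss, c, r1, r2, r3, r4⟩ := exists_computes_classes (K := Nat.log 2 Λ.length + 1)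
    (fun c hc => by
      obtain ⟨g1, g2, g3⟩ := hsmall c hc
      refine ⟨g2, ?_, g3⟩
      exact Nat.add_le_add_right (Nat.log_mono_right
        ((List.sublist_flatten_of_mem hc).length_le.trans hsf)) 1)
  obtain ⟨u1, u2, u3, u4⟩ := h₁ s hs Λ Ss hadm.bits_le (r2.trans_le hsl) r3
  obtain ⟨v1, v2⟩ := h₂ s hs (unionT Ss).val small.flatten Q (by omega)
    (hadm.length_le.trans (by omega)) (hadm.bits_hpt hs)
    (fun p hp => hadm.bits_pt p (u2 hp)) (fun p hp => hadm.bits_pt p (hrestΛ p hp))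
  have hEnd := complementaryFrames_nodup μ u1 small.flatten Q
  have hmem : ∀ R ∈ (complementaryFrames μ (unionT Ss).val small.flatten Q).val,
      R ≠ [] ∧ R ⊆ Λ ∧ Q.length + R.length ≤ d + 1 := fun R hR => by
    obtain ⟨m1, m2, m3, m4⟩ := mem_complementaryFrames hR
    have hRΛ : R ⊆ Λ := fun p hp => u2 (m2 p hp)
    refine ⟨?_, hRΛ, ?_⟩
    -- An empty `R` would mean that `p₀` belongs to the computed span of `Q`, whereas such points
    -- have been removed.
    · rintro rfl
      have t1 := m4 p₀ (List.mem_flatten.2 ⟨c₀, hc₀, hp₀⟩)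
      rw [List.map_nil, List.append_nil, hspan p₀ hp₀Λ] at t1
      exact Bool.false_ne_true t1
    -- A frame has as many points as its echelon form has rows, at most `d + 1`.
    · obtain ⟨A, C, hb⟩ := exists_spanBasis_bound hμ d (d + 4)
      rw [← m3]
      refine (hb s hs _ fun q hq => ?_).1
      rcases List.mem_append.1 hq with hq | hq
      · exact hadm.bits_hpt hs q hq
      · obtain ⟨p, hp, rfl⟩ := List.mem_map.1 hq
        exact bits_hom_le hs (by omega) (hadm.bits_pt p (hRΛ hp))
  set E := (complementaryFrames μ (unionT Ss).val small.flatten Q).val with hE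
  set X := C₀ * (μ s * (big.length * (k + s * (Nat.log 2 Λ.length + 1) ^ 2))) with hX
  obtain ⟨Ls, c', b1, b2, b3⟩ := exists_computes_mapM
    (f := fun R => exec (joinFrame Q R) >>= fun QR => equivariantFramesRec μ big QR >>=
          fun S => exec (mapT (fun T => do tick (1 + R.length); pure (R ++ T)) S))
    (P := fun R L => ∃ S : List (List (Pt d)), (R ⊆ Λ ∧ R.length ≤ d + 1 ∧ IsOutput M₀ Λ S) ∧
      L = S.map (R ++ ·))
    (g := fun _ => J + X) (l := E) fun R hR => by
      obtain ⟨m1, m2, m3⟩ := hmem R hR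
      obtain ⟨S, t, g1, g2, g3⟩ := hrec R m1 m2 m3
      refine ⟨_, _, Computes.exec_bind (Computes.bind (v := S) (by exact g1) (by exact computes_exec _)),
        ⟨S, ⟨m2, by omega, g2.mono le_rfl hbig⟩, rfl⟩, ?_⟩
      have f1 := joinFrame_cost Q R
      have f2 := mapT_cost_le (f := fun T => do tick (1 + R.length); pure (R ++ T)) (l := S)
        (c := 1 + (d + 1)) g2.length_le (fun T _ => by
          simp only [bind_cost, tick_cost, pure_cost]; omega)
      have f3 : t ≤ X := g3.trans (by rw [hX]; gcongr)
      have f4 : R.length * (1 + (d + 1)) ≤ (d + 1) * (1 + (d + 1)) := by gcongr; omega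
      have f5 := hadm.length_le
      have f6 : J = 1 + (d + 1) * (1 + (d + 1)) + (1 + (d + 1)) +
        (1 + M₀ * (1 + (1 + (d + 1)))) := rfl
      omega
  have hLs : Ls.length ≤ A₂ := b2.length_eq ▸ v1
  have hLl : Ls.flatten.length ≤ A₂ * M₀ := length_flatten_le hLs fun L hL => by
    obtain ⟨R, -, S, ⟨-, -, hS⟩, rfl⟩ := exists_of_forall₂_of_mem b2 hL
    rw [List.length_map]
    exact hS.length_le
  have hLmem : ∀ V ∈ Ls.flatten, V.length ≤ d + 1 + M₀ ∧ V ⊆ Λ := fun V hV => by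
    obtain ⟨L, hL, hV⟩ := List.mem_flatten.1 hV
    obtain ⟨R, -, S, ⟨hR, hRl, hS⟩, rfl⟩ := exists_of_forall₂_of_mem b2 hL
    obtain ⟨T, hT, rfl⟩ := List.mem_map.1 hV
    refine ⟨?_, List.append_subset.2 ⟨hR, hS.subset T hT⟩⟩
    rw [List.length_append]
    exact Nat.add_le_add hRl (hS.card_le T hT)
  have w := h₃ s hs Λ Q Ls.flatten hΛ0 hadm.nodup hLl
    (fun R hR => Nat.add_le_add hadm.length_le (hLmem R hR).1)
    (fun R hR p hp => (hLmem R hR).2 hp) hadm.pos (hadm.bits_hpt hs) hadm.bits_pt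
  refine ⟨_, _, r1.bind (Computes.exec_bind (Computes.exec_bind (Computes.exec_bind
    (b1.bind (Computes.exec_bind (by exact computes_exec _)))))),
    isOutput_selectMinimal hμ hs hadm hΛ0 (fun R hR => (hLmem R hR).1)
      (fun R hR => (hLmem R hR).2) (fun V => ?_), ?_⟩
  -- The initial segments `R` of a given list have lengths between 0 and `d + 1`, whence the factor
  -- `d + 2` in the multiplicity.
  · have t1 := count_flatten_map_append_le (M := M₀)
      (b2.imp fun R L ⟨S, ⟨_, _, hS⟩, e⟩ => ⟨S, hS.count_le, e⟩) V
    have t2 := length_filter_isPrefix_le (N := d + 1) hEnd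
      (fun R hR => by have := (hmem R hR).2.2; omega) V
    refine (t1.trans ?_).trans (Nat.le_succ _)
    gcongr
  · set U := Λ.length * (Nat.log 2 Λ.length + 1) * (s * μ s) with hU
    have hlin : ∀ c, Λ.length * (c * μ s) ≤ c * U :=
      fun c => linear_le_unit (Nat.le_add_left 1 _) hs
    have hU1 : 1 ≤ U := Nat.mul_pos (Nat.mul_pos hn (Nat.succ_pos _)) (Nat.mul_pos hs hw)
    have hcU : ∀ c, c ≤ c * U := fun c => Nat.le_mul_of_pos_right _ hU1
    have e1 : A₁ * μ s ≤ A₁ * U := (Nat.le_mul_of_pos_left _ hn).trans (hlin _)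
    have e2 : (small.flatten.length + 1) * (A₂ * μ s) ≤ 2 * A₂ * U := by
      refine le_trans ?_ (hlin _)
      calc _ ≤ (Λ.length + Λ.length) * (A₂ * μ s) := by gcongr
        _ = _ := by ring
    have e3 : (flattenT small).cost ≤ (1 + 2 ^ d + 1) * U := by
      refine (flattenT_cost_le hsl hsf).trans ?_
      have t1 : Λ.length ≤ 1 * U :=
        (Nat.le_mul_of_pos_right _ (Nat.mul_pos one_pos hw)).trans (hlin 1)
      have t2 := hcU (1 + 2 ^ d)
      rw [add_mul (1 + 2 ^ d)]
      omega
    have e4 : c' ≤ A₂ * J * U + A₂ * X := by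
      have t1 : (E.map fun _ => J + X).sum ≤ A₂ * (J + X) :=
        (sum_map_le fun _ _ => le_rfl).trans (by gcongr)
      have t2 := hcU (A₂ * J)
      rw [mul_add] at t1
      omega
    have e5 : (flattenT Ls).cost ≤ (1 + A₂ + A₂ * M₀) * U :=
      (flattenT_cost_le hLs hLl).trans (hcU _)
    have e6 := v2
    simp only [flattenT_val] at e6 w ⊢
    simp only [add_mul _ _ U] at e3 e5 ⊢
    omega

/-- The parameter `b` reserves room for the linear cost of the steps that precede the splitting. The
condition on `C₁` is linear in `C₀`, and `B` and `E` do not depend on either, so a suitable `C₁`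
exists. -/
theorem exists_splitStep_bound (hμ : IsMulCost μ) (d M₀ M₁ : ℕ) : ∃ B E, ∀ s, 1 ≤ s →
    ∀ (k C₀ C₁ : ℕ) (Λ : List (Pt d)) (Q : List (HPt d)),
    Admissible s k Λ Q → (∀ p ∈ Λ, (inSpan μ (spanBasis μ Q).val p).val = false) →
    (∃ p ∈ Λ, ∃ q ∈ Λ, ¬ Congr p q) →
    (∀ c : List (Pt d), c ≠ [] → c ⊆ Λ → c.Nodup → c.length < Λ.length →
      Solves μ s k C₁ M₁ c Q) →
    (∀ c R : List (Pt d), c ≠ [] → c ⊆ Λ → c.Nodup → R ≠ [] → R ⊆ Λ →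
      Q.length + R.length ≤ d + 1 → Solves μ s k C₀ M₀ c (Q ++ R.map hom)) →
    ∃ S c, Computes (splitStep μ Λ Q) S c ∧ IsOutput (outputBound d M₀) Λ S ∧
      ∀ b, E * C₀ + 2 * (B + b) ≤ C₁ → c + Λ.length * (b * μ s) ≤
        C₁ * (μ s * (Λ.length * (k + s * (Nat.log 2 Λ.length + 1) ^ 2))) := by
  obtain ⟨A₀, h₀⟩ := exists_classes_bound hμ d
  obtain ⟨A₁, h₁⟩ := exists_balanced_bound hμ d M₀ M₁
  obtain ⟨A₂, E, h₂⟩ := exists_unbalanced_bound hμ d M₀ M₁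
  refine ⟨A₀ + A₁ + A₂, E, fun s hs k C₀ C₁ Λ Q hadm hspan hne hrec hrec' => ?_⟩
  obtain ⟨small, big, e, hs0, hcs, hlen, hperm, hsmall, hcost⟩ :=
    h₀ s hs Λ hadm.bits_le hadm.nodup hne
  obtain ⟨p₀, hp₀, -⟩ := hne
  have hΛ0 : Λ ≠ [] := List.ne_nil_of_mem hp₀
  have hl := hperm.length_eq
  rw [List.flatten_append, List.length_append, List.flatten_singleton] at hl
  have hlt : ∀ c ∈ small ++ [big], 2 * c.length ≤ Λ.length → Solves μ s k C₁ M₁ c Q :=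
    fun c hc h2 => by
      obtain ⟨g1, g2, g3⟩ := hcs c hc
      have := List.length_pos_iff.2 g1
      exact hrec c g1 g2 g3 (by omega)
  set l := Nat.log 2 Λ.length with hldef
  have hlin : ∀ c, Λ.length * (c * μ s) ≤ c * (Λ.length * (l + 1) * (s * μ s)) :=
    fun c => linear_le_unit (Nat.le_add_left 1 _) hs
  by_cases hb : 2 * big.length ≤ Λ.length
  · obtain ⟨S, c, r1, r2, r3⟩ := h₁ s hs k C₁ Λ Q (small ++ [big]) hadm hΛ0 hlen hperm
      fun c hc => by
        have h2 : 2 * c.length ≤ Λ.length := by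
          rcases List.mem_append.1 hc with hc | hc
          · exact hsmall c hc
          · rw [List.mem_singleton.1 hc]; exact hb
        exact ⟨(hcs c hc).1, (hcs c hc).2.1, h2, hlt c hc h2⟩
    refine ⟨S, (partitionTwo Λ).cost + ((sortBySize (partitionTwo Λ).val).cost +
      ((tick (1 + (sortBySize (partitionTwo Λ).val).val.length + Λ.length)).cost + c)), ?_, r2,
      fun b hbC => ?_⟩
    · refine Computes.exec_bind (Computes.exec_bind (Computes.exec_bind ?_))
      simp only [e, List.dropLast_concat, List.getLastD_concat]
      rw [if_pos hb]
      exact r1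
    · rw [e, tick_cost]
      rw [← hldef] at r3
      have t1 := hlin A₀
      have t2 := hlin b
      -- The balanced case rests on `l ^ 2 + (l + 1) ≤ (l + 1) ^ 2`.
      have t3 : (A₀ + A₁ + b) * (Λ.length * (l + 1) * (s * μ s)) + C₁ *
          (μ s * (Λ.length * (k + s * l ^ 2))) ≤
          C₁ * (μ s * (Λ.length * (k + s * (l + 1) ^ 2))) := by
        calc _ ≤ C₁ * (Λ.length * (l + 1) * (s * μ s)) + C₁ *
              (μ s * (Λ.length * (k + s * l ^ 2))) := by
              gcongr
              omega
          _ = C₁ * (μ s * (Λ.length * (k + s * (l ^ 2 + (l + 1))))) := by ring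
          _ ≤ _ := by
            gcongr
            nlinarith
      rw [add_mul, add_mul] at t3
      omega
  · obtain ⟨S, c, r1, r2, r3⟩ := h₂ s hs k C₀ C₁ Λ Q small big hadm hspan
      (by rw [List.length_append] at hlen; omega) hs0 (by omega)
      (fun c hc => ⟨(hcs c (by simp [hc])).1, (hcs c (by simp [hc])).2.1,
        hlt c (by simp [hc]) (hsmall c hc)⟩) (hcs big (by simp)).2.1 (by omega)
      fun R hR0 hR hRl => by
        obtain ⟨g1, g2, g3⟩ := hcs big (by simp)
        exact hrec' big R g1 g2 g3 hR0 hR hRl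
    refine ⟨S, (partitionTwo Λ).cost + ((sortBySize (partitionTwo Λ).val).cost +
      ((tick (1 + (sortBySize (partitionTwo Λ).val).val.length + Λ.length)).cost + c)), ?_, r2,
      fun b hbC => ?_⟩
    · refine Computes.exec_bind (Computes.exec_bind (Computes.exec_bind ?_))
      simp only [e, List.dropLast_concat, List.getLastD_concat]
      rw [if_neg hb]
      exact r1
    · rw [e, tick_cost]
      have t1 := hlin A₀
      have t2 := hlin b
      set K := k + s * (l + 1) ^ 2 with hK
      rw [← hldef] at r3
      -- In the unbalanced case the cost of the step is charged to the large class alone, since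
      -- `Λ.length ≤ 2 * big.length`; this is the origin of the factor 2 in the condition on `C₁`.
      have t3 : (A₀ + A₂ + b) * (Λ.length * (l + 1) * (s * μ s)) ≤
          2 * (A₀ + A₁ + A₂ + b) * (μ s * (big.length * K)) := by
        calc _ ≤ (A₀ + A₁ + A₂ + b) * ((2 * big.length) * (l + 1) * (s * μ s)) := by
              gcongr <;> omega
          _ = 2 * (A₀ + A₁ + A₂ + b) * (μ s * (big.length * (0 + s * (l + 1)))) := by ring
          _ ≤ _ := by
            rw [hK]
            gcongr
            · omega
            · nlinarith
      have t4 : (E * C₀ + 2 * (A₀ + A₁ + A₂ + b)) * (μ s * (big.length * K)) ≤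
          C₁ * (μ s * (big.length * K)) := by gcongr
      -- The small classes use up exactly their share of the budget; the surplus is in the share of
      -- the large class.
      have t5 : C₁ * (μ s * (Λ.length * K)) =
          C₁ * (μ s * (small.flatten.length * K)) + C₁ * (μ s * (big.length * K)) := by
        rw [← hl]; ring
      rw [add_mul, mul_assoc E] at t4
      rw [add_mul, add_mul] at t3
      omega

/-- The recursive term keeps the same constant `C` and only `k` decreases, so the overhead of
`Λ.length * (B * μ s)` is what one unit of `k` has to pay for. -/
theorem exists_halveStep_bound (hμ : IsMulCost μ) (d M : ℕ) : ∃ B, ∀ s, 1 ≤ s →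
    ∀ (k C : ℕ) (Λ : List (Pt d)) (Q : List (HPt d)) (p : Pt d),
    Admissible s (k + 1) Λ Q → p ∈ Λ → (∀ x ∈ Λ, (congrTwo p x).val = true) →
    Solves μ s k C M (Λ.map fun x => (halvePt p x).val) (Q.map fun q => (halveHPt μ p q).val) →
    ∃ S c, Computes (exec (mapT (halvePt p) Λ) >>= fun Λ' =>
            exec (mapT (halveHPt μ p) Q) >>= fun Q' =>
            equivariantFramesRec μ Λ' Q' >>= fun S' =>
            exec (mapT (mapT (doublePt p)) S')) S c ∧ IsOutput M Λ S ∧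
      c ≤ Λ.length * (B * μ s) +
        C * (μ s * (Λ.length * (k + s * (Nat.log 2 Λ.length + 1) ^ 2))) := by
  obtain ⟨A₁, h₁⟩ := exists_halvePt_bound hμ d 1
  obtain ⟨A₂, h₂⟩ := exists_halveHPt_bound hμ d (d + 4)
  obtain ⟨A₃, h₃⟩ := exists_doublePt_bound hμ d 1
  refine ⟨2 + A₁ + (1 + (d + 1) * (1 + A₂)) + (1 + M * (1 + (1 + M * (1 + A₃)))),
    fun s hs k C Λ Q p hadm hp hc h => ?_⟩
  have hw := hμ.one_le hs
  have hn : 1 ≤ Λ.length := List.length_pos_of_mem hp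
  have hadm' := hadm.halve (μ := μ) hp hc
  obtain ⟨S, c, r1, r2, r3⟩ := h
  have hS : ∀ V ∈ S, ∀ y ∈ V, ∃ x ∈ Λ, (halvePt p x).val = y := fun V hV y hy =>
    List.mem_map.1 (r2.subset V hV hy)
  refine ⟨S.map fun V => V.map fun x => (doublePt p x).val, _,
    Computes.exec_bind (Computes.exec_bind (Computes.bind (by exact r1) (by exact computes_exec _))),
    ⟨by simpa using r2.length_le, ?_, ?_, fun V => ?_⟩, ?_⟩
  · intro W hW
    obtain ⟨V, hV, rfl⟩ := List.mem_map.1 hW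
    simpa using r2.card_le V hV
  · intro W hW x hx
    obtain ⟨V, hV, rfl⟩ := List.mem_map.1 hW
    obtain ⟨y, hy, rfl⟩ := List.mem_map.1 hx
    obtain ⟨z, hz, rfl⟩ := hS V hV y hy
    rw [doublePt_halvePt (hc z hz)]
    exact hz
  · have hinj : Function.Injective fun V : List (Pt d) => V.map fun x => (doublePt p x).val :=
      List.map_injective_iff.2 (doublePt_injective p)
    by_cases hV : V ∈ S.map fun V => V.map fun x => (doublePt p x).val
    · obtain ⟨W, -, rfl⟩ := List.mem_map.1 hV
      rw [List.count_map_of_injective _ _ hinj]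
      exact r2.count_le W
    · rw [List.count_eq_zero_of_not_mem hV]
      exact Nat.zero_le _
  · rw [List.length_map] at r3
    have c1 : (mapT (halvePt p) Λ).cost ≤ Λ.length * ((2 + A₁) * μ s) := by
      refine (mapT_cost_le le_rfl fun x hx => h₁ s hs p x (by simpa using hadm.bits_le p hp)
        (by simpa using hadm.bits_le x hx)).trans ?_
      calc 1 + Λ.length * (1 + A₁ * μ s) ≤ Λ.length * μ s + Λ.length * (μ s + A₁ * μ s) := by
            gcongr
            exact Nat.mul_pos hn hw
        _ = _ := by ring
    have c2 : (mapT (halveHPt μ p) Q).cost ≤ Λ.length * ((1 + (d + 1) * (1 + A₂)) * μ s) := by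
      refine (mapT_cost_le hadm.length_le fun q hq => h₂ s hs p q (hadm.bits_pt p hp)
        (hadm.bits_hpt hs q hq)).trans ?_
      refine le_trans ?_ (Nat.le_mul_of_pos_left _ hn)
      calc 1 + (d + 1) * (1 + A₂ * μ s) ≤ μ s + (d + 1) * (μ s + A₂ * μ s) := by gcongr
        _ = _ := by ring
    have c3 : (mapT (mapT (doublePt p)) S).cost ≤
        Λ.length * ((1 + M * (1 + (1 + M * (1 + A₃)))) * μ s) := by
      refine (mapT_cost_le r2.length_le fun V hV => mapT_cost_le (r2.card_le V hV) fun x hx =>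
        h₃ s hs p x (by simpa using hadm.bits_le p hp)
          (by simpa using hadm'.bits_le x (r2.subset V hV hx))).trans ?_
      refine le_trans ?_ (Nat.le_mul_of_pos_left _ hn)
      calc 1 + M * (1 + (1 + M * (1 + A₃ * μ s))) ≤
          μ s + M * (μ s + (μ s + M * (μ s + A₃ * μ s))) := by gcongr
        _ = _ := by ring
    rw [add_mul, add_mul, mul_add, mul_add]
    omega

/-- The recursion terminates within the required bounds. -/
theorem exists_solves (hμ : IsMulCost μ) (d r : ℕ) : ∃ C M, ∀ s, 1 ≤ s →
    ∀ (k : ℕ) (Λ : List (Pt d)) (Q : List (HPt d)), Admissible s k Λ Q → Λ ≠ [] →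
    d + 2 ≤ Q.length + r → Solves μ s k C M Λ Q := by
  induction r with
  | zero =>
    -- A frame has at most `d + 1` points, so this case is empty.
    exact ⟨0, 0, fun s hs k Λ Q hadm _ h => by have := hadm.length_le; omega⟩
  | succ r ih =>
    obtain ⟨C₀, M₀, ih⟩ := ih
    obtain ⟨A₁, h₁⟩ := exists_minusSpan_bound hμ d (d + 4) (d + 1)
    obtain ⟨A₂, h₂⟩ := hμ.exists_op 1
    obtain ⟨A₃, h₃⟩ := exists_halveStep_bound hμ d (outputBound d M₀)
    obtain ⟨B, E, h₄⟩ := exists_splitStep_bound hμ d M₀ (outputBound d M₀)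
    let b₁ := 2 * A₁ + 2
    let b₂ := 2 + (1 + d * (2 * A₂))
    -- Here `b₁` accounts for the removal of the points in the span, `b₂` for the congruence test,
    -- and `A₃` for the halving. All constants on the right come from `d` and from the level of
    -- larger frames.
    let C := E * C₀ + 2 * (B + (b₁ + b₂)) + A₃
    refine ⟨C, outputBound d M₀, fun s hs => ?_⟩
    have hw := hμ.one_le hs
    have hM : 1 ≤ outputBound d M₀ := by
      unfold outputBound
      exact le_add_left (Nat.mul_pos (Nat.succ_pos _) (Nat.succ_pos _))
    -- With `Q` of the same size, the calls either have fewer points or a smaller `k`, so the sum of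
    -- the two is a measure of termination.
    suffices H : ∀ m k (Λ : List (Pt d)) (Q : List (HPt d)), Λ.length + k = m →
        Admissible s k Λ Q → Λ ≠ [] → d + 2 ≤ Q.length + (r + 1) →
        Solves μ s k C (outputBound d M₀) Λ Q from fun k Λ Q => H _ k Λ Q rfl
    intro m
    induction m using Nat.strong_induction_on with
    | _ m IH =>
    intro k Λ₀ Q hm hadm₀ hΛ0 hr
    have hn0 : 1 ≤ Λ₀.length := List.length_pos_iff.2 hΛ0
    have hsub := minusSpan_sublist μ Λ₀ Q
    have hspan : ∀ p ∈ (minusSpan μ Λ₀ Q).val, (inSpan μ (spanBasis μ Q).val p).val = false :=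
      fun p hp => not_inSpan_of_mem_minusSpan hp
    have hc₁ : (minusSpan μ Λ₀ Q).cost + (1 + (minusSpan μ Λ₀ Q).val.length) ≤
        Λ₀.length * (b₁ * μ s) := by
      have t1 := h₁ s hs Λ₀ Q hadm₀.length_le (hadm₀.bits_hpt hs) hadm₀.bits_pt
      calc _ ≤ (Λ₀.length + 1) * (A₁ * μ s) + (1 + Λ₀.length) :=
            Nat.add_le_add t1 (Nat.add_le_add_left hsub.length_le 1)
        _ ≤ (Λ₀.length + Λ₀.length) * (A₁ * μ s) + (Λ₀.length * μ s + Λ₀.length * μ s) := by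
            gcongr
            · exact Nat.mul_pos hn0 hw
            · exact Nat.le_mul_of_pos_right _ hw
        _ = _ := by ring
    generalize hΛ : (minusSpan μ Λ₀ Q).val = Λ at hsub hspan hc₁
    have hlen := hsub.length_le
    have hadm := hadm₀.subset (hsub.nodup hadm₀.nodup) hsub.subset
    have hK1 : 1 ≤ k + s * (Nat.log 2 Λ₀.length + 1) ^ 2 :=
      (Nat.mul_pos hs (pow_pos (Nat.succ_pos _) 2)).trans_le (Nat.le_add_left _ _)
    have hb₁C : b₁ ≤ C := by dsimp only [C]; omega
    have hshort : ∀ V : List (Pt d), V.length ≤ 1 → V ⊆ Λ₀ →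
        Computes (equivariantFramesRec μ Λ₀ Q) [V]
          ((minusSpan μ Λ₀ Q).cost + ((tick (1 + Λ.length)).cost + 0)) →
        Solves μ s k C (outputBound d M₀) Λ₀ Q := fun V hV hV' hc => by
      refine ⟨_, _, hc, isOutput_singleton hM hV hV', ?_⟩
      rw [tick_cost, add_zero]
      calc _ ≤ Λ₀.length * (b₁ * μ s) := hc₁
        _ = b₁ * (μ s * (Λ₀.length * 1)) := by ring
        _ ≤ _ := by gcongr
    -- The `j` points removed with the span pay for themselves from their share of the budget, so it
    -- is enough to stay within the budget of the remaining ones.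
    have hlong : ∀ S c, Computes (equivariantFramesRec μ Λ₀ Q) S
          ((minusSpan μ Λ₀ Q).cost + ((tick (1 + Λ.length)).cost + c)) →
        IsOutput (outputBound d M₀) Λ S → c + Λ.length * (b₁ * μ s) ≤
          C * (μ s * (Λ.length * (k + s * (Nat.log 2 Λ.length + 1) ^ 2))) →
        Solves μ s k C (outputBound d M₀) Λ₀ Q := fun S c hc hS hcost => by
      refine ⟨_, _, hc, hS.mono le_rfl hsub.subset, ?_⟩
      rw [tick_cost]
      obtain ⟨j, hj⟩ := Nat.exists_eq_add_of_le hlen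
      have hlog : Nat.log 2 Λ.length ≤ Nat.log 2 Λ₀.length := Nat.log_mono_right hlen
      have t1 : C * (μ s * (Λ.length * (k + s * (Nat.log 2 Λ.length + 1) ^ 2))) ≤
          C * (μ s * (Λ.length * (k + s * (Nat.log 2 Λ₀.length + 1) ^ 2))) := by gcongr
      have t2 : j * (b₁ * μ s) ≤
          C * (μ s * (j * (k + s * (Nat.log 2 Λ₀.length + 1) ^ 2))) := by
        calc j * (b₁ * μ s) = b₁ * (μ s * (j * 1)) := by ring
          _ ≤ _ := by gcongr
      have t3 : Λ₀.length * (b₁ * μ s) = Λ.length * (b₁ * μ s) + j * (b₁ * μ s) := by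
        rw [hj]; ring
      have t4 : C * (μ s * (Λ₀.length * (k + s * (Nat.log 2 Λ₀.length + 1) ^ 2))) =
          C * (μ s * (Λ.length * (k + s * (Nat.log 2 Λ₀.length + 1) ^ 2))) +
          C * (μ s * (j * (k + s * (Nat.log 2 Λ₀.length + 1) ^ 2))) := by
        generalize k + s * (Nat.log 2 Λ₀.length + 1) ^ 2 = K
        rw [hj]; ring
      omega
    rcases Λ with _ | ⟨p, _ | ⟨q, l⟩⟩
    · refine hshort [] (by simp) (by simp) ?_
      rw [equivariantFramesRec_eq]
      refine Computes.exec_bind ?_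
      rw [hΛ]
      exact Computes.exec_bind (computes_pure _)
    · refine hshort [p] (by simp) hsub.subset ?_
      rw [equivariantFramesRec_eq]
      refine Computes.exec_bind ?_
      rw [hΛ]
      exact Computes.exec_bind (computes_pure _)
    · have hcong : (allT (congrTwo p) (p :: q :: l)).cost ≤
          (p :: q :: l).length * (b₂ * μ s) := by
        have t := allT_cost_le (l := p :: q :: l) (f := congrTwo p) le_rfl fun x hx =>
          congrTwo_cost_le (hadm.bits_le p (by simp)) (hadm.bits_le x hx)
            (h₂ s hs s (by omega)).1
        refine t.trans ?_
        generalize hn : (p :: q :: l).length = n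
        have hn1 : 1 ≤ n := by rw [← hn]; simp
        calc 1 + n * (1 + (1 + d * (2 * (A₂ * μ s)))) ≤
            n * μ s + n * (μ s + (μ s + d * (2 * (A₂ * μ s)))) := by
              gcongr
              exact Nat.mul_pos hn1 hw
          _ = _ := by ring
      have hcomp : ∀ S c, Computes
          (if (allT (congrTwo p) (p :: q :: l)).val = true then
            exec (mapT (halvePt p) (p :: q :: l)) >>= fun Λ' =>
            exec (mapT (halveHPt μ p) Q) >>= fun Q' =>
            equivariantFramesRec μ Λ' Q' >>= fun S' =>
            exec (mapT (mapT (doublePt p)) S')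
          else splitStep μ (p :: q :: l) Q) S c →
          Computes (equivariantFramesRec μ Λ₀ Q) S ((minusSpan μ Λ₀ Q).cost +
            ((tick (1 + (p :: q :: l).length)).cost +
              ((allT (congrTwo p) (p :: q :: l)).cost + c))) := fun S c h => by
        rw [equivariantFramesRec_eq]
        refine Computes.exec_bind ?_
        rw [hΛ]
        exact Computes.exec_bind (Computes.exec_bind h)
      have hlen2 : 2 ≤ (p :: q :: l).length := by simp
      have hpΛ : p ∈ p :: q :: l := by simp
      generalize p :: q :: l = Λ at *
      by_cases hsame : (allT (congrTwo p) Λ).val = true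
      · have hall : ∀ x ∈ Λ, (congrTwo p x).val = true := by
          rw [allT_val, List.all_eq_true] at hsame
          exact hsame
        rcases k with _ | k
        -- For `k = 0` all points coincide, so a halving can only occur with `k` positive.
        · have := hadm.length_le_one
          omega
        · obtain ⟨S, c, r1, r2, r3⟩ := h₃ s hs k C Λ Q p hadm hpΛ hall
            (IH (Λ.length + k) (by omega) k _ _ (by simp) (hadm.halve hpΛ hall)
              (by simpa using List.ne_nil_of_mem hpΛ) (by simpa using hr))
          refine hlong S _ (hcomp S c (by rw [if_pos hsame]; exact r1)) r2 ?_
          have t1 : Λ.length * ((b₁ + b₂ + A₃) * μ s) +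
              C * (μ s * (Λ.length * (k + s * (Nat.log 2 Λ.length + 1) ^ 2))) ≤
              C * (μ s * (Λ.length * (k + 1 + s * (Nat.log 2 Λ.length + 1) ^ 2))) := by
            calc _ ≤ Λ.length * (C * μ s) +
                C * (μ s * (Λ.length * (k + s * (Nat.log 2 Λ.length + 1) ^ 2))) := by
                  gcongr
                  dsimp only [C]
                  omega
              _ = _ := by ring
          rw [add_mul, add_mul, mul_add, mul_add] at t1
          omega
      · have hne : ∃ p ∈ Λ, ∃ q ∈ Λ, ¬ Congr p q := by
          by_contra! hcon
          refine hsame ?_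
          rw [allT_val, List.all_eq_true]
          exact fun x hx => (congrTwo_val p x).2 (hcon p hpΛ x hx)
        obtain ⟨S, c, r1, r2, r3⟩ := h₄ s hs k C₀ C Λ Q hadm hspan hne
          (fun c hc0 hcΛ hcn hcl => IH (c.length + k) (by omega) k c Q rfl
            (hadm.subset hcn hcΛ) hc0 hr)
          (fun c R hc0 hcΛ hcn hR0 hRΛ hRl => ih s hs k c _
            ((hadm.join hs hRΛ hRl).subset hcn hcΛ) hc0 (by
              have := List.length_pos_iff.2 hR0
              rw [List.length_append, List.length_map]
              omega))
        refine hlong S _ (hcomp S c (by rw [if_neg hsame]; exact r1)) r2 ?_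
        have t1 := r3 (b₁ + b₂) (by dsimp only [C]; omega)
        rw [add_mul, mul_add] at t1
        omega

/-! ### Homogeneous coordinates -/

theorem homogenize_val (μ : ℕ → ℕ) (q : Fin d → ℚ) (k : Fin (d + 1)) :
    (homogenize μ q).val k = ∏ j, if k = Fin.succ j then (q j).num else ((q j).den : ℤ) := by
  have key : ∀ (f : Fin d → ℤ) (l : List (Fin d)) (b : ℤ),
      (foldT (fun acc j => mulI μ acc (f j)) b l).val = b * (l.map f).prod := by
    intro f l
    induction l with
    | nil => intro b; simp [foldT]
    | cons a l ih => intro b; rw [foldT_cons, ih]; simp [mul_assoc]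
  have := key (fun j => if k = Fin.succ j then (q j).num else ((q j).den : ℤ)) (List.finRange d) 1
  rw [one_mul, ← List.ofFn_eq_map, List.prod_ofFn] at this
  exact this

theorem exists_homogenize_bound (hμ : IsMulCost μ) (d : ℕ) : ∃ C, ∀ s, 1 ≤ s →
    ∀ q : Fin d → ℚ, (∀ i, (q i).num.natAbs.size ≤ s ∧ (q i).den.size ≤ s) →
    (homogenize μ q).cost ≤ C * μ s := by
  obtain ⟨C, hC⟩ := hμ.exists_op (d + 1)
  refine ⟨(d + 1) * (1 + (1 + d * (1 + C))), fun s hs q hq => ?_⟩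
  have hw := hμ.one_le hs
  have key := vecT_cost_le (f := fun k : Fin (d + 1) => foldT
    (fun acc j => mulI μ acc (if k = Fin.succ j then (q j).num else ((q j).den : ℤ)))
    1 (List.finRange d)) (c := 1 + d * (1 + C * μ s)) (D := d + 1) (by simp) fun k => by
      have hf : ∀ j, bits (if k = Fin.succ j then (q j).num else ((q j).den : ℤ)) ≤ s := by
        intro j
        split
        · exact (hq j).1
        · exact (hq j).2
      have := (foldT_le (f := fun acc j => mulI μ acc (if k = Fin.succ j then (q j).num else
          ((q j).den : ℤ))) (fun i b => bits b ≤ 1 + i * s) (c := C * μ s) (N := d)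
        (l := List.finRange d) (fun i b j _ hi hb => by
          have h1 : bits b ≤ (d + 1) * s := by
            refine hb.trans ?_
            rw [add_mul, one_mul, add_comm]
            gcongr
          refine ⟨(bits_mul_le hb (hf j)).trans (by rw [add_mul]; omega),
            mulI_cost_le hμ h1 ((hf j).trans (Nat.le_mul_of_pos_left _ (Nat.succ_pos _)))
              (hC s hs _ le_rfl).2⟩) (b := 1) (i := 0) (by simp [bits_one]) (by simp)).2
      simpa using this
  refine key.trans ?_
  calc (d + 1) * (1 + (1 + d * (1 + C * μ s))) ≤
      (d + 1) * (μ s + (μ s + d * (μ s + C * μ s))) := by gcongr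
    _ = _ := by ring

/-- The product of the denominators is at most `2 ^ (d * s)`, and differences of lattice points are
below `2 ^ (s + 1)`; together this explains the exponent `(d + 2) * s` in the invariant. Affine
independence serves to bound the number of frame points by `d + 1`. -/
theorem admissible_homogenize (μ : ℕ → ℕ) {s : ℕ} (hs : 1 ≤ s) {Λ : List (Pt d)}
    {Q : List (Fin d → ℚ)} (hn : Λ.Nodup) (hQ : AffineIndependent ℚ Q.get)
    (hΛ : ∀ p ∈ Λ, ∀ i, (p i).natAbs.size ≤ s)
    (hq : ∀ q ∈ Q, ∀ i, (q i).num.natAbs.size ≤ s ∧ (q i).den.size ≤ s) :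
    Admissible s (s + 1) Λ (Q.map fun q => (homogenize μ q).val) := by
  have hden : ∀ q ∈ Q, ∀ i, ((q i).den : ℤ) ≤ 2 ^ s := fun q h i => by
    exact_mod_cast (Nat.size_le.1 (hq q h i).2).le
  have hpos : ∀ (q : Fin d → ℚ) i, (0 : ℤ) < (q i).den := fun q i => by
    exact_mod_cast (q i).den_pos
  have h0 : ∀ q : Fin d → ℚ, (homogenize μ q).val 0 = ∏ j, ((q j).den : ℤ) := fun q => by
    rw [homogenize_val]
    exact Finset.prod_congr rfl fun j _ => if_neg (Fin.succ_ne_zero j).symm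
  refine ⟨hn, le_rfl, hΛ, fun p hp q hq i => ?_, ?_, ?_, ?_, ?_⟩
  · have h1 := abs_lt_of_bits_le (hΛ p hp i)
    have h2 := abs_lt_of_bits_le (hΛ q hq i)
    have h3 := abs_sub (p i) (q i)
    rw [pow_succ]
    linarith
  all_goals try
    intro x hx
    obtain ⟨q, hqQ, rfl⟩ := List.mem_map.1 hx
  · rw [h0]
    exact Finset.prod_pos fun j _ => hpos q j
  · rw [h0]
    have h1 : ∏ j, ((q j).den : ℤ) ≤ ∏ _j : Fin d, 2 ^ s :=
      Finset.prod_le_prod (fun j _ => (hpos q j).le) fun j _ => hden q hqQ j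
    rw [Finset.prod_const, Finset.card_univ, Fintype.card_fin, ← pow_mul] at h1
    calc _ ≤ (2 : ℤ) ^ (s * d) * 2 ^ (s + 1) := by gcongr
      _ = 2 ^ (s * d + (s + 1)) := (pow_add _ _ _).symm
      _ ≤ _ := pow_le_pow_right₀ (by norm_num) (by nlinarith)
  · intro i
    rw [h0, homogenize_val, Finset.abs_prod]
    have h1 : ∏ j, |if i.succ = Fin.succ j then (q j).num else ((q j).den : ℤ)| ≤
        ∏ j, ((q j).den : ℤ) * if i = j then 2 ^ s else 1 := by
      refine Finset.prod_le_prod (fun j _ => abs_nonneg _) fun j _ => ?_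
      by_cases hij : i = j
      · subst hij
        rw [if_pos rfl, if_pos rfl]
        refine (abs_lt_of_bits_le (hq q hqQ i).1).le.trans ?_
        exact le_mul_of_one_le_left (by positivity) (hpos q i)
      · rw [if_neg fun h => hij (Fin.succ_injective _ h), if_neg hij, mul_one,
          abs_of_pos (hpos q j)]
    rwa [Finset.prod_mul_distrib, Finset.prod_ite_eq, if_pos (Finset.mem_univ i)] at h1
  · rw [List.length_map]
    have h1 := hQ.card_le_finrank_succ
    rw [Fintype.card_fin] at h1
    have h2 := Submodule.finrank_le (vectorSpan ℚ (Set.range Q.get))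
    rw [Module.finrank_fin_fun] at h2
    omega

end LatticeFrames

/-! ### The running time of the algorithm -/

theorem mainTheorem2 (d : ℕ) (μ : ℕ → ℕ) (hμ_mono : Monotone μ)
    (hμ_linear : ∃ c : ℕ, ∀ s, s ≤ c * μ s)
    (hμ_double : ∃ K : ℕ, ∀ s, μ (2 * s) ≤ K * μ s) :
    ∃ C : ℝ, ∀ (Λ : List (Fin d → ℤ)) (Q : List (Fin d → ℚ)) (s : ℕ),
      Λ.Nodup → 2 ≤ Λ.length → AffineIndependent ℚ Q.get →
      (∀ p ∈ Λ, ∀ i, (p i).natAbs.size ≤ s) →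
      (∀ q ∈ Q, ∀ i, (q i).num.natAbs.size ≤ s ∧ (q i).den.size ≤ s) →
      ∃ (S : List (List (Fin d → ℤ))) (t : ℕ),
        (LatticeFrames.equivariantFrames2 μ Λ Q).run 0 = some (S, t) ∧
        (t : ℝ) ≤ C * ((Λ.length : ℝ) * Real.logb 2 Λ.length ^ 2 * s * μ s) := by
  have hμ : LatticeFrames.IsMulCost μ := ⟨hμ_mono, hμ_linear, hμ_double⟩
  obtain ⟨A, hA⟩ := LatticeFrames.exists_homogenize_bound hμ d
  obtain ⟨C, M, hC⟩ := LatticeFrames.exists_solves hμ d (d + 2)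
  refine ⟨((1 + (d + 1) * (1 + A) + 6 * C : ℕ) : ℝ), fun Λ Q s hn hlen hQ hΛ hq => ?_⟩
  -- With zero bits every coordinate would vanish, contrary to the existence of two distinct points.
  have hs : 1 ≤ s := by
    by_contra hs
    have hs0 : s = 0 := by omega
    rcases Λ with _ | ⟨p, _ | ⟨q, l⟩⟩
    · simp at hlen
    · simp at hlen
    · have h0 : ∀ x ∈ p :: q :: l, x = 0 := fun x hx => funext fun i => by
        have := hΛ x hx i
        rw [hs0, Nat.size_le, pow_zero] at this
        simpa using this
      rw [List.nodup_cons, h0 p (by simp), h0 q (by simp)] at hn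
      exact hn.1 (by simp)
  have hw := hμ.one_le hs
  have hadm := LatticeFrames.admissible_homogenize μ hs hn hQ hΛ hq
  -- The recursion starts with `k = s + 1`; the parameter `d + 2` of the outer induction allows for
  -- an empty frame.
  obtain ⟨S, c, r1, -, r3⟩ := hC s hs (s + 1) Λ _ hadm
    (List.ne_nil_of_length_pos (by omega)) (by omega)
  refine ⟨S, 0 + ((LatticeFrames.mapT (LatticeFrames.homogenize μ) Q).cost + c),
    LatticeFrames.Computes.exec_bind (x := LatticeFrames.mapT (LatticeFrames.homogenize μ) Q) r1 0,
    ?_⟩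
  have hcost : (LatticeFrames.mapT (LatticeFrames.homogenize μ) Q).cost ≤
      (1 + (d + 1) * (1 + A)) * μ s := by
    have hl : Q.length ≤ d + 1 := by simpa using hadm.length_le
    refine (LatticeFrames.mapT_cost_le hl fun q h => hA s hs q (hq q h)).trans ?_
    calc 1 + (d + 1) * (1 + A * μ s) ≤ μ s + (d + 1) * (μ s + A * μ s) := by gcongr
      _ = _ := by ring
  have h1 : (0 + ((LatticeFrames.mapT (LatticeFrames.homogenize μ) Q).cost + c) : ℕ) ≤
      (1 + (d + 1) * (1 + A)) * μ s +
        C * (μ s * (Λ.length * (s + 1 + s * (Nat.log 2 Λ.length + 1) ^ 2))) := by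
    omega
  have hlog : (Nat.log 2 Λ.length : ℝ) ≤ Real.logb 2 Λ.length := by
    exact_mod_cast Real.natLog_le_logb Λ.length 2
  have hL : (1 : ℝ) ≤ Real.logb 2 Λ.length := by
    rw [Real.le_logb_iff_rpow_le (by norm_num) (by positivity), Real.rpow_one]
    exact_mod_cast hlen
  have hn1 : (1 : ℝ) ≤ Λ.length := by exact_mod_cast (by omega : 1 ≤ Λ.length)
  have hs1 : (1 : ℝ) ≤ s := by exact_mod_cast hs
  set L := Real.logb 2 Λ.length
  have hL2 : 1 ≤ L ^ 2 := one_le_pow₀ hL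
  have h2 : ((Nat.log 2 Λ.length : ℝ) + 1) ^ 2 ≤ 4 * L ^ 2 := by
    calc _ ≤ (L + L) ^ 2 := by gcongr
      _ = _ := by ring
  -- As `n ≥ 2` gives `L ≥ 1`, the terms `s` and `1` contribute at most one multiple of `L ^ 2 * s`
  -- each, and the square contributes four.
  have h3 : (s : ℝ) + 1 + s * ((Nat.log 2 Λ.length : ℝ) + 1) ^ 2 ≤ 6 * (L ^ 2 * s) := by
    have h4 : (s : ℝ) ≤ L ^ 2 * s := le_mul_of_one_le_left (by positivity) hL2
    have h5 : (s : ℝ) * ((Nat.log 2 Λ.length : ℝ) + 1) ^ 2 ≤ s * (4 * L ^ 2) := by gcongr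
    linarith
  have h6 : (1 : ℝ) ≤ Λ.length * L ^ 2 * s :=
    one_le_mul_of_one_le_of_one_le (one_le_mul_of_one_le_of_one_le hn1 hL2) hs1
  have h7 : ((0 + ((LatticeFrames.mapT (LatticeFrames.homogenize μ) Q).cost + c) : ℕ) : ℝ) ≤
      (1 + (d + 1) * (1 + A)) * μ s +
        C * (μ s * (Λ.length * (s + 1 + s * ((Nat.log 2 Λ.length : ℝ) + 1) ^ 2))) := by
    exact_mod_cast h1
  refine h7.trans ?_
  push_cast
  calc _ ≤ (1 + ((d : ℝ) + 1) * (1 + A)) * (1 * μ s) +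
        C * (μ s * (Λ.length * (6 * (L ^ 2 * s)))) := by rw [one_mul]; gcongr
    _ ≤ (1 + ((d : ℝ) + 1) * (1 + A)) * (Λ.length * L ^ 2 * s * μ s) +
        C * (μ s * (Λ.length * (6 * (L ^ 2 * s)))) := by gcongr
    _ = _ := by ring
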